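/- **Setting.** Let $R$ be an irreducible reduced crystallographic root system with simple roots $\alpha_1,\dots,\alpha_n$, Weyl group $W$ and $W$-invariant form $(\cdot,\cdot)$ normalized by $(\alpha,\alpha)=2$ for short roots; $\nu_\alpha=(\alpha,\alpha)/2$, $\nu_R=\{\nu_\alpha\}$, $\alpha^\vee=\alpha/\nu_\alpha$, $P$ the weight lattice, $P_+$ the dominant weights, $\rho^\vee_\nu=\frac12\sum_{\alpha>0,\,\nu_\alpha=\nu}\alpha^\vee$, $\vartheta$ the maximal short root. Work over $\mathbb K=\mathbb Q(q^{1/2m},t_\nu^{1/2}\,(\nu\in\nu_R))(X_b,\ b\in P)$, where $X_{a+b}=X_aX_b$ and $(P,P)=\frac1m\mathbb Z$. Put $X_{\tilde\alpha}=X_\alpha q^{\nu_\alpha j}$ and $t_{\tilde\alpha}=t_{\nu_\alpha}$ for an affine root $\tilde\alpha=[\alpha,\nu_\alpha j]$ ($\alpha\in R$, $j\in\mathbb Z$), and let $\alpha_0=[-\vartheta,1]$. The group $\widehat W=P\rtimes W$ acts on affine roots by $(bw)([z,\zeta])=[w(z),\zeta-(w(z),b)]$ and correspondingly on $\mathbb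 K$: $w(X_z)=X_{w(z)}$, and $b$ acts as $\Gamma_{-b}$, where $\Gamma_b(X_z)=q^{(b,z)}X_z$. Let $s_{\tilde\alpha}\in\widehat W$ be the reflections, $s_i=s_{\alpha_i}$ ($0\le i\le n$), and $\Pi\subset\widehat W$ the subgroup preserving $\{\alpha_0,\dots,\alpha_n\}$. In the algebra of operators $\sum_{\hat w\in\widehat W}g_{\hat w}\hat w$ ($g_{\hat w}\in\mathbb K$) put $$T_i=t_i^{1/2}s_i+\frac{t_i^{1/2}-t_i^{-1/2}}{X_{\alpha_i}-1}(s_i-1),\qquad t_i=t_{\alpha_i},$$ so that $T_i^{-1}=T_i-(t_i^{1/2}-t_i^{-1/2})$, and $$G^+_{\tilde\alpha}=t_\alpha^{-1/2}(f_{\tilde\alpha}+g_{\tilde\alpha}s_{\tilde\alpha}),\quad G^-_{\tilde\alpha}=t_\alpha^{-1/2}(f_{\tilde\alpha}-s_{\tilde\alpha}g_{\tilde\alpha}),\quad f_{\tilde\alpha}=\frac{t_\alpha X_{\tilde\alpha}^{-1}-1}{X_{\tilde\alpha}^{-1}-1},\quad g_{\tilde\alpha}=\frac{t_\alpha-1}{1-X_{\tilde\alpha}^{-1}}.$$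 Let $b\in P_+$, let $b=\pi s_{j_l}\cdots s_{j_1}$ be any reduced decomposition ($\pi\in\Pi$, $l$ minimal), $Y_b=\pi T_{j_l}\cdots T_{j_1}$, and $\tilde\alpha^p=s_{j_1}\cdots s_{j_{p-1}}(\alpha_{j_p})$ for $1\le p\le l$. **Spinors.** $W$-spinors are the functions $W\to\mathbb K$ with pointwise operations; $\zeta_u$ is the characteristic function of $u\in W$, and $\delta(v)$ acts on spinors by $(\delta(v)F)(u)=F(v^{-1}u)$. Spinor operators are the finite sums $A=\sum_{c\in P,\,v\in W}F_{c,v}\Gamma_c\delta(v)$ with spinors $F_{c,v}$, where $\Gamma_c$ acts on spinors pointwise and commutes with $\delta(v)$. Let $\varphi$ be the homomorphism with $\varphi(g\,\Gamma_c\,v)=\sum_{u\in W}u^{-1}(g)\,\zeta_u\,\Gamma_{u^{-1}(c)}\,\delta(v)$. Let $æ^\delta(L)$ be obtained from $\varphi(L)$ by conjugation by $X_{\rho_k}\Gamma_{-\rho_k}$, that is, by replacing $$X_z\mapsto\prod_\nu t_\nu^{-(\rho_\nu^\vee,z)}X_z,\qquad \Gamma_c\mapsto\prod_\nu t_\nu^{-(\rho_\nu^\vee,c)}\Gamma_c$$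 with $\zeta_u$ and $\delta(v)$ unchanged. Let $RE^\delta(L)=\lim_{t\to0}æ^\delta(L)$, taken coefficientwise; the limit of a coefficient $c\in\mathbb K$ exists if $c=p/d$ with $p,d$ polynomial in all $t_\nu^{1/2}$ (with coefficients Laurent polynomials in $X$ and $q^{1/2m}$) and $d\ne0$ at $t=0$, and then it equals $p/d$ evaluated with all $t_\nu^{1/2}=0$. For $w\in W$ and $\nu\in\nu_R$ let $\mathrm{ord}^\nu_w(A)$ be the minimum of the $t_\nu$-orders of the components $F_{c,v}(w)$, and let ${}^\dagger\mathrm{ord}^\nu_w(A)$ be the same minimum computed after writing $A=\sum\delta(v)F'_{c,v}\Gamma_c$, i.e. with $F'_{c,v}(w)=F_{c,v}(vw)$ in place of $F_{c,v}(w)$. **Corollary 5.2.** One has $Y_bY_b^{-1}=Y_b^{-1}Y_b=1$ for $Y_b^{-1}=T_{j_1}^{-1}\cdots T_{j_l}^{-1}\pi^{-1}$, and $$b^{-1}Y_b=G^+_{\tilde\alpha^l}\cdots G^+_{\tilde\alpha^1},\qquad Y_b^{-1}b=G^-_{-\tilde\alpha^1}\cdots G^-_{-\tilde\alpha^l}.$$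 Expand these two right-hand sides into $2^l$ products each by choosing one of the two terms of every factor $G^\pm$. Then, for all $w\in W$ and $\nu\in\nu_R$: 1. every product $h$ in the expansion of $b^{-1}Y_b$ satisfies $\mathrm{ord}^\nu_w(æ^\delta(h))\ge\mathrm{ord}^\nu_w(æ^\delta(\Gamma_b))$; 2. every product $h$ in the expansion of $Y_b^{-1}b$ satisfies ${}^\dagger\mathrm{ord}^\nu_w(æ^\delta(h))\ge\mathrm{ord}^\nu_w(æ^\delta(\Gamma_{-b}))$; 3. the limits $\widehat Y_b=RE^\delta(Y_b)$ and $\widehat Y_b'=RE^\delta(Y_b^{-1})$ exist, are unique, and satisfy $\widehat Y_b\widehat Y_b'=\widehat Y_b'\widehat Y_b=1$; 4. the $RE^\delta$-limits of all individual products in the expansions of $Y_b$ and $Y_b^{-1}$ exist and are unique: $RE^\delta(b\,h)$ for $h$ as in 1, and $RE^\delta(h\,b^{-1})$ for $h$ as in 2. -/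

import Mathlib

open scoped Classical

noncomputable section

namespace TodaDunkl

/-! ### Fields of fractions of group algebras of lattices -/

section Frac

variable {A : Type*} [AddCommGroup A] [TwoUniqueSums A]

instance : IsDomain (AddMonoidAlgebra ℚ A) := NoZeroDivisors.to_isDomain _

/-- The field of fractions of the group algebra `ℚ[A]`. -/
abbrev Frac (A : Type*) [AddCommGroup A] [TwoUniqueSums A] : Type _ :=
  FractionRing (AddMonoidAlgebra ℚ A)

/-- The field automorphism of `Frac A` induced by an automorphism of the lattice `A`. -/
def fracMap (e : A ≃+ A) : Frac A ≃+* Frac A :=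
  IsFractionRing.ringEquivOfRingEquiv (AddMonoidAlgebra.domCongr ℚ ℚ e).toRingEquiv

theorem fracMap_algebraMap (e : A ≃+ A) (p : AddMonoidAlgebra ℚ A) :
    fracMap e (algebraMap _ (Frac A) p) =
      algebraMap _ (Frac A) (AddMonoidAlgebra.domCongr ℚ ℚ e p) := by
  simp [fracMap]

theorem fracMap_refl (x : Frac A) : fracMap (AddEquiv.refl A) x = x := by
  have h : (fracMap (AddEquiv.refl A)).toRingHom = RingHom.id (Frac A) := by
    refine IsLocalization.ringHom_ext (nonZeroDivisors (AddMonoidAlgebra ℚ A)) ?_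
    refine RingHom.ext fun p => ?_
    have := fracMap_algebraMap (AddEquiv.refl A) p
    rw [AddMonoidAlgebra.domCongr_refl] at this
    simpa using this
  exact congrArg (fun f : Frac A →+* Frac A => f x) h

theorem fracMap_trans (e f : A ≃+ A) (x : Frac A) :
    fracMap (e.trans f) x = fracMap f (fracMap e x) := by
  have h : (fracMap (e.trans f)).toRingHom =
      (fracMap f).toRingHom.comp (fracMap e).toRingHom := by
    refine IsLocalization.ringHom_ext (nonZeroDivisors (AddMonoidAlgebra ℚ A)) ?_
    refine RingHom.ext fun p => ?_
    have h1 := fracMap_algebraMap (e.trans f) p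
    have h2 : AddMonoidAlgebra.domCongr ℚ ℚ (e.trans f) p =
        AddMonoidAlgebra.domCongr ℚ ℚ f (AddMonoidAlgebra.domCongr ℚ ℚ e p) := by
      rw [← AddMonoidAlgebra.trans_domCongr_domCongr]; rfl
    rw [h2, ← fracMap_algebraMap, ← fracMap_algebraMap] at h1
    simpa using h1
  exact congrArg (fun f : Frac A →+* Frac A => f x) h

end Frac

/-! ### Root systems, weights, lengths -/

/-- An irreducible reduced crystallographic root system `R ⊂ M` over `ℝ` (roots indexed by `ι`)
with a choice `base` of simple roots, the invariant form `B`, normalized by `(α, α) = 2` for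
the short roots, and the maximal short root `θ`. -/
structure Setup (ι M N : Type*) [Fintype ι] [AddCommGroup M] [Module ℝ M]
    [AddCommGroup N] [Module ℝ N] where
  /-- the root system -/
  P : RootPairing ι ℝ M N
  isRootSystem : P.IsRootSystem
  isCrystallographic : P.IsCrystallographic
  isReduced : P.IsReduced
  isIrreducible : P.IsIrreducible
  /-- the simple roots -/
  base : P.Base
  /-- the `W`-invariant form -/
  B : P.InvariantForm
  /-- normalization: the smallest value of `(α, α)` on roots is `2` -/
  two_le : ∀ i, 2 ≤ B.form (P.root i) (P.root i)
  exists_eq_two : ∃ i, B.form (P.root i) (P.root i) = 2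
  /-- the maximal short root -/
  θ : ι
  θ_short : B.form (P.root θ) (P.root θ) = 2
  θ_max : ∀ i, B.form (P.root i) (P.root i) = 2 →
    P.root θ - P.root i ∈ AddSubmonoid.closure (P.root '' base.support)

attribute [instance] Setup.isRootSystem Setup.isCrystallographic Setup.isReduced
  Setup.isIrreducible

namespace Setup

variable {ι M N : Type*} [Fintype ι] [AddCommGroup M] [Module ℝ M] [AddCommGroup N] [Module ℝ N]
  (S : Setup ι M N)

/-- The finite Weyl group `W`. -/
abbrev W : Type _ := S.P.weylGroup

/-- The weight lattice `P`: vectors having integral pairings with all coroots. -/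
def weights : AddSubgroup M where
  carrier := {x | ∀ i, ∃ n : ℤ, S.P.toLinearMap x (S.P.coroot i) = n}
  zero_mem' := fun i => ⟨0, by simp⟩
  add_mem' := fun {x y} hx hy i => by
    obtain ⟨m, hm⟩ := hx i
    obtain ⟨n, hn⟩ := hy i
    exact ⟨m + n, by simp [hm, hn]⟩
  neg_mem' := fun {x} hx i => by
    obtain ⟨m, hm⟩ := hx i
    exact ⟨-m, by simp [hm]⟩

/-- The weight lattice as a type. -/
abbrev Wt : Type _ := S.weights

/-- The integer `(b, αᵢ^∨)` for a weight `b`. -/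
def cop (i : ι) : S.Wt →+ ℤ where
  toFun b := ⌊S.P.toLinearMap (b : M) (S.P.coroot i)⌋
  map_zero' := by simp
  map_add' a b := by
    obtain ⟨m, hm⟩ := a.2 i
    obtain ⟨n, hn⟩ := b.2 i
    rw [AddSubgroup.coe_add, map_add, LinearMap.add_apply, hm, hn, ← Int.cast_add]
    simp only [Int.floor_intCast]

theorem cop_cast (i : ι) (b : S.Wt) :
    ((S.cop i b : ℤ) : ℝ) = S.P.toLinearMap (b : M) (S.P.coroot i) := by
  obtain ⟨n, hn⟩ := b.2 i
  change ((⌊S.P.toLinearMap (b : M) (S.P.coroot i)⌋ : ℤ) : ℝ) = _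
  rw [hn, Int.floor_intCast]

theorem root_mem_weights (i : ι) : S.P.root i ∈ S.weights := fun j => by
  obtain ⟨n, hn⟩ := S.P.exists_value (S := ℤ) i j
  exact ⟨n, hn.symm.trans (by simp)⟩

/-- A root as a weight. -/
def rootWt (i : ι) : S.Wt := ⟨S.P.root i, S.root_mem_weights i⟩

/-- The dominant weights `P₊`. -/
def IsDominant (b : S.Wt) : Prop := ∀ i ∈ S.base.support, 0 ≤ S.cop i b

theorem smul_mem_weights (w : S.W) {x : M} (hx : x ∈ S.weights) : w • x ∈ S.weights := by
  obtain ⟨g, hg⟩ := w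
  change g • x ∈ S.weights
  induction hg using RootPairing.weylGroup.induction generalizing x with
  | mem i =>
    rw [RootPairing.Equiv.reflection_smul, RootPairing.reflection_apply]
    obtain ⟨n, hn⟩ := hx i
    have h : S.P.coroot' i x = n := by simpa using hn
    rw [h, Int.cast_smul_eq_zsmul]
    exact S.weights.sub_mem hx (S.weights.zsmul_mem (S.root_mem_weights i) n)
  | one => simpa using hx
  | mul g₁ g₂ _ _ h₁ h₂ => rw [mul_smul]; exact h₁ (h₂ hx)

instance : DistribMulAction S.W S.Wt where
  smul w b := ⟨w • (b : M), S.smul_mem_weights w b.2⟩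
  one_smul b := Subtype.ext (one_smul S.W (b : M))
  mul_smul v w b := Subtype.ext (mul_smul v w (b : M))
  smul_zero w := Subtype.ext (smul_zero w)
  smul_add w a b := Subtype.ext (smul_add w (a : M) (b : M))

theorem coe_smul (w : S.W) (b : S.Wt) : ((w • b : S.Wt) : M) = w • (b : M) := rfl

/-- `ν_α = (α, α)/2`. -/
def nu (i : ι) : ℝ := S.B.form (S.P.root i) (S.P.root i) / 2

/-- The set `ν_R = {ν_α}` of normalized squared lengths of roots (one or two elements). -/
abbrev NuR : Type := Set.range S.nu

/-- `ν_α` as an element of `ν_R`. -/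
def len (i : ι) : S.NuR := ⟨S.nu i, Set.mem_range_self i⟩

/-- The group `(1/2m)ℤ` of exponents of `q`, where `(P, P) = (1/m)ℤ`. -/
def qExps : AddSubgroup ℝ :=
  AddSubgroup.closure {r | ∃ a b : S.Wt, r = S.B.form (a : M) (b : M) / 2}

/-- The exponents of `q` as a type. -/
abbrev QExp : Type := S.qExps

theorem form_mem_qExps (a b : S.Wt) : S.B.form (a : M) (b : M) ∈ S.qExps := by
  have h : S.B.form (a : M) (b : M) / 2 ∈ S.qExps := AddSubgroup.subset_closure ⟨a, b, rfl⟩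
  have := S.qExps.add_mem h h
  simpa using this

/-- The form `(a, b)` on weights with values in the group of exponents of `q`. -/
def pair (a b : S.Wt) : S.QExp := ⟨S.B.form (a : M) (b : M), S.form_mem_qExps a b⟩

theorem pair_add_left (a a' b : S.Wt) : S.pair (a + a') b = S.pair a b + S.pair a' b :=
  Subtype.ext (by simp [pair])

theorem pair_add_right (a b b' : S.Wt) : S.pair a (b + b') = S.pair a b + S.pair a b' :=
  Subtype.ext (by simp [pair])

theorem pair_smul (w : S.W) (a b : S.Wt) : S.pair (w • a) (w • b) = S.pair a b :=
  Subtype.ext (by simp [pair, coe_smul])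

/-- `ν_α` as an exponent of `q`: `ν_α = (α, α)/2`. -/
def nuExp (i : ι) : S.QExp :=
  ⟨S.nu i, AddSubgroup.subset_closure ⟨S.rootWt i, S.rootWt i, rfl⟩⟩

/-- The number `2(ρ_ν^∨, b) = ∑_{α > 0, ν_α = ν} (α^∨, b)`. -/
def twoRho (ν : S.NuR) : S.Wt →+ ℤ :=
  ∑ i ∈ Finset.univ.filter (fun i => S.base.IsPos i ∧ S.len i = ν), S.cop i

/-! ### The field of rational functions in `X`, `q^{1/2m}`, `t_ν^{1/2}` -/

/-- Exponents: `(z, ζ, τ)` stands for the monomial `X_z q^ζ ∏_ν t_ν^{τ_ν/2}`. -/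
abbrev Expo : Type _ := S.Wt × S.QExp × (S.NuR → ℤ)

instance : TwoUniqueSums S.Wt :=
  letI : Module ℚ M := Module.compHom M (algebraMap ℚ ℝ)
  TwoUniqueSums.of_injective_addHom S.weights.subtype.toAddHom
    (Subtype.val_injective) inferInstance

instance : TwoUniqueSums S.QExp :=
  TwoUniqueSums.of_injective_addHom S.qExps.subtype.toAddHom
    (Subtype.val_injective) inferInstance

/-- The group algebra of the lattice of exponents: Laurent polynomials in
`X`, `q^{1/2m}`, `t_ν^{1/2}`. -/
abbrev Pol : Type _ := AddMonoidAlgebra ℚ S.Expo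

/-- The field `ℚ(q^{1/2m}, t_ν^{1/2})(X)`. -/
abbrev K : Type _ := Frac S.Expo

/-- A monomial in `K`. -/
def mono (e : S.Expo) : S.K := algebraMap S.Pol S.K (AddMonoidAlgebra.single e 1)

/-- `t_ν^{1/2}`. -/
def tHalf (ν : S.NuR) : S.K := S.mono (0, 0, Pi.single ν 1)

/-- `q^{(ρ_k, b)} = ∏_ν t_ν^{(ρ_ν^∨, b)}`. -/
def qRho (b : S.Wt) : S.K := S.mono (0, 0, fun ν => S.twoRho ν b)

/-! ### The extended affine Weyl group -/

instance : MulDistribMulAction S.W (Multiplicative S.Wt) where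
  smul w x := Multiplicative.ofAdd (w • Multiplicative.toAdd x)
  one_smul x := congrArg Multiplicative.ofAdd (one_smul S.W (Multiplicative.toAdd x))
  mul_smul v w x := congrArg Multiplicative.ofAdd (mul_smul v w (Multiplicative.toAdd x))
  smul_mul w x y :=
    congrArg Multiplicative.ofAdd (smul_add w (Multiplicative.toAdd x) (Multiplicative.toAdd y))
  smul_one w := congrArg Multiplicative.ofAdd (smul_zero w)

/-- The extended affine Weyl group `P ⋊ W`; the pair `⟨b, w⟩` is the product `b w`. -/
abbrev What : Type _ :=
  Multiplicative S.Wt ⋊[MulDistribMulAction.toMulAut S.W (Multiplicative S.Wt)] S.W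

/-- The translation by `b`. -/
def tr (b : S.Wt) : S.What := SemidirectProduct.inl (Multiplicative.ofAdd b)

/-- `w ∈ W` as an element of the extended affine Weyl group. -/
def fin (w : S.W) : S.What := SemidirectProduct.inr w

/-- The action `(b w)([z, ζ]) = [w z, ζ - (w z, b)]` on exponents, trivial on powers of `t`. -/
def actFun (g : S.What) (e : S.Expo) : S.Expo :=
  (g.right • e.1, e.2.1 - S.pair (g.right • e.1) (Multiplicative.toAdd g.left), e.2.2)

theorem actFun_one (e : S.Expo) : S.actFun 1 e = e := by
  have h : S.pair e.1 0 = 0 := Subtype.ext (by simp [pair])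
  simp [actFun, h]

theorem actFun_mul (g h : S.What) (e : S.Expo) :
    S.actFun (g * h) e = S.actFun g (S.actFun h e) := by
  refine Prod.ext ?_ (Prod.ext ?_ rfl)
  · simp [actFun, mul_smul]
  · simp only [actFun, SemidirectProduct.mul_left, SemidirectProduct.mul_right, toAdd_mul,
      mul_smul]
    rw [pair_add_right, ← S.pair_smul g.right (h.right • e.1)]
    have : Multiplicative.toAdd (((MulDistribMulAction.toMulAut S.W (Multiplicative S.Wt))
      g.right) h.left) = g.right • Multiplicative.toAdd h.left := rfl
    rw [this]
    abel

theorem actFun_add (g : S.What) (e f : S.Expo) :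
    S.actFun g (e + f) = S.actFun g e + S.actFun g f := by
  refine Prod.ext ?_ (Prod.ext ?_ rfl)
  · simp [actFun]
  · simp only [actFun, Prod.fst_add, Prod.snd_add, smul_add, pair_add_left]
    abel

/-- The action of the extended affine Weyl group on exponents by automorphisms. -/
def actEquiv (g : S.What) : S.Expo ≃+ S.Expo where
  toFun := S.actFun g
  invFun := S.actFun g⁻¹
  left_inv e := by rw [← actFun_mul, inv_mul_cancel, actFun_one]
  right_inv e := by rw [← actFun_mul, mul_inv_cancel, actFun_one]
  map_add' := S.actFun_add g

/-- The action `ŵ(X_{[z, ζ]}) = X_{ŵ([z, ζ])}` on `K`. -/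
instance : MulSemiringAction S.What S.K where
  smul g x := fracMap (S.actEquiv g) x
  one_smul x := by
    have : S.actEquiv 1 = AddEquiv.refl _ := AddEquiv.ext S.actFun_one
    change fracMap (S.actEquiv 1) x = x
    rw [this, fracMap_refl]
  mul_smul g h x := by
    have : S.actEquiv (g * h) = (S.actEquiv h).trans (S.actEquiv g) :=
      AddEquiv.ext (S.actFun_mul g h)
    change fracMap (S.actEquiv (g * h)) x = fracMap (S.actEquiv g) (fracMap (S.actEquiv h) x)
    rw [this, fracMap_trans]
  smul_zero g := map_zero (fracMap (S.actEquiv g))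
  smul_add g := map_add (fracMap (S.actEquiv g))
  smul_one g := map_one (fracMap (S.actEquiv g))
  smul_mul g := map_mul (fracMap (S.actEquiv g))

theorem smul_mono (g : S.What) (e : S.Expo) : g • S.mono e = S.mono (S.actFun g e) := by
  change fracMap (S.actEquiv g) (algebraMap S.Pol S.K _) = _
  rw [fracMap_algebraMap, AddMonoidAlgebra.domCongr_single]
  rfl

/-! ### Affine roots -/

/-- `(i, j)` stands for the affine root `[αᵢ, ν_{αᵢ} j]`. -/
abbrev AffRoot (_S : Setup ι M N) : Type _ := ι × ℤ

/-- `X_{[α, ν_α j]} = X_α q^{ν_α j}`. -/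
def XAff (a : S.AffRoot) : S.K := S.mono (S.rootWt a.1, a.2 • S.nuExp a.1, 0)

/-- `t_{[α, ν_α j]}^{1/2}`. -/
def tAff (a : S.AffRoot) : S.K := S.tHalf (S.len a.1)

/-- The reflection in `[α, ν_α j]`; it is the product of the translation by `-jα` and `s_α`. -/
def sAff (a : S.AffRoot) : S.What :=
  S.tr (-(a.2 • S.rootWt a.1)) * S.fin (RootPairing.weylGroup.ofIdx S.P a.1)

/-- The negative of an affine root. -/
def negAff (a : S.AffRoot) : S.AffRoot := (S.P.reflectionPerm a.1 a.1, -a.2)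

/-- The action of the extended affine Weyl group on affine roots:
`(b w)([α, ν_α j]) = [w α, ν_α (j - (b, (w α)^∨))]`. -/
def actAff (g : S.What) (a : S.AffRoot) : S.AffRoot :=
  (g.right • a.1, a.2 - S.cop (g.right • a.1) (Multiplicative.toAdd g.left))

/-- Vertices of the affine Dynkin diagram; `none` is the affine vertex `0`. -/
abbrev AffIdx : Type _ := Option S.base.support

/-- The affine simple roots, with `α₀ = [-θ, 1]`. -/
def simple : S.AffIdx → S.AffRoot
  | none => (S.P.reflectionPerm S.θ S.θ, 1)
  | some i => (i, 0)

/-- The simple reflections `sᵢ`, `i ≥ 0`. -/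
def s (i : S.AffIdx) : S.What := S.sAff (S.simple i)

/-- Membership in the group `Π` of elements leaving the affine Dynkin diagram invariant. -/
def IsPi (π : S.What) : Prop := ∀ i, ∃ j, S.actAff π (S.simple i) = S.simple j

/-- `g = π s_{j_l} ⋯ s_{j_1}` is a reduced decomposition (`π ∈ Π`, smallest possible `l`);
the list `js` is `[j_l, …, j_1]`. -/
def IsReducedDec (g π : S.What) (js : List S.AffIdx) : Prop :=
  S.IsPi π ∧ g = π * (js.map S.s).prod ∧
    ∀ (π' : S.What) (ks : List S.AffIdx), S.IsPi π' → g = π' * (ks.map S.s).prod →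
      js.length ≤ ks.length

/-- For `js = [j_l, …, j_1]`, the list `[α̃^l, …, α̃^1]`, where
`α̃^p = s_{j_1} ⋯ s_{j_{p-1}}(α_{j_p})`. -/
def lamSeq : List S.AffIdx → List S.AffRoot
  | [] => []
  | j :: js => S.actAff ((js.map S.s).prod)⁻¹ (S.simple j) :: lamSeq js

/-! ### Difference-reflection operators and the polynomial representation -/

/-- The algebra of difference-reflection operators `∑ g_ŵ ŵ`, `g_ŵ ∈ K`,
with the relations `ŵ g = ŵ(g) ŵ`. -/
abbrev Op : Type _ := SkewMonoidAlgebra S.K S.What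

/-- The operator of multiplication by a function. -/
def mulOp (g : S.K) : S.Op := SkewMonoidAlgebra.single 1 g

/-- An element of the extended affine Weyl group as an operator. -/
def grpOp (g : S.What) : S.Op := SkewMonoidAlgebra.single g 1

/-- The difference operator `Γ_b : X_a ↦ q^{(a, b)} X_a`; it equals the translation by `-b`. -/
def Gam (b : S.Wt) : S.Op := S.grpOp (S.tr (-b))

/-- `t_i^{1/2} - t_i^{-1/2}` -/
def hecke (a : S.AffRoot) : S.K := S.tAff a - (S.tAff a)⁻¹

/-- The Demazure–Lusztig operator
`T_i = t_i^{1/2} s_i + (t_i^{1/2} - t_i^{-1/2}) (X_{α_i} - 1)^{-1} (s_i - 1)`. -/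
def T (i : S.AffIdx) : S.Op :=
  S.mulOp (S.tAff (S.simple i)) * S.grpOp (S.s i) +
    S.mulOp (S.hecke (S.simple i) * (S.XAff (S.simple i) - 1)⁻¹) * (S.grpOp (S.s i) - 1)

/-- `T_i^{-1} = T_i - (t_i^{1/2} - t_i^{-1/2})`. -/
def TInv (i : S.AffIdx) : S.Op := S.T i - S.mulOp (S.hecke (S.simple i))

/-- `π T_{j_l} ⋯ T_{j_1}`. For a reduced decomposition of `b ∈ P₊` this is `Y_b = T_b`. -/
def Y (π : S.What) (js : List S.AffIdx) : S.Op := S.grpOp π * (js.map S.T).prod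

/-- `T_{j_1}^{-1} ⋯ T_{j_l}^{-1} π^{-1}`. For a reduced decomposition of `b ∈ P₊` this is
`Y_b^{-1}`. -/
def YInv (π : S.What) (js : List S.AffIdx) : S.Op :=
  (js.reverse.map S.TInv).prod * S.grpOp π⁻¹

/-- `f_α̃ = (t_α X_α̃^{-1} - 1) / (X_α̃^{-1} - 1)`. -/
def f (a : S.AffRoot) : S.K :=
  (S.tAff a ^ 2 * (S.XAff a)⁻¹ - 1) / ((S.XAff a)⁻¹ - 1)

/-- `g_α̃ = (t_α - 1) / (1 - X_α̃^{-1})`. -/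
def g (a : S.AffRoot) : S.K := (S.tAff a ^ 2 - 1) / (1 - (S.XAff a)⁻¹)

/-- The first term of `G^±_α̃`: `t_α^{-1/2} f_α̃`. -/
def termF (a : S.AffRoot) : S.Op := S.mulOp ((S.tAff a)⁻¹ * S.f a)

/-- The second term of `G^+_α̃`: `t_α^{-1/2} g_α̃ s_α̃`. -/
def termPlus (a : S.AffRoot) : S.Op :=
  S.mulOp ((S.tAff a)⁻¹ * S.g a) * S.grpOp (S.sAff a)

/-- The second term of `G^-_α̃`: `- t_α^{-1/2} s_α̃ g_α̃`. -/
def termMinus (a : S.AffRoot) : S.Op :=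
  -(S.grpOp (S.sAff a) * S.mulOp ((S.tAff a)⁻¹ * S.g a))

/-- `G^+_α̃ = t_α^{-1/2} (f_α̃ + g_α̃ s_α̃)`. -/
def GPlus (a : S.AffRoot) : S.Op := S.termF a + S.termPlus a

/-- `G^-_α̃ = t_α^{-1/2} (f_α̃ - s_α̃ g_α̃)`. -/
def GMinus (a : S.AffRoot) : S.Op := S.termF a + S.termMinus a

/-- `h` is one of the products in the expansion of `G^+_{a_1} ⋯ G^+_{a_l}`, obtained by choosing
one of the two terms of each binomial. -/
def IsPlusProduct (as : List S.AffRoot) (h : S.Op) : Prop :=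
  ∃ hs : List S.Op, List.Forall₂ (fun x a => x = S.termF a ∨ x = S.termPlus a) hs as ∧
    h = hs.prod

/-- `h` is one of the products in the expansion of `G^-_{a_1} ⋯ G^-_{a_l}`. -/
def IsMinusProduct (as : List S.AffRoot) (h : S.Op) : Prop :=
  ∃ hs : List S.Op, List.Forall₂ (fun x a => x = S.termF a ∨ x = S.termMinus a) hs as ∧
    h = hs.prod

/-! ### Spinors -/

/-- `W`-spinors: maps `u ↦ f(u)` from `W` to `K`, an algebra under pointwise operations. -/
abbrev Spin : Type _ := S.W → S.K

/-- The pair `(c, v)` stands for the operator `Γ_c δ(v)` on spinors. -/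
abbrev SpinGrp : Type _ := Multiplicative S.Wt × S.W

/-- The action of `Γ_c δ(v)` on spinors: `(Γ_c δ(v) f)(u) = Γ_c (f (v⁻¹ u))`. -/
instance : MulSemiringAction S.SpinGrp S.Spin where
  smul x F := fun u => S.tr (-(Multiplicative.toAdd x.1)) • F (x.2⁻¹ * u)
  one_smul F := by
    funext u
    change S.tr (-(0 : S.Wt)) • F ((1 : S.W)⁻¹ * u) = F u
    simp [tr]
  mul_smul x y F := by
    funext u
    change S.tr (-(Multiplicative.toAdd x.1 + Multiplicative.toAdd y.1)) •
        F ((x.2 * y.2)⁻¹ * u) =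
      S.tr (-(Multiplicative.toAdd x.1)) • S.tr (-(Multiplicative.toAdd y.1)) •
        F (y.2⁻¹ * (x.2⁻¹ * u))
    rw [smul_smul, mul_inv_rev, mul_assoc, neg_add]
    rfl
  smul_zero x := funext fun _ => smul_zero (S.tr (-(Multiplicative.toAdd x.1)))
  smul_add x F G := funext fun u =>
    smul_add (S.tr (-(Multiplicative.toAdd x.1))) (F (x.2⁻¹ * u)) (G (x.2⁻¹ * u))
  smul_one x := funext fun _ => smul_one (S.tr (-(Multiplicative.toAdd x.1)))
  smul_mul x F G := funext fun u =>
    smul_mul' (S.tr (-(Multiplicative.toAdd x.1))) (F (x.2⁻¹ * u)) (G (x.2⁻¹ * u))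

/-- The algebra of spinor difference-reflection operators `∑ F_{c,v} Γ_c δ(v)` with spinor
coefficients `F_{c,v} = ∑_u F_{c,v}(u) ζ_u`. -/
abbrev SpinOp : Type _ := SkewMonoidAlgebra S.Spin S.SpinGrp

/-- The homomorphism `φ : g Γ_b w ↦ ϱ(g) ϱ(Γ_b) δ(w)`, where `ϱ(g) = ∑_u u⁻¹(g) ζ_u` and
`ϱ(Γ_b) = ∑_u Γ_{u⁻¹(b)} ζ_u`. (An element `⟨b, w⟩` of the extended affine Weyl group
is `Γ_{-b} w`.) -/
def phi (L : S.Op) : S.SpinOp :=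
  L.sum fun x c => ∑ᶠ u : S.W,
    SkewMonoidAlgebra.single
      (Multiplicative.ofAdd (u⁻¹ • (-(Multiplicative.toAdd x.left))), x.right)
      (Pi.single u (S.fin u⁻¹ • c) : S.Spin)

/-- The automorphism of the lattice of exponents corresponding to
`Γ_{-ρ_k} : X_b ↦ q^{-(ρ_k, b)} X_b = ∏_ν t_ν^{-(ρ_ν^∨, b)} X_b`. -/
def rhoShift : S.Expo ≃+ S.Expo where
  toFun e := (e.1, e.2.1, fun ν => e.2.2 ν - S.twoRho ν e.1)
  invFun e := (e.1, e.2.1, fun ν => e.2.2 ν + S.twoRho ν e.1)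
  left_inv e := by simp
  right_inv e := by simp
  map_add' e f := by
    refine Prod.ext rfl (Prod.ext rfl ?_)
    funext ν
    simp only [Prod.fst_add, Prod.snd_add, Pi.add_apply, map_add]
    ring

/-- Conjugation by `δ(X_{ρ_k} Γ_{-ρ_k})`. It fixes `ζ_u` and `δ(v)`, sends a function `c` to
`Γ_{-ρ_k}(c)`, and sends `Γ_b` to `X_{ρ_k} Γ_b X_{ρ_k}^{-1} = q^{-(ρ_k, b)} Γ_b`. -/
def conjRho (L : S.SpinOp) : S.SpinOp :=
  L.sum fun x F => SkewMonoidAlgebra.single x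
    (fun u => S.qRho (-(Multiplicative.toAdd x.1)) * fracMap S.rhoShift (F u))

/-- `ae^δ(L) = δ(X_{ρ_k} Γ_{-ρ_k}) φ(L) δ(X_{ρ_k} Γ_{-ρ_k})^{-1}`. -/
def ae (L : S.Op) : S.SpinOp := S.conjRho (S.phi L)

/-! ### Orders in `t_ν` and the limit `t → 0` -/

/-- The order of a nonzero Laurent polynomial with respect to `t_ν^{1/2}`. -/
def polOrd (ν : S.NuR) (p : S.Pol) : ℤ :=
  if h : p.coeff.support.Nonempty then p.coeff.support.inf' h (fun e => e.2.2 ν) else 0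

/-- The order of an element of `K` with respect to `t_ν` (it belongs to `½ ℤ ∪ {∞}`). -/
def tOrd (ν : S.NuR) (c : S.K) : WithTop ℚ :=
  if c = 0 then ⊤ else
    ((((S.polOrd ν (IsLocalization.sec (nonZeroDivisors S.Pol) c).1 -
      S.polOrd ν ((IsLocalization.sec (nonZeroDivisors S.Pol) c).2 : S.Pol) : ℤ) : ℚ) / 2 : ℚ) :
      WithTop ℚ)

/-- `ord_w^ν` of `∑ F_{c,v} Γ_c δ(v)`: the smallest order of the `w`-components `F_{c,v}(w)`
of the coefficients, so that `ord_w^ν(A v) = ord_w^ν(A)` for `v ∈ W`. -/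
def ordW (ν : S.NuR) (w : S.W) (L : S.SpinOp) : WithTop ℚ :=
  L.support.inf fun x => S.tOrd ν (L.coeff x w)

/-- `†ord_w^ν`, which is `ord_w^ν` computed after the elements of `W` are moved to the left, so
that `†ord_w^ν(v A) = ord_w^ν(A)` for `v ∈ W`: one has
`F Γ_c δ(v) = δ(v) F' Γ_c`, where `F'(w) = F(v w)`. -/
def dagOrdW (ν : S.NuR) (w : S.W) (L : S.SpinOp) : WithTop ℚ :=
  L.support.inf fun x => S.tOrd ν (L.coeff x (x.2 * w))

/-- A Laurent polynomial without negative powers of the `t_ν^{1/2}`. -/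
def IsTPol (p : S.Pol) : Prop := ∀ e ∈ p.coeff.support, ∀ ν, 0 ≤ e.2.2 ν

/-- The part of a Laurent polynomial which does not involve the `t_ν`. -/
def tZero (p : S.Pol) : S.Pol :=
  AddMonoidAlgebra.ofCoeff (p.coeff.filter fun e => e.2.2 = 0)

/-- `c ∈ K` is well defined when all `t_ν^{1/2} = 0` and `c₀` is its value: `c = p / d`, where
`p`, `d` are polynomial in the `t_ν^{1/2}`, `d|_{t = 0} ≠ 0` and `c₀ = p|_{t = 0} / d|_{t = 0}`. -/
def HasTLimit (c c₀ : S.K) : Prop :=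
  ∃ p d : S.Pol, S.IsTPol p ∧ S.IsTPol d ∧ S.tZero d ≠ 0 ∧
    c = algebraMap S.Pol S.K p / algebraMap S.Pol S.K d ∧
    c₀ = algebraMap S.Pol S.K (S.tZero p) / algebraMap S.Pol S.K (S.tZero d)

/-- `RE^δ(L) = L₀`, i.e. `ae^δ(L) → L₀` coefficientwise as all `t_ν → 0`. -/
def HasRE (L : S.Op) (L₀ : S.SpinOp) : Prop :=
  ∀ (x : S.SpinGrp) (u : S.W), S.HasTLimit ((S.ae L).coeff x u) (L₀.coeff x u)

end Setup

end TodaDunkl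

end

/-! A choice of terms in the G-binomials turns each product in the expansion of b⁻¹Y_b into one
monomial c·g, and each product in that of Y_b⁻¹b into one monomial g⁻¹·c, with g in the extended
affine Weyl group and c in `K`. Each component of æ^δ of such a monomial is either 0 or, up to
translations, a monomial in the t_ν times Γ_{-ρ_k}(y(c)) for one y in W (`coeff_ae`). So everything
reduces to bounding from below, for all y, the powers of t in the ρ-shift of y(c). The predicate
`Reg e` records such a bound for all ν at once, in a form that yields both t-orders and limits at t
= 0.

The multiplication term at α̃ = [α, ν_α j] has exponent at least -sgn(yα) in t_ν^{1/2}, where ν =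
ν_α. Choosing it everywhere gives the exponent -ψ(y), with ψ(y) the sum of sgn(yα) over the α̃^p of
length ν (`psi`). A closed formula for ψ (`omg`) is checked one letter at a time and is unchanged by
Π. For a translation it gives ψ(y) = 2(ρ_ν^∨, y(b)) (`psi_eq_twoRho`), and -ψ(y) is exactly the
exponent carried by Γ_b.

Choosing the reflection term at α̃ makes the remaining factors be seen at y s_α instead of y and
adds the translation by -jα. No order is lost provided that ψ(y) - ψ(y s_α), taken over the
remaining roots, lies between two multiples of (ρ_ν^∨, yα), up to a constant. By `psi_sub_psi_refl`
this difference is governed by the change in the number ℓ_ν of inversions of length ν, and the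
required inequalities become, for yα > 0, δ ≤ ℓ_ν(y s_α) - ℓ_ν(y) ≤ 2(ρ_ν^∨, yα) - δ, where δ is 1
if α has length ν and 0 otherwise (`lenDiff_lower`, `lenDiff_upper`). The lower bound needs α > 0,
which is where dominance of b and reducedness enter (`isPos_of_mem_lamSeq`). For Y_b⁻¹b the roots
are negated and the two bounds exchange roles.

Multiplying by b or b⁻¹ brings the exponents up to 0, so all individual limits exist, and Y_b and
Y_b⁻¹ are finite sums of such products. Since æ^δ is a ring homomorphism (`ae_mul`) and limits are
unique and multiplicative, Y_bY_b⁻¹ = 1 passes to the limit. -/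

noncomputable section

namespace TodaDunkl

namespace Setup

variable {ι M N : Type*} [Fintype ι] [AddCommGroup M] [Module ℝ M] [AddCommGroup N] [Module ℝ N]
  (S : Setup ι M N)

section

/-! ### The Weyl group acting on roots and weights -/

/-- The index of the negative of a root. -/
def ng (i : ι) : ι := S.P.reflectionPerm i i

/-- The reflection in a root as an element of the Weyl group. -/
abbrev refl (i : ι) : S.W := RootPairing.weylGroup.ofIdx S.P i

theorem root_smul (w : S.W) (i : ι) : S.P.root (w • i) = w • S.P.root i :=
  (S.P.weylGroup_apply_root w i).symm

theorem root_ng (i : ι) : S.P.root (S.ng i) = -S.P.root i := by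
  simp [ng, RootPairing.root_reflectionPerm]

theorem root_inj {i j : ι} : S.P.root i = S.P.root j ↔ i = j := S.P.root.injective.eq_iff

theorem ng_ng (i : ι) : S.ng (S.ng i) = i := by
  rw [← S.root_inj, root_ng, root_ng, neg_neg]

theorem ng_ne (i : ι) : S.ng i ≠ i := fun h => by
  have h1 := S.root_ng i
  have : IsAddTorsionFree M := .of_isTorsionFree ℝ M
  rw [h, self_eq_neg] at h1
  exact S.P.ne_zero i h1

theorem ng_eq_iff {i j : ι} : S.ng i = j ↔ i = S.ng j :=
  ⟨fun h => by rw [← h, ng_ng], fun h => by rw [h, ng_ng]⟩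

theorem smul_ng (w : S.W) (i : ι) : w • S.ng i = S.ng (w • i) := by
  rw [← S.root_inj, root_smul, root_ng, root_ng, root_smul, smul_neg]

theorem rootWt_smul (w : S.W) (i : ι) : S.rootWt (w • i) = w • S.rootWt i :=
  Subtype.ext (S.root_smul w i)

theorem rootWt_ng (i : ι) : S.rootWt (S.ng i) = -S.rootWt i := Subtype.ext (S.root_ng i)

theorem rootWt_inj {i j : ι} : S.rootWt i = S.rootWt j ↔ i = j :=
  ⟨fun h => S.root_inj.1 (congrArg Subtype.val h), fun h => h ▸ rfl⟩

theorem form_symm (x y : M) : S.B.form x y = S.B.form y x :=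
  (S.B.symm.eq y x).symm

theorem form_smul (w : S.W) (x y : M) : S.B.form (w • x) (w • y) = S.B.form x y :=
  RootPairing.InvariantForm.apply_weylGroup_smul S.P (B := S.B) w x y

theorem nu_pos (i : ι) : 0 < S.nu i := by
  have := S.two_le i
  unfold nu; linarith

theorem one_le_nu (i : ι) : 1 ≤ S.nu i := by
  have := S.two_le i
  unfold nu; linarith

/-- Invariance of the form under the reflection in α_i, applied to x and α_i, whose image is -α_i.
-/
theorem form_root (x : M) (i : ι) :
    S.B.form x (S.P.root i) = S.nu i * S.P.toLinearMap x (S.P.coroot i) := by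
  have h := S.B.isOrthogonal_reflection i x (S.P.root i)
  rw [RootPairing.reflection_apply_self, RootPairing.reflection_apply] at h
  simp only [map_neg, map_sub, LinearMap.sub_apply, map_smul, LinearMap.smul_apply,
    smul_eq_mul] at h
  have h2 : S.P.coroot' i x = S.P.toLinearMap x (S.P.coroot i) := by simp
  rw [h2] at h
  unfold nu
  linarith

theorem form_rootWt (b : S.Wt) (i : ι) :
    S.B.form (b : M) (S.P.root i) = S.nu i * S.cop i b := by
  rw [form_root, cop_cast]

theorem nu_smul (w : S.W) (i : ι) : S.nu (w • i) = S.nu i := by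
  simp only [nu, root_smul, form_smul]

theorem nu_ng (i : ι) : S.nu (S.ng i) = S.nu i := by
  simp [nu, root_ng]

theorem len_smul (w : S.W) (i : ι) : S.len (w • i) = S.len i := Subtype.ext (S.nu_smul w i)

theorem len_ng (i : ι) : S.len (S.ng i) = S.len i := Subtype.ext (S.nu_ng i)

theorem cop_smul (w : S.W) (i : ι) (b : S.Wt) : S.cop (w • i) (w • b) = S.cop i b := by
  have h := S.form_smul w (b : M) (S.P.root i)
  rw [← root_smul, ← coe_smul, form_rootWt, form_rootWt, nu_smul] at h
  exact_mod_cast mul_left_cancel₀ (S.nu_pos i).ne' h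

theorem cop_smul_left (w : S.W) (i : ι) (b : S.Wt) : S.cop (w • i) b = S.cop i (w⁻¹ • b) := by
  rw [← S.cop_smul w i (w⁻¹ • b), smul_inv_smul]

theorem cop_ng (i : ι) (b : S.Wt) : S.cop (S.ng i) b = -S.cop i b := by
  have h := S.form_rootWt b (S.ng i)
  rw [root_ng, map_neg, form_rootWt, nu_ng] at h
  have : S.nu i * (S.cop (S.ng i) b : ℝ) = S.nu i * ((-S.cop i b : ℤ) : ℝ) := by
    push_cast; linarith
  exact_mod_cast mul_left_cancel₀ (S.nu_pos i).ne' this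

theorem cop_self (i : ι) : S.cop i (S.rootWt i) = 2 := by
  have h : ((S.cop i (S.rootWt i) : ℤ) : ℝ) = 2 := by
    rw [cop_cast]; simp [rootWt]
  exact_mod_cast h

theorem nu_mul_cop (i j : ι) :
    S.nu i * S.cop i (S.rootWt j) = S.nu j * S.cop j (S.rootWt i) := by
  rw [← form_rootWt, ← form_rootWt, form_symm]; rfl

theorem refl_smul_wt (i : ι) (b : S.Wt) : S.refl i • b = b - S.cop i b • S.rootWt i := by
  refine Subtype.ext ?_
  rw [coe_smul, RootPairing.weylGroup.ofIdx_smul, RootPairing.Equiv.reflection_smul,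
    RootPairing.reflection_apply]
  have h2 : S.P.coroot' i (b : M) = ((S.cop i b : ℤ) : ℝ) := by rw [cop_cast]; simp
  rw [h2, Int.cast_smul_eq_zsmul]
  simp [rootWt]

theorem rootWt_refl (i j : ι) :
    S.rootWt (S.refl i • j) = S.rootWt j - S.cop i (S.rootWt j) • S.rootWt i := by
  rw [rootWt_smul, refl_smul_wt]

theorem root_refl (i j : ι) :
    S.P.root (S.refl i • j) = S.P.root j - S.cop i (S.rootWt j) • S.P.root i := by
  have := congrArg Subtype.val (S.rootWt_refl i j)
  simpa [rootWt] using this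

theorem refl_smul_self (i : ι) : S.refl i • i = S.ng i := rfl

theorem refl_mul_self (i : ι) : S.refl i * S.refl i = 1 := by
  refine Subtype.ext ?_
  change RootPairing.Equiv.reflection S.P i * RootPairing.Equiv.reflection S.P i = 1
  rw [mul_eq_one_iff_inv_eq, RootPairing.Equiv.reflection_inv]

theorem refl_inv (i : ι) : (S.refl i)⁻¹ = S.refl i := by
  rw [inv_eq_iff_mul_eq_one, refl_mul_self]

theorem refl_smul_refl_smul (i j : ι) : S.refl i • S.refl i • j = j := by
  rw [smul_smul, refl_mul_self, one_smul]

theorem weyl_ext {v w : S.W} (h : ∀ x : M, v • x = w • x) : v = w := by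
  refine Subtype.ext (RootPairing.Equiv.weightHom_injective S.P ?_)
  exact LinearEquiv.ext h

/-- The roots span `M`, so W acts faithfully on their indices. Finiteness of W and identities in W
follow by checking on roots. -/
theorem weyl_ext_root {v w : S.W} (h : ∀ i : ι, v • i = w • i) : v = w := by
  refine S.weyl_ext fun x => ?_
  have hx : x ∈ Submodule.span ℝ (Set.range S.P.root) := by
    rw [S.isRootSystem.span_root_eq_top]; trivial
  induction hx using Submodule.span_induction with
  | mem x hx =>
    obtain ⟨i, rfl⟩ := hx
    rw [← root_smul, ← root_smul, h]
  | zero => simp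
  | add x y _ _ hx hy => rw [smul_add, smul_add, hx, hy]
  | smul a x _ hx =>
    have hv : ∀ u : S.W, u • a • x = a • u • x := fun u => smul_comm (u : S.P.Aut) a x
    rw [hv, hv, hx]

instance finite_W : Finite S.W :=
  Finite.of_injective (fun w : S.W => (fun i : ι => w • i))
    fun _ _ h => S.weyl_ext_root fun i => congrFun h i

instance : Fintype S.W := Fintype.ofFinite _

theorem refl_smul_index (w : S.W) (i : ι) : S.refl (w • i) = w * S.refl i * w⁻¹ := by
  refine S.weyl_ext_root fun j => S.rootWt_inj.1 ?_
  have h : S.rootWt ((w * S.refl i * w⁻¹) • j) = w • S.rootWt (S.refl i • w⁻¹ • j) := by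
    rw [mul_smul, mul_smul, rootWt_smul]
  rw [h, rootWt_refl, rootWt_refl, smul_sub, smul_comm w, rootWt_smul, rootWt_smul,
    smul_inv_smul, cop_smul_left]

theorem refl_ng (i : ι) : S.refl (S.ng i) = S.refl i := by
  rw [← refl_smul_self, refl_smul_index]; simp

/-! ### Signs of roots -/

/-- The sign of a root. -/
def sgn (i : ι) : ℤ := if S.base.IsPos i then 1 else -1

theorem isPos_ng (i : ι) : S.base.IsPos (S.ng i) ↔ ¬ S.base.IsPos i :=
  RootPairing.Base.IsPos.neg_iff_not S.base i

theorem sgn_pos {i : ι} (h : S.base.IsPos i) : S.sgn i = 1 := if_pos h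

theorem sgn_neg {i : ι} (h : ¬ S.base.IsPos i) : S.sgn i = -1 := if_neg h

theorem sgn_ng (i : ι) : S.sgn (S.ng i) = -S.sgn i := by
  unfold sgn
  by_cases h : S.base.IsPos i
  · rw [if_pos h, if_neg (by rw [isPos_ng]; simpa using h)]
  · rw [if_neg h, if_pos ((S.isPos_ng i).2 h)]; rfl

theorem sgn_cases (i : ι) : S.sgn i = 1 ∨ S.sgn i = -1 := by
  unfold sgn; split_ifs <;> simp

/-- The roots lying in the cone of nonnegative combinations of the simple roots are positive. -/
theorem isPos_iff_mem (i : ι) :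
    S.base.IsPos i ↔ S.P.root i ∈ AddSubmonoid.closure (S.P.root '' S.base.support) := by
  have key : ∀ i : ι, S.P.root i ∈ AddSubmonoid.closure (S.P.root '' S.base.support) →
      S.base.IsPos i := by
    intro i hi
    have : ∀ m ∈ AddSubmonoid.closure (S.P.root '' S.base.support),
        ∃ f : ι → ℕ, m = ∑ j ∈ S.base.support, f j • S.P.root j := by
      intro m hm
      induction hm using AddSubmonoid.closure_induction with
      | mem x hx =>
        obtain ⟨j, hj, rfl⟩ := hx
        refine ⟨Pi.single j 1, ?_⟩
        rw [Finset.sum_eq_single_of_mem j hj (by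
          intro b _ hb; simp [Pi.single_eq_of_ne hb])]
        simp
      | zero => exact ⟨0, by simp⟩
      | add x y _ _ hx hy =>
        obtain ⟨f, rfl⟩ := hx
        obtain ⟨g, rfl⟩ := hy
        exact ⟨f + g, by simp [add_smul, Finset.sum_add_distrib]⟩
    obtain ⟨f, hf⟩ := this _ hi
    have h2 : S.P.root i = ∑ j ∈ S.base.support, (fun j => (f j : ℤ)) j • S.P.root j := by
      rw [hf]; simp
    rw [RootPairing.Base.isPos_iff', RootPairing.Base.height_eq_sum h2]
    exact Finset.sum_nonneg fun j _ => by positivity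
  refine ⟨fun h => ?_, key i⟩
  refine (S.base.root_mem_or_neg_mem i).resolve_right fun h2 => ?_
  rw [← root_ng] at h2
  exact (S.isPos_ng i).1 (key _ h2) h

/-- A positive multiple of a positive root cannot be the difference of a negative
and a positive root. -/
theorem isPos_of_add {i j k : ι} {n : ℤ} (hn : 0 ≤ n) (hi : S.base.IsPos i) (hj : S.base.IsPos j)
    (h : S.P.root k = S.P.root i + n • S.P.root j) : S.base.IsPos k := by
  rw [isPos_iff_mem] at *
  obtain ⟨m, rfl⟩ := Int.eq_ofNat_of_zero_le hn
  rw [h]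
  exact add_mem hi (by simpa using nsmul_mem hj m)

end

/-! ### Dominance, the maximal short root, and inversion counts by root length -/

section

theorem cop_rootWt (i j : ι) : S.cop i (S.rootWt j) = S.P.pairingIn ℤ j i := by
  have h : ((S.cop i (S.rootWt j) : ℤ) : ℝ) = ((S.P.pairingIn ℤ j i : ℤ) : ℝ) := by
    rw [cop_cast]
    have := S.P.algebraMap_pairingIn ℤ j i
    simp only [algebraMap_int_eq, eq_intCast] at this
    rw [this]; simp [rootWt]
  exact_mod_cast h

theorem cop_comm_pos {i j : ι} : 0 < S.cop i (S.rootWt j) ↔ 0 < S.cop j (S.rootWt i) := by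
  have h := S.nu_mul_cop i j
  have hi := S.nu_pos i
  have hj := S.nu_pos j
  have : (0 : ℝ) < S.cop i (S.rootWt j) ↔ (0 : ℝ) < S.cop j (S.rootWt i) := by
    rw [← mul_pos_iff_of_pos_left hi, h, mul_pos_iff_of_pos_left hj]
  exact_mod_cast this

theorem cop_comm_neg {i j : ι} : S.cop i (S.rootWt j) < 0 ↔ S.cop j (S.rootWt i) < 0 := by
  have := S.cop_comm_pos (i := S.ng i) (j := j)
  rw [rootWt_ng, map_neg, cop_ng] at this
  simpa using this

theorem mem_closure_form_nonneg {b : S.Wt} (hb : S.IsDominant b) {x : M}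
    (hx : x ∈ AddSubmonoid.closure (S.P.root '' S.base.support)) : 0 ≤ S.B.form (b : M) x := by
  induction hx using AddSubmonoid.closure_induction with
  | mem x hx =>
    obtain ⟨i, hi, rfl⟩ := hx
    rw [form_rootWt]
    exact mul_nonneg (S.nu_pos i).le (by exact_mod_cast hb i hi)
  | zero => simp
  | add x y _ _ hx hy => rw [map_add]; exact add_nonneg hx hy

theorem IsDominant.cop_nonneg {S : Setup ι M N} {b : S.Wt} (hb : S.IsDominant b) {i : ι}
    (hi : S.base.IsPos i) : 0 ≤ S.cop i b := by
  have h := S.mem_closure_form_nonneg hb ((S.isPos_iff_mem i).1 hi)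
  rw [form_rootWt] at h
  exact_mod_cast nonneg_of_mul_nonneg_right h (S.nu_pos i)

theorem refl_height (k i : ι) :
    S.base.height (S.refl k • i) = S.base.height i - S.cop k (S.rootWt i) * S.base.height k := by
  have h : S.P.root (S.refl k • i) = S.P.root i + (-S.cop k (S.rootWt i)) • S.P.root k := by
    rw [root_refl]; module
  rw [S.base.height_add_zsmul h]
  simp [sub_eq_add_neg]

/-- If θ paired negatively with a simple coroot, the reflected root would be short and larger than
θ, against maximality. -/
theorem theta_dominant : S.IsDominant (S.rootWt S.θ) := by
  intro k hk
  by_contra hneg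
  push Not at hneg
  have h1 : S.B.form (S.P.root (S.refl k • S.θ)) (S.P.root (S.refl k • S.θ)) = 2 := by
    rw [root_smul, form_smul, S.θ_short]
  have h2 := S.θ_max _ h1
  rw [root_refl] at h2
  -- The difference θ - s_kθ is cα_k with c ≤ -1. Adding -c - 1 copies of α_k leaves exactly -α_k,
  -- which would then be positive.
  obtain ⟨n, hn⟩ := Int.eq_ofNat_of_zero_le (a := -S.cop k (S.rootWt S.θ) - 1) (by omega)
  have h3 : S.P.root (S.ng k) = S.P.root S.θ - (S.P.root S.θ -
      S.cop k (S.rootWt S.θ) • S.P.root k) + n • S.P.root k := by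
    rw [root_ng, ← natCast_zsmul, ← hn]; module
  have h4 : S.base.IsPos (S.ng k) := by
    rw [isPos_iff_mem, h3]
    exact add_mem h2 (nsmul_mem (AddSubmonoid.subset_closure (Set.mem_image_of_mem _ hk)) n)
  exact (S.isPos_ng k).1 h4 (S.base.isPos_of_mem_support hk)

theorem nu_theta : S.nu S.θ = 1 := by
  unfold nu; rw [S.θ_short]; norm_num

theorem theta_isPos : S.base.IsPos S.θ := by
  by_contra h
  have h1 := (S.theta_dominant).cop_nonneg ((S.isPos_ng _).2 h)
  rw [cop_ng, cop_self] at h1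
  omega

/-- For non-proportional roots, a pairing of absolute value at least 2 forces the opposite one to be
±1. Then α_i would be shorter than θ, which contradicts ν_i ≥ 1. -/
theorem cop_theta_cases (i : ι) : i = S.θ ∨ i = S.ng S.θ ∨
    (S.cop i (S.rootWt S.θ) = 0 ∨ S.cop i (S.rootWt S.θ) = 1 ∨ S.cop i (S.rootWt S.θ) = -1) := by
  by_cases h1 : i = S.θ
  · exact Or.inl h1
  by_cases h2 : i = S.ng S.θ
  · exact Or.inr (Or.inl h2)
  refine Or.inr (Or.inr ?_)
  have h := S.P.pairingIn_pairingIn_mem_set_of_isCrystal_of_isRed' S.θ i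
    (by rw [Ne, root_inj]; exact fun h => h1 h.symm)
    (by rw [← root_ng, Ne, root_inj]; exact fun h => h2 (S.ng_eq_iff.1 h.symm))
  rw [← cop_rootWt, ← cop_rootWt] at h
  have e := S.nu_mul_cop i S.θ
  rw [nu_theta, one_mul] at e
  have e1 := S.one_le_nu i
  simp only [Set.mem_insert_iff, Prod.mk.injEq, Set.mem_singleton_iff] at h
  rcases h with h | h | h | h | h | h | h | h | h | h | h
  all_goals try (simp [h.1]; done)
  all_goals rw [h.1, h.2] at e; push_cast at e; linarith

/-- The reflection subtracts a nonnegative multiple of a positive root, so it cannot make a negative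
root positive. -/
theorem sgn_refl_le {a i : ι} (ha : S.base.IsPos a) (h : 0 ≤ S.cop a (S.rootWt i)) :
    S.sgn (S.refl a • i) ≤ S.sgn i := by
  by_cases hi : S.base.IsPos i
  · rw [S.sgn_pos hi]
    rcases S.sgn_cases (S.refl a • i) with h | h <;> rw [h]
    norm_num
  · rw [S.sgn_neg (i := S.refl a • i)]
    · rcases S.sgn_cases i with h | h <;> rw [h]
      norm_num
    · intro hr
      refine hi (S.isPos_of_add h hr ha ?_)
      rw [root_refl]; module

theorem cop_refl_self (a i : ι) :
    S.cop a (S.rootWt (S.refl a • i)) = -S.cop a (S.rootWt i) := by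
  rw [rootWt_refl, map_sub, map_zsmul, cop_self]
  simp only [smul_eq_mul]; ring

theorem le_sgn_refl {a i : ι} (ha : S.base.IsPos a) (h : S.cop a (S.rootWt i) ≤ 0) :
    S.sgn i ≤ S.sgn (S.refl a • i) := by
  have := S.sgn_refl_le (i := S.refl a • i) ha (by rw [cop_refl_self]; omega)
  rwa [refl_smul_refl_smul] at this

theorem refl_smul_of_cop_eq_zero {a i : ι} (h : S.cop a (S.rootWt i) = 0) :
    S.refl a • i = i := by
  refine S.rootWt_inj.1 ?_
  rw [rootWt_refl, h]; simp

/-! ### Sums over roots of a given length -/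

/-- The sum over the roots of a given length. -/
def sumL (ν : S.NuR) (F : ι → ℤ) : ℤ := ∑ i ∈ Finset.univ.filter (fun i => S.len i = ν), F i

/-- The indicator of the roots of a given length. -/
def dl (ν : S.NuR) (i : ι) : ℤ := if S.len i = ν then 1 else 0

theorem dl_smul (ν : S.NuR) (w : S.W) (i : ι) : S.dl ν (w • i) = S.dl ν i := by
  simp [dl, len_smul]

theorem dl_ng (ν : S.NuR) (i : ι) : S.dl ν (S.ng i) = S.dl ν i := by
  simp [dl, len_ng]

theorem dl_nonneg (ν : S.NuR) (i : ι) : 0 ≤ S.dl ν i := by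
  unfold dl; split_ifs <;> norm_num

theorem sumL_smul (ν : S.NuR) (w : S.W) (F : ι → ℤ) :
    S.sumL ν (fun i => F (w • i)) = S.sumL ν F := by
  unfold sumL
  refine Finset.sum_nbij' (fun i => w • i) (fun i => w⁻¹ • i) ?_ ?_ ?_ ?_ ?_ <;>
    simp [len_smul]

theorem sumL_add (ν : S.NuR) (F G : ι → ℤ) :
    S.sumL ν (fun i => F i + G i) = S.sumL ν F + S.sumL ν G := Finset.sum_add_distrib

theorem sumL_sub (ν : S.NuR) (F G : ι → ℤ) :
    S.sumL ν (fun i => F i - G i) = S.sumL ν F - S.sumL ν G := Finset.sum_sub_distrib ..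

theorem sumL_mul (ν : S.NuR) (c : ℤ) (F : ι → ℤ) :
    S.sumL ν (fun i => c * F i) = c * S.sumL ν F := (Finset.mul_sum ..).symm

theorem sumL_le {ν : S.NuR} {F G : ι → ℤ} (h : ∀ i, F i ≤ G i) : S.sumL ν F ≤ S.sumL ν G :=
  Finset.sum_le_sum fun i _ => h i

theorem sumL_ite (ν : S.NuR) (a : ι) (c : ℤ) :
    S.sumL ν (fun i => if i = a then c else 0) = c * S.dl ν a := by
  unfold sumL dl
  rw [Finset.sum_ite_eq']
  simp

/-- A root and its negative contribute equally. Passing to a sum over all roots lets W act by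
reindexing. -/
theorem two_mul_twoRho (ν : S.NuR) (b : S.Wt) :
    2 * S.twoRho ν b = S.sumL ν (fun i => S.sgn i * S.cop i b) := by
  have h0 : S.twoRho ν b =
      ∑ i ∈ Finset.univ.filter (fun i => S.base.IsPos i ∧ S.len i = ν), S.cop i b := by
    simp [twoRho]
  have h1 : ∑ i ∈ (Finset.univ.filter (fun i => S.len i = ν)).filter (fun i => S.base.IsPos i),
      S.sgn i * S.cop i b = S.twoRho ν b := by
    rw [h0, Finset.filter_filter]
    refine Finset.sum_congr (by ext; simp [and_comm]) fun i hi => ?_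
    rw [S.sgn_pos (Finset.mem_filter.1 hi).2.1, one_mul]
  have h2 : ∑ i ∈ (Finset.univ.filter (fun i => S.len i = ν)).filter (fun i => ¬ S.base.IsPos i),
      S.sgn i * S.cop i b = S.twoRho ν b := by
    rw [h0, Finset.filter_filter]
    refine Finset.sum_nbij' S.ng S.ng ?_ ?_ ?_ ?_ ?_
    · intro i hi
      simp only [Finset.mem_filter, Finset.mem_univ, true_and] at hi ⊢
      exact ⟨(S.isPos_ng i).2 hi.2, by rw [len_ng, hi.1]⟩
    · intro i hi
      simp only [Finset.mem_filter, Finset.mem_univ, true_and] at hi ⊢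
      exact ⟨by rw [len_ng, hi.2], by rw [isPos_ng]; simpa using hi.1⟩
    · intro i _; exact S.ng_ng i
    · intro i _; exact S.ng_ng i
    · intro i hi
      rw [S.sgn_neg (Finset.mem_filter.1 hi).2.2, cop_ng]; ring
  unfold sumL
  rw [← Finset.sum_filter_add_sum_filter_not _ (fun i => S.base.IsPos i), h1, h2]
  ring

theorem two_mul_twoRho_smul (ν : S.NuR) (y : S.W) (b : S.Wt) :
    2 * S.twoRho ν (y • b) = S.sumL ν (fun i => S.sgn (y • i) * S.cop i b) := by
  rw [two_mul_twoRho, ← S.sumL_smul ν y]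
  simp only [cop_smul]

/-- The sum of `sgn(y α) sgn(x α)` over the roots of a given length. -/
def sgnSum (ν : S.NuR) (y x : S.W) : ℤ := S.sumL ν (fun i => S.sgn (y • i) * S.sgn (x • i))

theorem sgnSum_mul (ν : S.NuR) (y x v : S.W) :
    S.sgnSum ν (y * v) (x * v) = S.sgnSum ν y x := by
  unfold sgnSum
  simp only [mul_smul]
  exact S.sumL_smul ν v (fun i => S.sgn (y • i) * S.sgn (x • i))

/-- Four times the change of the number of inversions of length `ν` from `y` to `y s_a`. -/
def lenDiff (ν : S.NuR) (y : S.W) (a : ι) : ℤ :=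
  S.sgnSum ν y 1 - S.sgnSum ν (y * S.refl a) 1

theorem lenDiff_eq (ν : S.NuR) (y : S.W) (a : ι) :
    S.lenDiff ν y a = S.sumL ν (fun i => S.sgn (y • i) * (S.sgn i - S.sgn (S.refl a • i))) := by
  have h : S.sgnSum ν (y * S.refl a) 1 =
      S.sumL ν (fun i => S.sgn (y • i) * S.sgn (S.refl a • i)) := by
    rw [← S.sgnSum_mul ν _ _ (S.refl a), mul_assoc, refl_mul_self]
    simp [sgnSum]
  unfold lenDiff
  rw [h, sgnSum, ← sumL_sub]
  simp only [one_smul, mul_sub]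

/-- Averaging over the substitution i ↦ s_a i writes twice the difference as a sum of products of
two sign drops: that of i under s_a and that of y i under s_{ya}. Both drops are controlled by the
sign of the same pairing, so no term is negative, and the indices of ±α_a contribute 4 each. -/
theorem lenDiff_lower (ν : S.NuR) {y : S.W} {a : ι} (ha : S.base.IsPos a)
    (hy : S.base.IsPos (y • a)) : 4 * S.dl ν a ≤ S.lenDiff ν y a := by
  have h2 : 2 * S.lenDiff ν y a = S.sumL ν (fun i =>
      (S.sgn (y • i) - S.sgn ((y * S.refl a) • i)) * (S.sgn i - S.sgn (S.refl a • i))) := by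
    have e1 := S.lenDiff_eq ν y a
    have e2 : S.lenDiff ν y a = S.sumL ν (fun i =>
        S.sgn ((y * S.refl a) • i) * (S.sgn (S.refl a • i) - S.sgn i)) := by
      rw [e1, ← S.sumL_smul ν (S.refl a)]
      simp only [refl_smul_refl_smul, mul_smul]
    rw [two_mul]
    nth_rw 1 [e1]
    rw [e2, ← sumL_add]
    congr 1; funext i; ring
  have h3 : S.sumL ν (fun i => (if i = a then (4 : ℤ) else 0) + if i = S.ng a then (4 : ℤ) else 0)
      ≤ 2 * S.lenDiff ν y a := by
    rw [h2]
    refine S.sumL_le fun i => ?_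
    by_cases h1 : i = a
    · subst h1
      rw [mul_smul, refl_smul_self, smul_ng, sgn_ng, sgn_ng, S.sgn_pos ha, S.sgn_pos hy,
        if_pos rfl, if_neg (S.ng_ne i).symm]
      norm_num
    by_cases h1' : i = S.ng a
    · subst h1'
      rw [mul_smul, smul_ng (w := S.refl a), refl_smul_self, ng_ng, smul_ng, sgn_ng, sgn_ng,
        S.sgn_pos ha, S.sgn_pos hy, if_pos rfl, if_neg (S.ng_ne a)]
      norm_num
    rw [if_neg h1, if_neg h1']
    have hyr : (y * S.refl a) • i = S.refl (y • a) • (y • i) := by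
      rw [refl_smul_index, smul_smul]; simp
    have hc : S.cop (y • a) (S.rootWt (y • i)) = S.cop a (S.rootWt i) := by
      rw [rootWt_smul, cop_smul]
    rw [hyr]
    rcases le_total 0 (S.cop a (S.rootWt i)) with h | h
    · have q1 := S.sgn_refl_le ha h
      have q2 := S.sgn_refl_le hy (hc ▸ h)
      have := mul_nonneg (sub_nonneg.2 q2) (sub_nonneg.2 q1)
      simpa using this
    · have q1 := S.le_sgn_refl ha h
      have q2 := S.le_sgn_refl hy (hc ▸ h)
      have := mul_nonneg_of_nonpos_of_nonpos (sub_nonpos.2 q2) (sub_nonpos.2 q1)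
      simpa using this
  rw [sumL_add, sumL_ite, sumL_ite, dl_ng] at h3
  omega

theorem four_mul_twoRho_rootWt (ν : S.NuR) (x : S.W) (a : ι) :
    4 * S.twoRho ν (S.rootWt (x • a)) = S.sumL ν (fun i =>
      S.sgn (x • i) * (2 * S.cop i (S.rootWt a))) := by
  rw [rootWt_smul, show (4 : ℤ) = 2 * 2 by norm_num, mul_assoc, two_mul_twoRho_smul, ← sumL_mul]
  congr 1; funext i; ring

/-- With z = ya, both sides are sums over roots i of the sign drop under s_z, weighted by sgn(y⁻¹i)
on the left and by the integer (z, i^∨) in the ρ-term. A nonzero drop forces this integer to have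
the sign of the drop, hence to dominate ±1 in that direction. At ±z the integer is ±2, and this
surplus gives the constant 4. -/
theorem lenDiff_upper (ν : S.NuR) {y : S.W} {a : ι} (hy : S.base.IsPos (y • a)) :
    S.lenDiff ν y a ≤ 4 * S.twoRho ν (S.rootWt (y • a)) - 4 * S.dl ν a := by
  set z := y • a with hz
  have e1 : S.lenDiff ν y a = S.sumL ν (fun i =>
      (S.sgn i - S.sgn (S.refl z • i)) * S.sgn (y⁻¹ • i)) := by
    rw [← S.sumL_smul ν y, hz, refl_smul_index]
    unfold lenDiff sgnSum
    rw [← sumL_sub]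
    congr 1; funext i
    simp [mul_smul]; ring
  have e2 : 4 * S.twoRho ν (S.rootWt z) = S.sumL ν (fun i =>
      (S.sgn i - S.sgn (S.refl z • i)) * S.cop i (S.rootWt z)) := by
    have q := S.two_mul_twoRho ν (S.rootWt z)
    have q2 : S.sumL ν (fun i => S.sgn (S.refl z • i) * S.cop i (S.rootWt z)) =
        -(2 * S.twoRho ν (S.rootWt z)) := by
      rw [q, ← S.sumL_smul ν (S.refl z), ← neg_one_mul, ← sumL_mul]
      congr 1; funext i
      rw [refl_smul_refl_smul, cop_smul_left, refl_inv, ← rootWt_smul, refl_smul_self, rootWt_ng,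
        map_neg]; ring
    simp only [sub_mul]
    rw [sumL_sub, ← q, q2]; ring
  have e3 : S.sumL ν (fun i => (S.sgn i - S.sgn (S.refl z • i)) * S.sgn (y⁻¹ • i) +
      ((if i = z then (2 : ℤ) else 0) + if i = S.ng z then (2 : ℤ) else 0)) ≤
      4 * S.twoRho ν (S.rootWt z) := by
    rw [e2]
    refine S.sumL_le fun i => ?_
    by_cases h1 : i = z
    · subst h1
      rw [refl_smul_self, sgn_ng, S.sgn_pos hy, cop_self, if_pos rfl, if_neg (S.ng_ne z).symm]
      rcases S.sgn_cases (y⁻¹ • z) with h | h <;> rw [h] <;> norm_num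
    by_cases h1' : i = S.ng z
    · subst h1'
      rw [smul_ng (w := S.refl z), refl_smul_self, ng_ng, sgn_ng, S.sgn_pos hy, cop_ng, cop_self,
        if_pos rfl, if_neg (S.ng_ne z)]
      rcases S.sgn_cases (y⁻¹ • S.ng z) with h | h <;> rw [h] <;> norm_num
    rw [if_neg h1, if_neg h1']
    have hs := S.sgn_cases (y⁻¹ • i)
    rcases lt_trichotomy 0 (S.cop z (S.rootWt i)) with h | h | h
    · have q1 := sub_nonneg.2 (S.sgn_refl_le hy h.le)
      have q2 : 1 ≤ S.cop i (S.rootWt z) := S.cop_comm_pos.1 h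
      have q3 : S.sgn (y⁻¹ • i) ≤ S.cop i (S.rootWt z) := by rcases hs with h | h <;> omega
      simpa using mul_le_mul_of_nonneg_left q3 q1
    · rw [S.refl_smul_of_cop_eq_zero h.symm]; simp
    · have q1 := sub_nonpos.2 (S.le_sgn_refl hy h.le)
      have q2 : S.cop i (S.rootWt z) < 0 := S.cop_comm_neg.1 h
      have q3 : S.cop i (S.rootWt z) ≤ S.sgn (y⁻¹ • i) := by rcases hs with h | h <;> omega
      simpa using mul_le_mul_of_nonpos_left q3 q1
  rw [sumL_add, sumL_add, sumL_ite, sumL_ite, dl_ng, ← e1, hz, dl_smul] at e3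
  rw [hz]
  omega

/-! ### Affine simple roots -/

/-- Away from ±θ the pairing with θ is 0 or ±1. If it is 0, the root is fixed by s_θ. Otherwise
dominance of θ makes the pairing equal to the sign of the root, and s_θ negates it. At ±θ the
pairing is ±2, whence the corrections. -/
theorem sgn_sub_sgn_refl_theta (i : ι) : S.sgn i - S.sgn (S.refl S.θ • i) =
    2 * S.cop i (S.rootWt S.θ) - (if i = S.θ then 2 else 0) + (if i = S.ng S.θ then 2 else 0) := by
  by_cases h1 : i = S.θ
  · subst h1
    rw [refl_smul_self, sgn_ng, S.sgn_pos S.theta_isPos, cop_self, if_pos rfl,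
      if_neg (S.ng_ne _).symm]
    norm_num
  by_cases h2 : i = S.ng S.θ
  · subst h2
    rw [smul_ng (w := S.refl _), refl_smul_self, ng_ng, sgn_ng, S.sgn_pos S.theta_isPos, cop_ng,
      cop_self, if_pos rfl, if_neg (S.ng_ne _)]
    norm_num
  rw [if_neg h1, if_neg h2]
  have key : ∀ j : ι, S.cop j (S.rootWt S.θ) < 0 → S.sgn j = -1 := fun j hj => by
    refine S.sgn_neg fun hp => ?_
    have := S.theta_dominant.cop_nonneg hp
    omega
  have key' : ∀ j : ι, 0 < S.cop j (S.rootWt S.θ) → S.sgn j = 1 := fun j hj => by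
    have := key (S.ng j) (by rw [cop_ng]; omega)
    rw [sgn_ng] at this; omega
  have hr : S.cop (S.refl S.θ • i) (S.rootWt S.θ) = -S.cop i (S.rootWt S.θ) := by
    rw [cop_smul_left, refl_inv, ← rootWt_smul, refl_smul_self, rootWt_ng, map_neg]
  rcases (S.cop_theta_cases i).resolve_left h1 |>.resolve_left h2 with h | h | h
  · have : S.cop S.θ (S.rootWt i) = 0 := by
      by_contra hne
      rcases lt_or_gt_of_ne hne with h' | h'
      · have := S.cop_comm_neg.1 h'; omega
      · have := S.cop_comm_pos.1 h'; omega
    rw [S.refl_smul_of_cop_eq_zero this, h]; simp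
  · rw [key' i (by omega), key _ (by rw [hr]; omega), h]; norm_num
  · rw [key i (by omega), key' _ (by rw [hr]; omega), h]; norm_num

theorem sgn_sub_sgn_refl_support {k : ι} (hk : k ∈ S.base.support) (i : ι) :
    S.sgn i - S.sgn (S.refl k • i) = (if i = k then 2 else 0) - (if i = S.ng k then 2 else 0) := by
  have hkp := S.base.isPos_of_mem_support hk
  by_cases h1 : i = k
  · subst h1
    rw [refl_smul_self, sgn_ng, S.sgn_pos hkp, if_pos rfl, if_neg (S.ng_ne _).symm]
    norm_num
  by_cases h2 : i = S.ng k
  · subst h2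
    rw [smul_ng (w := S.refl _), refl_smul_self, ng_ng, sgn_ng, S.sgn_pos hkp, if_pos rfl,
      if_neg (S.ng_ne _)]
    norm_num
  rw [if_neg h1, if_neg h2]
  by_cases hi : S.base.IsPos i
  · have := hi.reflectionPerm hk h1
    rw [S.sgn_pos hi, S.sgn_pos (i := S.refl k • i) this]; norm_num
  · have hi' : S.base.IsPos (S.ng i) := (S.isPos_ng i).2 hi
    have : S.base.IsPos (S.refl k • S.ng i) :=
      hi'.reflectionPerm hk (fun h => h2 (S.ng_eq_iff.1 h))
    rw [smul_ng, isPos_ng] at this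
    rw [S.sgn_neg hi, S.sgn_neg this]; norm_num

/-- Levels 0 and 1 of the finite and affine simple roots put both cases into one formula, so the
affine vertex needs no separate treatment afterwards. -/
theorem sgn_sub_sgn_refl_simple (j : S.AffIdx) (i : ι) :
    S.sgn i - S.sgn (S.refl (S.simple j).1 • i) =
      (if i = (S.simple j).1 then 2 else 0) - (if i = S.ng (S.simple j).1 then 2 else 0) -
        2 * (S.simple j).2 * S.cop i (S.rootWt (S.simple j).1) := by
  rcases j with _ | k
  · change S.sgn i - S.sgn (S.refl (S.ng S.θ) • i) = (if i = S.ng S.θ then 2 else 0) -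
      (if i = S.ng (S.ng S.θ) then 2 else 0) - 2 * 1 * S.cop i (S.rootWt (S.ng S.θ))
    rw [refl_ng, ng_ng, sgn_sub_sgn_refl_theta, rootWt_ng, map_neg]; ring
  · change S.sgn i - S.sgn (S.refl (k : ι) • i) = (if i = (k : ι) then 2 else 0) -
      (if i = S.ng k then 2 else 0) - 2 * 0 * S.cop i (S.rootWt (k : ι))
    rw [S.sgn_sub_sgn_refl_support k.2]; ring

/-- For a finite simple root this is the familiar change of length by one. For α₀ the pairing terms
of `sgn_sub_sgn_refl_simple`, summed against the signs of x, assemble into the ρ-term. -/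
theorem lenDiff_simple (ν : S.NuR) (x : S.W) (j : S.AffIdx) :
    S.lenDiff ν x (S.simple j).1 = 4 * S.dl ν (S.simple j).1 * S.sgn (x • (S.simple j).1) -
      4 * (S.simple j).2 * S.twoRho ν (S.rootWt (x • (S.simple j).1)) := by
  rw [lenDiff_eq]
  simp only [sgn_sub_sgn_refl_simple]
  set c := (S.simple j).1
  have e1 : ∀ i, S.sgn (x • i) * ((if i = c then 2 else 0) - (if i = S.ng c then 2 else 0) -
      2 * (S.simple j).2 * S.cop i (S.rootWt c)) =
      ((if i = c then 2 * S.sgn (x • c) else 0) - (if i = S.ng c then -2 * S.sgn (x • c) else 0)) -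
        (S.simple j).2 * (S.sgn (x • i) * (2 * S.cop i (S.rootWt c))) := by
    intro i
    have : (if i = c then 2 * S.sgn (x • c) else 0) = S.sgn (x • i) * (if i = c then 2 else 0) := by
      split_ifs with h
      · rw [h]; ring
      · simp
    rw [this]
    have : (if i = S.ng c then -2 * S.sgn (x • c) else 0) =
        S.sgn (x • i) * (if i = S.ng c then 2 else 0) := by
      split_ifs with h
      · rw [h, smul_ng, sgn_ng]; ring
      · simp
    rw [this]; ring
  simp only [e1]
  rw [sumL_sub, sumL_sub, sumL_ite, sumL_ite, sumL_mul, ← four_mul_twoRho_rootWt, dl_ng]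
  ring

end

section

/-! ### The extended affine Weyl group acting on affine roots -/

/-- The translation part of an element of the extended affine Weyl group. -/
def tra (g : S.What) : S.Wt := Multiplicative.toAdd g.left

theorem What_ext {g h : S.What} (h1 : S.tra g = S.tra h) (h2 : g.right = h.right) : g = h :=
  SemidirectProduct.ext (congrArg Multiplicative.ofAdd h1) h2

theorem tra_mul (g h : S.What) : S.tra (g * h) = S.tra g + g.right • S.tra h := rfl

theorem tra_one : S.tra 1 = 0 := rfl

theorem tra_inv (g : S.What) : S.tra g⁻¹ = -(g.right⁻¹ • S.tra g) := by
  have h := S.tra_mul g⁻¹ g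
  rw [inv_mul_cancel, tra_one, SemidirectProduct.inv_right] at h
  exact eq_neg_of_add_eq_zero_left h.symm

theorem tra_tr (b : S.Wt) : S.tra (S.tr b) = b := rfl

theorem right_tr (b : S.Wt) : (S.tr b).right = 1 := rfl

theorem tra_fin (w : S.W) : S.tra (S.fin w) = 0 := rfl

theorem right_fin (w : S.W) : (S.fin w).right = w := rfl

theorem tra_sAff (a : S.AffRoot) : S.tra (S.sAff a) = -(a.2 • S.rootWt a.1) := by
  unfold sAff
  rw [tra_mul, tra_tr, tra_fin, smul_zero, add_zero]

theorem right_sAff (a : S.AffRoot) : (S.sAff a).right = S.refl a.1 := one_mul _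

theorem actAff_fst (g : S.What) (a : S.AffRoot) : (S.actAff g a).1 = g.right • a.1 := rfl

theorem actAff_snd (g : S.What) (a : S.AffRoot) :
    (S.actAff g a).2 = a.2 - S.cop (g.right • a.1) (S.tra g) := rfl

theorem actAff_one (a : S.AffRoot) : S.actAff 1 a = a := by
  refine Prod.ext (one_smul _ _) ?_
  rw [actAff_snd, tra_one]; simp

theorem actAff_mul (g h : S.What) (a : S.AffRoot) :
    S.actAff (g * h) a = S.actAff g (S.actAff h a) := by
  refine Prod.ext (mul_smul _ _ _) ?_
  simp only [actAff_snd, actAff_fst, tra_mul, SemidirectProduct.mul_right, map_add, mul_smul,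
    cop_smul]
  ring

theorem actAff_actAff_inv (g : S.What) (a : S.AffRoot) : S.actAff g (S.actAff g⁻¹ a) = a := by
  rw [← actAff_mul, mul_inv_cancel, actAff_one]

theorem actAff_negAff (g : S.What) (a : S.AffRoot) :
    S.actAff g (S.negAff a) = S.negAff (S.actAff g a) := by
  refine Prod.ext (S.smul_ng _ _) ?_
  change -a.2 - S.cop (g.right • S.ng a.1) (S.tra g) = -(a.2 - S.cop (g.right • a.1) (S.tra g))
  rw [smul_ng, cop_ng]; ring

theorem sAff_mul_self (a : S.AffRoot) : S.sAff a * S.sAff a = 1 := by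
  refine S.What_ext ?_ ?_
  · rw [tra_mul, tra_sAff, right_sAff, smul_neg, smul_comm, ← rootWt_smul, refl_smul_self,
      rootWt_ng, tra_one]
    simp
  · rw [SemidirectProduct.mul_right, right_sAff, refl_mul_self]; rfl

theorem sAff_inv (a : S.AffRoot) : (S.sAff a)⁻¹ = S.sAff a := by
  rw [inv_eq_iff_mul_eq_one, sAff_mul_self]

theorem sAff_actAff (g : S.What) (a : S.AffRoot) :
    S.sAff (S.actAff g a) = g * S.sAff a * g⁻¹ := by
  refine S.What_ext ?_ ?_
  · simp only [tra_mul, tra_sAff, actAff_fst, actAff_snd, right_sAff, tra_inv,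
      smul_neg, smul_smul, mul_assoc]
    rw [smul_add, smul_neg, smul_neg, smul_smul g.right (_ * _), ← mul_assoc, ← refl_smul_index,
      refl_smul_wt, rootWt_smul, smul_comm g.right, sub_smul]
    abel
  · simp only [SemidirectProduct.mul_right, SemidirectProduct.inv_right, right_sAff, actAff_fst,
      refl_smul_index]

theorem sAff_negAff (a : S.AffRoot) : S.sAff (S.negAff a) = S.sAff a := by
  refine S.What_ext ?_ ?_
  · rw [tra_sAff, tra_sAff]
    change -((-a.2) • S.rootWt (S.ng a.1)) = _
    rw [rootWt_ng]; simp
  · rw [right_sAff, right_sAff]; exact S.refl_ng a.1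

theorem s_mul_self (j : S.AffIdx) : S.s j * S.s j = 1 := S.sAff_mul_self _

theorem actAff_sAff_self (a : S.AffRoot) : S.actAff (S.sAff a) a = S.negAff a := by
  refine Prod.ext ?_ ?_
  · rw [actAff_fst, right_sAff]; rfl
  · rw [actAff_snd, right_sAff, refl_smul_self, tra_sAff, cop_ng, map_neg, map_zsmul, cop_self]
    change _ = -a.2
    simp only [smul_eq_mul]; ring

/-- An integer whose sign is the sign of the affine root `[α, ν_α j]`. -/
def affSgn (a : S.AffRoot) : ℤ := 2 * a.2 + S.sgn a.1

theorem affSgn_negAff (a : S.AffRoot) : S.affSgn (S.negAff a) = -S.affSgn a := by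
  change 2 * (-a.2) + S.sgn (S.ng a.1) = -(2 * a.2 + S.sgn a.1)
  rw [sgn_ng]; ring

theorem affSgn_ne_zero (a : S.AffRoot) : S.affSgn a ≠ 0 := by
  unfold affSgn
  rcases S.sgn_cases a.1 with h | h <;> omega

theorem affSgn_simple (j : S.AffIdx) : S.affSgn (S.simple j) = 1 := by
  rcases j with _ | k
  · change 2 * 1 + S.sgn (S.ng S.θ) = 1
    rw [sgn_ng, S.sgn_pos S.theta_isPos]; norm_num
  · change 2 * 0 + S.sgn (k : ι) = 1
    rw [S.sgn_pos (S.base.isPos_of_mem_support k.2)]; norm_num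

/-- The shift of the level by the translation part of s_j cancels the pairing term of
`sgn_sub_sgn_refl_simple`. Only affine roots whose finite part is that of ±α_j are affected. -/
theorem affSgn_s (j : S.AffIdx) (a : S.AffRoot) :
    S.affSgn (S.actAff (S.s j) a) = S.affSgn a - (if a.1 = (S.simple j).1 then 2 else 0) +
      (if a.1 = S.ng (S.simple j).1 then 2 else 0) := by
  have h := S.sgn_sub_sgn_refl_simple j a.1
  unfold affSgn s
  rw [actAff_snd, actAff_fst, right_sAff, tra_sAff, map_neg, map_zsmul, cop_smul_left, refl_inv,
    ← rootWt_smul, refl_smul_self, rootWt_ng, map_neg, smul_eq_mul]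
  linarith

/-- A simple reflection permutes the positive affine roots except for the simple one. -/
theorem affSgn_s_pos {j : S.AffIdx} {a : S.AffRoot} (ha : 0 < S.affSgn a)
    (h : a ≠ S.simple j) : 0 < S.affSgn (S.actAff (S.s j) a) := by
  rw [affSgn_s]
  have h1 := S.affSgn_simple j
  by_cases h2 : a.1 = (S.simple j).1
  · rw [if_pos h2, if_neg (h2 ▸ (S.ng_ne a.1).symm)]
    -- With the same finite part but another level, positivity puts the level above that of α_j. The
    -- sign integer is then at least 3 and survives the loss of 2.
    have h3 : a.2 ≠ (S.simple j).2 := fun h3 => h (Prod.ext h2 h3)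
    unfold affSgn at *
    rw [← h2] at h1
    omega
  · rw [if_neg h2]
    split_ifs <;> omega

/-! ### Exchange -/

/-- The element of the affine Weyl group given by a word in simple reflections. -/
abbrev word (js : List S.AffIdx) : S.What := (js.map S.s).prod

theorem word_reverse (js : List S.AffIdx) : S.word js.reverse = (S.word js)⁻¹ := by
  unfold word
  rw [List.prod_inv_reverse, List.map_map, List.map_reverse]
  congr 2
  refine List.map_congr_left fun j _ => ?_
  exact (S.sAff_inv _).symm

/-- Acting letter by letter from the right, α_j first becomes negative at some letter k. As s_k
makes no positive root other than α_k negative, the root is α_k at that point. So s_k is the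
conjugate of s_j by the letters already read, and multiplying by s_j deletes k. -/
theorem exchange (j : S.AffIdx) (ks : List S.AffIdx)
    (h : S.affSgn (S.actAff (S.word ks) (S.simple j)) < 0) :
    ∃ ks', ks'.length < ks.length ∧ S.word ks * S.s j = S.word ks' := by
  induction ks with
  | nil =>
    simp only [word, List.map_nil, List.prod_nil, actAff_one, affSgn_simple] at h
    omega
  | cons k ks ih =>
    have hw : S.word (k :: ks) = S.s k * S.word ks := by simp [word]
    rcases lt_or_gt_of_ne (S.affSgn_ne_zero (S.actAff (S.word ks) (S.simple j))) with h1 | h1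
    · obtain ⟨ks', hl, he⟩ := ih h1
      refine ⟨k :: ks', by simpa using hl, ?_⟩
      rw [hw, mul_assoc, he]; simp [word]
    · have h2 : S.actAff (S.word ks) (S.simple j) = S.simple k := by
        by_contra hne
        have := S.affSgn_s_pos h1 hne
        rw [hw, actAff_mul] at h
        omega
      have h3 := S.sAff_actAff (S.word ks) (S.simple j)
      rw [h2] at h3
      refine ⟨ks, by simp, ?_⟩
      have h4 : S.s k = S.word ks * S.s j * (S.word ks)⁻¹ := h3
      rw [hw, h4]
      have := S.s_mul_self j
      calc S.word ks * S.s j * (S.word ks)⁻¹ * S.word ks * S.s j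
          = S.word ks * (S.s j * S.s j) := by group
        _ = S.word ks := by rw [this, mul_one]

theorem mem_lamSeq {js : List S.AffIdx} {a : S.AffRoot} (h : a ∈ S.lamSeq js) :
    ∃ pre j suf, js = pre ++ j :: suf ∧ a = S.actAff (S.word suf)⁻¹ (S.simple j) := by
  induction js with
  | nil => simp [lamSeq] at h
  | cons k js ih =>
    rw [lamSeq, List.mem_cons] at h
    rcases h with rfl | h
    · exact ⟨[], k, js, rfl, rfl⟩
    · obtain ⟨pre, j, suf, rfl, rfl⟩ := ih h
      exact ⟨k :: pre, j, suf, rfl, rfl⟩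

/-! ### The elements of length zero -/

/-- The short dominant root is the largest one after normalization: `θ^∨ - β^∨` is a nonnegative
combination of simple roots for all roots `β`. -/
theorem nu_smul_theta_sub_mem (i : ι) : ∃ m : ℕ, S.nu i = m ∧
    m • S.P.root S.θ - S.P.root i ∈ AddSubmonoid.closure (S.P.root '' S.base.support) := by
  set C := AddSubmonoid.closure (S.P.root '' S.base.support) with hC
  by_contra hbad
  -- A counterexample of maximal height: if it is not dominant, a simple reflection raises its
  -- height and adds only a multiple of a simple root to the difference, so it must be dominant.
  obtain ⟨c, hc, hmax⟩ := Finset.exists_max_image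
    (Finset.univ.filter fun i => ¬ ∃ m : ℕ, S.nu i = m ∧ m • S.P.root S.θ - S.P.root i ∈ C)
    S.base.height ⟨i, by simpa using hbad⟩
  simp only [Finset.mem_filter, Finset.mem_univ, true_and] at hc hmax
  refine hc ?_
  by_cases hd : S.IsDominant (S.rootWt c)
  -- Irreducibility gives a short root e not orthogonal to α_c, and up to sign (α_c, e) > 0. Since θ
  -- - e is in the positive cone and α_c is dominant, (α_c, θ) > 0 too.
  · obtain ⟨e, he1, he2⟩ := S.P.exists_form_eq_form_and_form_ne_zero S.B c S.θ
    rw [θ_short] at he1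
    have : ∃ e, S.B.form (S.P.root e) (S.P.root e) = 2 ∧
        0 < S.B.form (S.P.root c) (S.P.root e) := by
      rcases lt_or_gt_of_ne he2 with h | h
      · refine ⟨S.ng e, by rw [root_ng]; simpa using he1, by rw [root_ng, map_neg]; linarith⟩
      · exact ⟨e, he1, h⟩
    obtain ⟨e, he1, he2⟩ := this
    have h1 := S.mem_closure_form_nonneg hd (S.θ_max e he1)
    rw [map_sub] at h1
    have h2 : 0 < S.B.form (S.P.root S.θ) (S.P.root c) := by
      rw [form_symm]
      change 0 ≤ S.B.form (S.P.root c) _ - S.B.form (S.P.root c) _ at h1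
      linarith
    have h3 : 0 < S.cop c (S.rootWt S.θ) := by
      have := S.form_rootWt (S.rootWt S.θ) c
      change S.B.form (S.P.root S.θ) (S.P.root c) = _ at this
      rw [this] at h2
      exact_mod_cast (pos_iff_pos_of_mul_pos h2).1 (S.nu_pos c)
    rcases S.cop_theta_cases c with h | h | h
    · refine ⟨1, by rw [h, nu_theta]; simp, ?_⟩
      rw [h]; simp
    · rw [h, cop_ng, cop_self] at h3; omega
    · have h4 : S.cop c (S.rootWt S.θ) = 1 := by omega
      have h5 := S.nu_mul_cop c S.θ
      rw [h4, nu_theta] at h5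
      have h6 : S.nu c = S.cop S.θ (S.rootWt c) := by push_cast at h5; linarith
      obtain ⟨m, hm⟩ := Int.eq_ofNat_of_zero_le (a := S.cop S.θ (S.rootWt c)) (by
        have := S.nu_pos c
        rw [h6] at this
        exact_mod_cast this.le)
      have hm' : S.nu c = m := by rw [h6, hm]; simp
      refine ⟨m, hm', ?_⟩
      have hm1 : 1 ≤ m := by
        have := S.one_le_nu c
        rw [hm'] at this
        exact_mod_cast this
      rcases Nat.eq_or_lt_of_le hm1 with h7 | h7
      · subst h7
        rw [one_smul]
        refine S.θ_max c ?_
        have : S.nu c = 1 := by rw [hm']; simp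
        unfold nu at this
        linarith
      -- The root -s_cθ = α_c - θ is short, so θ - (α_c - θ) = 2θ - α_c lies in the cone. The other
      -- m - 2 copies of θ are positive.
      · have h8 : S.B.form (S.P.root (S.ng (S.refl c • S.θ)))
            (S.P.root (S.ng (S.refl c • S.θ))) = 2 := by
          rw [root_ng]
          simp only [map_neg, LinearMap.neg_apply, neg_neg]
          rw [root_smul, form_smul, θ_short]
        have h9 := S.θ_max _ h8
        rw [root_ng, root_refl, h4] at h9
        obtain ⟨r, rfl⟩ := Nat.exists_eq_add_of_le h7
        have : (Nat.succ 1 + r) • S.P.root S.θ - S.P.root c =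
            (S.P.root S.θ - -(S.P.root S.θ - (1 : ℤ) • S.P.root c)) + r • S.P.root S.θ := by
          rw [add_smul, one_smul, Nat.succ_eq_add_one, one_add_one_eq_two, two_nsmul]
          abel
        rw [this]
        exact add_mem h9 (nsmul_mem ((S.isPos_iff_mem _).1 S.theta_isPos) r)
  · unfold IsDominant at hd
    push Not at hd
    obtain ⟨k, hk, hneg⟩ := hd
    have h1 := S.refl_height k c
    rw [S.base.height_one_of_mem_support hk] at h1
    have h2 : ∃ m : ℕ, S.nu (S.refl k • c) = m ∧
        m • S.P.root S.θ - S.P.root (S.refl k • c) ∈ C := by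
      by_contra h3
      have := hmax _ h3
      omega
    obtain ⟨m, hm, hmem⟩ := h2
    refine ⟨m, by rw [← hm, nu_smul], ?_⟩
    obtain ⟨n, hn⟩ := Int.eq_ofNat_of_zero_le (a := -S.cop k (S.rootWt c)) (by omega)
    have : m • S.P.root S.θ - S.P.root c =
        (m • S.P.root S.θ - S.P.root (S.refl k • c)) + n • S.P.root k := by
      rw [root_refl, ← natCast_zsmul _ n, ← hn]; module
    rw [this]
    exact add_mem hmem (nsmul_mem (AddSubmonoid.subset_closure (Set.mem_image_of_mem _ hk)) n)

/-- Let c be the translation part of π moved to the right of its finite part. Finite simple roots go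
to affine simple ones, whose level is 0 or 1, so c is nonpositive on the positive cone, and vectors
of the cone orthogonal to c stay in the cone. The image of α₀ gives (c, θ) ≥ -1, and
`nu_smul_theta_sub_mem` carries this bound to every positive root. Hence the pairing is 0 (sign
kept) or -1 (sign reversed). -/
theorem affSgn_root_of_isPi {π : S.What} (hπ : S.IsPi π) {i : ι} (hi : S.base.IsPos i) :
    2 * S.cop i (π.right⁻¹ • S.tra π) = S.sgn (π.right • i) - S.sgn i := by
  set C := AddSubmonoid.closure (S.P.root '' S.base.support) with hC
  set c := π.right⁻¹ • S.tra π with hc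
  have hact : ∀ a : S.AffRoot, S.actAff π a = (π.right • a.1, a.2 - S.cop a.1 c) := fun a => by
    refine Prod.ext rfl ?_
    rw [actAff_snd, cop_smul_left]
  have key : ∀ x ∈ C, S.B.form (c : M) x ≤ 0 ∧
      (S.B.form (c : M) x = 0 → π.right • x ∈ C) := by
    intro x hx
    induction hx using AddSubmonoid.closure_induction with
    | mem x hx =>
      obtain ⟨k, hk, rfl⟩ := hx
      obtain ⟨j, hj⟩ := hπ (some ⟨k, hk⟩)
      rw [hact] at hj
      change (π.right • k, 0 - S.cop k c) = S.simple j at hj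
      rw [form_rootWt]
      have hν := S.nu_pos k
      rcases j with _ | l
      · have h2 : 0 - S.cop k c = 1 := congrArg Prod.snd hj
        have h3 : S.cop k c = -1 := by omega
        rw [h3]
        push_cast
        exact ⟨by linarith, fun h => by linarith⟩
      · have h1 : π.right • k = (l : ι) := congrArg Prod.fst hj
        have h2 : 0 - S.cop k c = 0 := congrArg Prod.snd hj
        have h3 : S.cop k c = 0 := by omega
        rw [h3, ← root_smul, h1]
        exact ⟨by simp, fun _ => AddSubmonoid.subset_closure (Set.mem_image_of_mem _ l.2)⟩
    | zero => simp
    | add x y _ _ hx hy =>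
      rw [map_add, smul_add]
      refine ⟨add_nonpos hx.1 hy.1, fun h => ?_⟩
      exact add_mem (hx.2 (by linarith [hx.1, hy.1])) (hy.2 (by linarith [hx.1, hy.1]))
  have hν := S.nu_pos i
  obtain ⟨h1, h2⟩ := key _ ((S.isPos_iff_mem i).1 hi)
  rw [form_rootWt] at h1 h2
  obtain ⟨m, hm, hmem⟩ := S.nu_smul_theta_sub_mem i
  obtain ⟨h3, h4⟩ := key _ hmem
  rw [map_sub, map_nsmul, form_rootWt, form_rootWt, nu_theta, nsmul_eq_mul, ← hm, one_mul,
    ← mul_sub] at h3 h4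
  obtain ⟨j, hj⟩ := hπ none
  rw [hact] at hj
  change (π.right • S.ng S.θ, 1 - S.cop (S.ng S.θ) c) = S.simple j at hj
  have h5 : 0 ≤ 1 + S.cop S.θ c := by
    have : 1 - S.cop (S.ng S.θ) c = (S.simple j).2 := congrArg Prod.snd hj
    rw [cop_ng] at this
    have h0 : 0 ≤ (S.simple j).2 := by rcases j with _ | l <;> simp [simple]
    omega
  have h6 : S.cop i c ≤ 0 := by
    by_contra hcon
    have : (0 : ℝ) < S.cop i c := by exact_mod_cast not_le.1 hcon
    have := mul_pos hν this
    linarith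
  have h7 : S.cop S.θ c ≤ S.cop i c := by
    by_contra hcon
    have : (0 : ℝ) < S.cop S.θ c - S.cop i c := by
      have : (S.cop i c : ℝ) < S.cop S.θ c := by exact_mod_cast not_le.1 hcon
      linarith
    have := mul_pos hν this
    linarith
  rw [S.sgn_pos hi]
  rcases (show S.cop i c = 0 ∨ S.cop i c = -1 by omega) with h8 | h8
  · have h9 := h2 (by rw [h8]; simp)
    rw [← root_smul, ← isPos_iff_mem] at h9
    rw [h8, S.sgn_pos h9]; norm_num
  -- Now mθ - α_i is orthogonal to c, so its image stays in the cone, while -θ goes to a simple root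
  -- of level 0, hence positive. Together these make -π(α_i) positive.
  · have h9 : S.cop S.θ c = -1 := by omega
    have h10 := h4 (by rw [h8, h9]; simp)
    have h11 : π.right • S.ng S.θ = (S.simple j).1 := congrArg Prod.fst hj
    have h12 : S.base.IsPos (S.simple j).1 := by
      rcases j with _ | l
      · have : 1 - S.cop (S.ng S.θ) c = 1 := congrArg Prod.snd hj
        rw [cop_ng] at this
        omega
      · exact S.base.isPos_of_mem_support l.2
    rw [← h11, isPos_iff_mem, root_smul, root_ng] at h12
    have h13 : S.base.IsPos (S.ng (π.right • i)) := by
      rw [isPos_iff_mem, root_ng, root_smul]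
      have : -(π.right • S.P.root i) = π.right • (m • S.P.root S.θ - S.P.root i) +
          m • π.right • (-S.P.root S.θ) := by
        rw [smul_sub, smul_comm π.right m, smul_neg, smul_neg]; abel
      rw [this]
      exact add_mem h10 (nsmul_mem h12 m)
    rw [isPos_ng] at h13
    rw [h8, S.sgn_neg h13]; norm_num

theorem two_mul_cop_of_isPi {π : S.What} (hπ : S.IsPi π) (i : ι) :
    2 * S.cop i (π.right⁻¹ • S.tra π) = S.sgn (π.right • i) - S.sgn i := by
  by_cases hi : S.base.IsPos i
  · exact S.affSgn_root_of_isPi hπ hi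
  · have := S.affSgn_root_of_isPi hπ ((S.isPos_ng i).2 hi)
    rw [cop_ng, smul_ng, sgn_ng, sgn_ng] at this
    omega

theorem affSgn_of_isPi {π : S.What} (hπ : S.IsPi π) (a : S.AffRoot) :
    S.affSgn (S.actAff π a) = S.affSgn a := by
  have := S.two_mul_cop_of_isPi hπ a.1
  unfold affSgn
  rw [actAff_snd, actAff_fst, cop_smul_left]
  omega

/-- The affine roots attached to a reduced decomposition of a dominant weight
are of the form `[α, ν_α j]` with `α > 0`. -/
theorem isPos_of_mem_lamSeq {b : S.Wt} (hb : S.IsDominant b) {π : S.What} {js : List S.AffIdx}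
    (hred : S.IsReducedDec (S.tr b) π js) {a : S.AffRoot} (ha : a ∈ S.lamSeq js) :
    S.base.IsPos a.1 := by
  obtain ⟨hπ, he, hmin⟩ := hred
  obtain ⟨pre, j, suf, rfl, rfl⟩ := S.mem_lamSeq ha
  have hprod : S.word (pre ++ j :: suf) = S.word pre * (S.s j * S.word suf) := by simp [word]
  -- Otherwise the exchange property, applied to the reversed suffix, would shorten the
  -- decomposition. The prefix is treated in the same way.
  have h1 : 0 < S.affSgn (S.actAff (S.word suf)⁻¹ (S.simple j)) := by
    by_contra h
    rw [← word_reverse] at h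
    obtain ⟨ks, hl, hk⟩ := S.exchange j suf.reverse
      (lt_of_le_of_ne (not_lt.1 h) (S.affSgn_ne_zero _))
    have hk' : S.s j * S.word suf = S.word ks.reverse := by
      rw [word_reverse, ← hk, word_reverse, mul_inv_rev, inv_inv]
      congr 1
      exact (S.sAff_inv _).symm
    have := hmin π (pre ++ ks.reverse) hπ (by
      rw [he]
      change π * S.word _ = π * S.word _
      rw [hprod, hk']; simp [word])
    simp at this hl
    omega
  have h2 : 0 < S.affSgn (S.actAff (S.word pre) (S.simple j)) := by
    by_contra h
    obtain ⟨ks, hl, hk⟩ := S.exchange j pre (lt_of_le_of_ne (not_lt.1 h) (S.affSgn_ne_zero _))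
    have := hmin π (ks ++ suf) hπ (by
      rw [he]
      change π * S.word _ = π * S.word _
      rw [hprod, ← mul_assoc (S.word pre), hk]; simp [word])
    simp at this
    omega
  have h3 : S.actAff (S.tr b) (S.actAff (S.word suf)⁻¹ (S.simple j)) =
      S.actAff π (S.negAff (S.actAff (S.word pre) (S.simple j))) := by
    rw [he]
    change S.actAff (π * S.word _) _ = _
    rw [hprod, actAff_mul, actAff_mul, actAff_mul, actAff_actAff_inv, ← actAff_negAff]
    congr 2
    exact S.actAff_sAff_self _
  generalize S.actAff (S.word suf)⁻¹ (S.simple j) = a at h1 h3 ⊢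
  have h4 := congrArg S.affSgn h3
  rw [S.affSgn_of_isPi hπ, affSgn_negAff] at h4
  -- A positive affine root with negative finite part has level at least 1, and a dominant b can
  -- only raise the level. Its image under b would be positive, whereas `h4` makes it negative.
  by_contra hneg
  have h5 := hb.cop_nonneg ((S.isPos_ng _).2 hneg)
  rw [cop_ng] at h5
  unfold affSgn at h1 h2 h4
  rw [actAff_snd, actAff_fst, right_tr, one_smul, tra_tr] at h4
  rw [S.sgn_neg hneg] at h1 h4
  omega

/-! ### The order function -/

/-- The sum of the signs of `y(α)` over the roots of a given length in a sequence. -/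
def psi (ν : S.NuR) (as : List S.AffRoot) (y : S.W) : ℤ :=
  (as.map fun a => S.dl ν a.1 * S.sgn (y • a.1)).sum

theorem psi_cons (ν : S.NuR) (a : S.AffRoot) (as : List S.AffRoot) (y : S.W) :
    S.psi ν (a :: as) y = S.dl ν a.1 * S.sgn (y • a.1) + S.psi ν as y := rfl

/-- A closed expression for `4 psi`, defined for all elements of the extended
affine Weyl group. -/
def omg (ν : S.NuR) (g : S.What) (y : S.W) : ℤ :=
  4 * S.twoRho ν (y • g.right⁻¹ • S.tra g) - S.sgnSum ν y g.right + S.sgnSum ν y 1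

/-- The ρ-term created by the translation part of s_j cancels the one in `lenDiff_simple`, leaving a
single sign. -/
theorem omg_s_mul (ν : S.NuR) (j : S.AffIdx) (g : S.What) (y : S.W) :
    S.omg ν (S.s j * g) y = S.omg ν g y +
      4 * (S.dl ν (S.simple j).1 * S.sgn (y • g.right⁻¹ • (S.simple j).1)) := by
  have h := S.lenDiff_simple ν (y * g.right⁻¹) j
  set c := (S.simple j).1 with hc
  have h1 : S.sgnSum ν y (S.refl c * g.right) = S.sgnSum ν (y * g.right⁻¹ * S.refl c) 1 := by
    rw [← S.sgnSum_mul ν _ 1 (S.refl c * g.right)]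
    congr 1
    · have := S.refl_mul_self c
      calc y = y * g.right⁻¹ * 1 * g.right := by group
        _ = _ := by rw [← this]; group
  have h2 : S.sgnSum ν y g.right = S.sgnSum ν (y * g.right⁻¹) 1 := by
    rw [← S.sgnSum_mul ν _ 1 g.right]; simp
  have h3 : (S.s j * g).right⁻¹ • S.tra (S.s j * g) =
      g.right⁻¹ • ((S.simple j).2 • S.rootWt c + S.tra g) := by
    rw [tra_mul, SemidirectProduct.mul_right, s, right_sAff, tra_sAff, mul_inv_rev, mul_smul,
      refl_inv, smul_add, smul_smul (S.refl _) (S.refl _), refl_mul_self, one_smul, smul_neg,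
      smul_comm (S.refl _), ← rootWt_smul, refl_smul_self, rootWt_ng]
    simp [hc]
  unfold omg
  rw [h3, SemidirectProduct.mul_right, s, right_sAff, h1, h2]
  unfold lenDiff at h
  rw [smul_add, smul_add, map_add, smul_comm g.right⁻¹, smul_comm y, map_zsmul, smul_eq_mul,
    ← rootWt_smul, ← rootWt_smul]
  rw [mul_smul] at h
  linarith

theorem omg_one (ν : S.NuR) (y : S.W) : S.omg ν 1 y = 0 := by
  simp [omg, tra_one]

theorem omg_word (ν : S.NuR) (js : List S.AffIdx) (y : S.W) :
    S.omg ν (S.word js) y = 4 * S.psi ν (S.lamSeq js) y := by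
  induction js with
  | nil => simp [word, lamSeq, psi, omg_one]
  | cons j js ih =>
    have hw : S.word (j :: js) = S.s j * S.word js := by simp [word]
    rw [hw, omg_s_mul, ih, lamSeq, psi_cons, actAff_fst, dl_smul, SemidirectProduct.inv_right]
    ring

/-- By `two_mul_cop_of_isPi` the translation part and the finite part of π contribute opposite
amounts. -/
theorem omg_pi_mul (ν : S.NuR) {π : S.What} (hπ : S.IsPi π) (g : S.What) (y : S.W) :
    S.omg ν (π * g) y = S.omg ν g y := by
  have h0 : ∀ x : S.W, 4 * S.twoRho ν (x • π.right⁻¹ • S.tra π) =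
      S.sgnSum ν x π.right - S.sgnSum ν x 1 := by
    intro x
    rw [show (4 : ℤ) = 2 * 2 by norm_num, mul_assoc, two_mul_twoRho_smul, ← sumL_mul]
    unfold sgnSum
    rw [← sumL_sub]
    congr 1; funext i
    have := S.two_mul_cop_of_isPi hπ i
    rw [one_smul, ← mul_sub, ← this]; ring
  have h1 := h0 (y * g.right⁻¹)
  have h2 : S.sgnSum ν (y * g.right⁻¹) π.right = S.sgnSum ν y (π.right * g.right) := by
    rw [← S.sgnSum_mul ν _ _ g.right]; simp
  have h3 : S.sgnSum ν (y * g.right⁻¹) 1 = S.sgnSum ν y g.right := by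
    rw [← S.sgnSum_mul ν _ _ g.right]; simp
  rw [h2, h3, mul_smul] at h1
  unfold omg
  rw [tra_mul, SemidirectProduct.mul_right, mul_inv_rev, mul_smul, smul_add, smul_smul π.right⁻¹,
    inv_mul_cancel, one_smul, smul_add, smul_add, map_add]
  linarith

/-- For a pure translation the two sign sums in `omg` cancel and only the ρ-term is left. -/
theorem psi_eq_twoRho {b : S.Wt} {π : S.What} {js : List S.AffIdx}
    (hred : S.IsReducedDec (S.tr b) π js) (ν : S.NuR) (y : S.W) :
    S.psi ν (S.lamSeq js) y = S.twoRho ν (y • b) := by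
  have h1 := S.omg_pi_mul ν hred.1 (S.word js) y
  have he : π * S.word js = S.tr b := hred.2.1.symm
  rw [he, omg_word] at h1
  unfold omg at h1
  rw [right_tr, tra_tr, inv_one, one_smul] at h1
  omega

/-- The main estimate: the change of `psi` under a reflection. -/
theorem psi_sub_psi_refl (ν : S.NuR) (j : S.AffIdx) (js : List S.AffIdx) (y : S.W)
    {a : S.AffRoot} (ha : a = S.actAff (S.word js)⁻¹ (S.simple j))
    (hpos : S.base.IsPos (y • a.1)) :
    4 * (S.psi ν (S.lamSeq js) y - S.psi ν (S.lamSeq js) (y * S.refl a.1)) =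
      4 * (a.2 * S.twoRho ν (S.rootWt (y • a.1))) + S.lenDiff ν y a.1 - 4 * S.dl ν a.1 := by
  have h := S.lenDiff_simple ν (y * (S.word js).right⁻¹) j
  set g := S.word js with hg
  set c := (S.simple j).1 with hc
  have ha1 : a.1 = g.right⁻¹ • c := by rw [ha]; rfl
  -- The level of a has two sources: the level of α_j, supplied by `lenDiff_simple`, and the pairing
  -- with the translation part of g, which appears when the ρ-terms at y and y s_a are compared.
  have ha2 : a.2 = (S.simple j).2 + S.cop a.1 (g.right⁻¹ • S.tra g) := by
    rw [ha1, ha, actAff_snd, tra_inv, map_neg]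
    change _ - - (S.cop (g.right⁻¹ • c) _) = _
    ring
  rw [mul_sub, ← omg_word, ← omg_word]
  unfold omg
  have h1 : S.sgnSum ν y g.right = S.sgnSum ν (y * g.right⁻¹) 1 := by
    rw [← S.sgnSum_mul ν _ 1 g.right]; simp
  have h2 : S.sgnSum ν (y * S.refl a.1) g.right =
      S.sgnSum ν (y * g.right⁻¹ * S.refl c) 1 := by
    rw [← S.sgnSum_mul ν _ 1 g.right, ha1, refl_smul_index]
    congr 1; group
  have h3 : S.twoRho ν ((y * S.refl a.1) • g.right⁻¹ • S.tra g) =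
      S.twoRho ν (y • g.right⁻¹ • S.tra g) -
        S.cop a.1 (g.right⁻¹ • S.tra g) * S.twoRho ν (S.rootWt (y • a.1)) := by
    rw [mul_smul, refl_smul_wt, smul_sub, smul_comm y (S.cop a.1 _), map_sub, map_zsmul, rootWt_smul,
      smul_eq_mul]
  have h4 : (y * g.right⁻¹) • c = y • a.1 := by rw [mul_smul, ha1]
  rw [h1, h2, h3]
  rw [h4, S.sgn_pos hpos] at h
  have h5 : S.dl ν c = S.dl ν a.1 := by rw [ha1, dl_smul]
  rw [h5] at h
  unfold lenDiff at h ⊢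
  rw [ha2]
  linarith

theorem psi_sub_lower (ν : S.NuR) (j : S.AffIdx) (js : List S.AffIdx) (y : S.W)
    {a : S.AffRoot} (ha : a = S.actAff (S.word js)⁻¹ (S.simple j)) (hp : S.base.IsPos a.1)
    (hpos : S.base.IsPos (y • a.1)) :
    a.2 * S.twoRho ν (S.rootWt (y • a.1)) ≤
      S.psi ν (S.lamSeq js) y - S.psi ν (S.lamSeq js) (y * S.refl a.1) := by
  have h1 := S.psi_sub_psi_refl ν j js y ha hpos
  have h2 := S.lenDiff_lower ν hp hpos
  linarith

theorem psi_sub_upper (ν : S.NuR) (j : S.AffIdx) (js : List S.AffIdx) (y : S.W)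
    {a : S.AffRoot} (ha : a = S.actAff (S.word js)⁻¹ (S.simple j))
    (hpos : S.base.IsPos (y • a.1)) :
    S.psi ν (S.lamSeq js) y - S.psi ν (S.lamSeq js) (y * S.refl a.1) ≤
      (a.2 + 1) * S.twoRho ν (S.rootWt (y • a.1)) - 2 * S.dl ν a.1 := by
  have h1 := S.psi_sub_psi_refl ν j js y ha hpos
  have h2 := S.lenDiff_upper ν hpos
  linarith

end

/-! ### The field `K`: initial parts, limits at t = 0, orders in t -/

section

/-! ### Shortcut instances -/

scoped instance : CommRing S.Pol := inferInstance
scoped instance : CommSemiring S.Pol := inferInstance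
scoped instance : Ring S.Pol := inferInstance
scoped instance : Semiring S.Pol := inferInstance
scoped instance : Mul S.Pol := inferInstance
scoped instance : Field S.K := inferInstanceAs (Field (Frac S.Expo))
scoped instance : CommRing S.K := inferInstance
scoped instance : CommSemiring S.K := inferInstance
scoped instance : Ring S.K := inferInstance
scoped instance : Semiring S.K := inferInstance
scoped instance : Monoid S.K := inferInstance
scoped instance : AddMonoid S.K := inferInstance
scoped instance : AddCommMonoid S.K := inferInstance
scoped instance : AddCommGroup S.K := inferInstance
scoped instance : GroupWithZero S.K := inferInstance
scoped instance : Mul S.K := inferInstance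
scoped instance : Add S.K := inferInstance
scoped instance : Sub S.K := inferInstance
scoped instance : Neg S.K := inferInstance
scoped instance : Inv S.K := inferInstance
scoped instance : Div S.K := inferInstance
scoped instance : Zero S.K := inferInstance
scoped instance : One S.K := inferInstance
scoped instance : SMul S.What S.K := inferInstance
scoped instance : MulAction S.What S.K := inferInstance
scoped instance : DistribMulAction S.What S.K := inferInstance
scoped instance : MulDistribMulAction S.What S.K := inferInstance
scoped instance : Semiring S.Op := inferInstance
scoped instance : Semigroup S.Op := inferInstance
scoped instance : Mul S.Op := inferInstance
scoped instance : Add S.Op := inferInstance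
scoped instance : One S.Op := inferInstance
scoped instance : Zero S.Op := inferInstance
scoped instance : Semiring S.Spin := inferInstance
scoped instance : Mul S.Spin := inferInstance
scoped instance : AddCommMonoid S.Spin := inferInstance
scoped instance : SMul S.SpinGrp S.Spin := inferInstance
scoped instance : Semiring S.SpinOp := inferInstance
scoped instance : Mul S.SpinOp := inferInstance
scoped instance : Add S.SpinOp := inferInstance
scoped instance : AddCommMonoid S.SpinOp := inferInstance

/-! ### Homogeneous parts of Laurent polynomials -/

theorem exists_of_mem_support_mul {p q : S.Pol} {e : S.Expo} (he : e ∈ (p * q).coeff.support) :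
    ∃ a ∈ p.coeff.support, ∃ b ∈ q.coeff.support, a + b = e := by
  have h := AddMonoidAlgebra.support_coeff_mul_subset p q he
  rwa [Finset.mem_add] at h

section Part

variable {A : Type*} [AddCommGroup A]

/-- The part of weight `m` of a Laurent polynomial. -/
def part (φ : S.Expo →+ A) (m : A) (p : S.Pol) : S.Pol :=
  AddMonoidAlgebra.ofCoeff (p.coeff.filter fun e => φ e = m)

theorem part_coeff (φ : S.Expo →+ A) (m : A) (p : S.Pol) (e : S.Expo) :
    (S.part φ m p).coeff e = if φ e = m then p.coeff e else 0 := Finsupp.filter_apply ..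

theorem part_add (φ : S.Expo →+ A) (m : A) (p q : S.Pol) :
    S.part φ m (p + q) = S.part φ m p + S.part φ m q := by
  ext e
  simp only [part_coeff, AddMonoidAlgebra.coeff_add, Finsupp.add_apply]
  split_ifs <;> simp

theorem part_eq_zero {φ : S.Expo →+ A} {m : A} {p : S.Pol}
    (h : ∀ e ∈ p.coeff.support, φ e ≠ m) : S.part φ m p = 0 := by
  ext e
  rw [part_coeff]
  split_ifs with h1
  · by_contra h2
    exact h e (Finsupp.mem_support_iff.2 h2) h1
  · rfl

theorem part_eq_self {φ : S.Expo →+ A} {m : A} {p : S.Pol}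
    (h : ∀ e ∈ p.coeff.support, φ e = m) : S.part φ m p = p := by
  ext e
  rw [part_coeff]
  split_ifs with h1
  · rfl
  · by_contra h2
    exact h1 (h e (Finsupp.mem_support_iff.2 (Ne.symm h2)))

variable [PartialOrder A] [IsOrderedAddMonoid A]

/-- Weight m + n in the product arises only from weight m times weight n. With all t-exponents and
the componentwise partial order this is multiplicativity of the value at t = 0. With the exponent of
a single t_ν it gives additivity of the order. -/
theorem part_mul {φ : S.Expo →+ A} {m n : A} {p q : S.Pol}
    (hp : ∀ e ∈ p.coeff.support, m ≤ φ e) (hq : ∀ e ∈ q.coeff.support, n ≤ φ e) :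
    S.part φ (m + n) (p * q) = S.part φ m p * S.part φ n q := by
  have hpp : ∀ e ∈ (S.part φ m p).coeff.support, φ e = m := by
    intro e he
    rw [Finsupp.mem_support_iff, part_coeff] at he
    by_contra h; exact he (if_neg h)
  have hqq : ∀ e ∈ (S.part φ n q).coeff.support, φ e = n := by
    intro e he
    rw [Finsupp.mem_support_iff, part_coeff] at he
    by_contra h; exact he (if_neg h)
  have hp' : ∀ e ∈ (p - S.part φ m p).coeff.support, m < φ e := by
    intro e he
    rw [Finsupp.mem_support_iff, AddMonoidAlgebra.coeff_sub, Finsupp.sub_apply, part_coeff] at he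
    split_ifs at he with h
    · simp at he
    · exact lt_of_le_of_ne (hp e (Finsupp.mem_support_iff.2 (by simpa using he))) (Ne.symm h)
  have hq' : ∀ e ∈ (q - S.part φ n q).coeff.support, n < φ e := by
    intro e he
    rw [Finsupp.mem_support_iff, AddMonoidAlgebra.coeff_sub, Finsupp.sub_apply, part_coeff] at he
    split_ifs at he with h
    · simp at he
    · exact lt_of_le_of_ne (hq e (Finsupp.mem_support_iff.2 (by simpa using he))) (Ne.symm h)
  have e1 : p * q = S.part φ m p * S.part φ n q +
      (S.part φ m p * (q - S.part φ n q) + (p - S.part φ m p) * q) := by ring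
  rw [e1, part_add, part_add]
  rw [S.part_eq_self (p := S.part φ m p * S.part φ n q),
    S.part_eq_zero (p := _ * (q - _)), S.part_eq_zero (p := (p - _) * _), add_zero,
    add_zero]
  · intro e he
    obtain ⟨a, ha, b, hb, rfl⟩ := S.exists_of_mem_support_mul he
    rw [map_add]
    exact (add_lt_add_of_lt_of_le (hp' a ha) (hq b hb)).ne'
  · intro e he
    obtain ⟨a, ha, b, hb, rfl⟩ := S.exists_of_mem_support_mul he
    rw [map_add, hpp a ha]
    exact (add_lt_add_right (hq' b hb) m).ne'
  · intro e he
    obtain ⟨a, ha, b, hb, rfl⟩ := S.exists_of_mem_support_mul he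
    rw [map_add, hpp a ha, hqq b hb]

end Part

/-- The exponents of the `t_ν^{1/2}` in a monomial. -/
def tExp : S.Expo →+ (S.NuR → ℤ) := (AddMonoidHom.snd _ _).comp (AddMonoidHom.snd _ _)

theorem tExp_apply (e : S.Expo) : S.tExp e = e.2.2 := rfl

theorem tZero_eq (p : S.Pol) : S.tZero p = S.part S.tExp 0 p := by
  unfold tZero part
  congr 1
  ext e
  rw [Finsupp.filter_apply, Finsupp.filter_apply, tExp_apply]
  split_ifs <;> rfl

theorem tZero_coeff (p : S.Pol) (e : S.Expo) :
    (S.tZero p).coeff e = if e.2.2 = 0 then p.coeff e else 0 := by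
  rw [tZero_eq, part_coeff, tExp_apply]
  split_ifs <;> rfl

theorem tZero_add (p q : S.Pol) : S.tZero (p + q) = S.tZero p + S.tZero q := by
  simp only [tZero_eq, part_add]

theorem tZero_zero : S.tZero 0 = 0 := by
  rw [tZero_eq]; exact S.part_eq_zero (by simp)

theorem tZero_mul {p q : S.Pol} (hp : S.IsTPol p) (hq : S.IsTPol q) :
    S.tZero (p * q) = S.tZero p * S.tZero q := by
  rw [tZero_eq, tZero_eq, tZero_eq]
  nth_rw 1 [← add_zero (0 : S.NuR → ℤ)]
  exact S.part_mul (fun e he ν => hp e he ν) (fun e he ν => hq e he ν)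

theorem IsTPol.mul {S : Setup ι M N} {p q : S.Pol} (hp : S.IsTPol p) (hq : S.IsTPol q) :
    S.IsTPol (p * q) := by
  intro e he ν
  obtain ⟨a, ha, b, hb, rfl⟩ := S.exists_of_mem_support_mul he
  exact add_nonneg (hp a ha ν) (hq b hb ν)

theorem IsTPol.add {S : Setup ι M N} {p q : S.Pol} (hp : S.IsTPol p) (hq : S.IsTPol q) :
    S.IsTPol (p + q) := by
  intro e he ν
  rcases Finset.mem_union.1 (Finsupp.support_add he) with h | h
  · exact hp e h ν
  · exact hq e h ν

theorem IsTPol.neg {S : Setup ι M N} {p : S.Pol} (hp : S.IsTPol p) : S.IsTPol (-p) := by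
  intro e he ν
  refine hp e ?_ ν
  simpa using he

theorem isTPol_single {e : S.Expo} (he : ∀ ν, 0 ≤ e.2.2 ν) (c : ℚ) :
    S.IsTPol (AddMonoidAlgebra.single e c) := by
  intro e' he' ν
  have := Finsupp.support_single_subset he'
  rw [Finset.mem_singleton] at this
  rw [this]; exact he ν

theorem isTPol_one : S.IsTPol 1 := S.isTPol_single (e := 0) (fun _ => le_rfl) 1

theorem tZero_one : S.tZero 1 = 1 := by
  rw [tZero_eq]
  refine S.part_eq_self fun e he => ?_
  have := Finsupp.support_single_subset (show e ∈ (Finsupp.single (0 : S.Expo) (1 : ℚ)).support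
    from he)
  rw [Finset.mem_singleton] at this
  rw [this]; rfl

theorem algebraMap_ne_zero {p : S.Pol} (hp : p ≠ 0) : algebraMap S.Pol S.K p ≠ 0 := by
  rwa [Ne, FaithfulSMul.algebraMap_eq_zero_iff]

theorem ne_zero_of_tZero {p : S.Pol} (hp : S.tZero p ≠ 0) : p ≠ 0 := by
  rintro rfl
  exact hp S.tZero_zero

/-! ### Limits -/

/-- Cross-multiplication gives an identity of polynomials in the t_ν^{1/2}, on which evaluation at t
= 0 is multiplicative. -/
theorem HasTLimit.unique {S : Setup ι M N} {c a b : S.K} (ha : S.HasTLimit c a)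
    (hb : S.HasTLimit c b) : a = b := by
  obtain ⟨p, d, hp, hd, hd0, rfl, rfl⟩ := ha
  obtain ⟨p', d', hp', hd', hd0', he, rfl⟩ := hb
  rw [div_eq_div_iff (S.algebraMap_ne_zero (S.ne_zero_of_tZero hd0))
    (S.algebraMap_ne_zero (S.ne_zero_of_tZero hd0')), ← map_mul, ← map_mul] at he
  have he' := IsFractionRing.injective S.Pol S.K he
  rw [div_eq_div_iff (S.algebraMap_ne_zero hd0) (S.algebraMap_ne_zero hd0'), ← map_mul,
    ← map_mul, ← S.tZero_mul hp hd', ← S.tZero_mul hp' hd, he']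

theorem HasTLimit.mul {S : Setup ι M N} {c c' a a' : S.K} (h : S.HasTLimit c a)
    (h' : S.HasTLimit c' a') : S.HasTLimit (c * c') (a * a') := by
  obtain ⟨p, d, hp, hd, hd0, rfl, rfl⟩ := h
  obtain ⟨p', d', hp', hd', hd0', rfl, rfl⟩ := h'
  refine ⟨p * p', d * d', hp.mul hp', hd.mul hd', ?_, ?_, ?_⟩
  · rw [S.tZero_mul hd hd']; exact mul_ne_zero hd0 hd0'
  · rw [map_mul, map_mul, div_mul_div_comm]
  · rw [S.tZero_mul hd hd', S.tZero_mul hp hp', map_mul, map_mul, div_mul_div_comm]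

theorem HasTLimit.add {S : Setup ι M N} {c c' a a' : S.K} (h : S.HasTLimit c a)
    (h' : S.HasTLimit c' a') : S.HasTLimit (c + c') (a + a') := by
  obtain ⟨p, d, hp, hd, hd0, rfl, rfl⟩ := h
  obtain ⟨p', d', hp', hd', hd0', rfl, rfl⟩ := h'
  refine ⟨p * d' + d * p', d * d', (hp.mul hd').add (hd.mul hp'), hd.mul hd', ?_, ?_, ?_⟩
  · rw [S.tZero_mul hd hd']; exact mul_ne_zero hd0 hd0'
  · rw [map_mul, map_add, map_mul, map_mul, div_add_div _ _
      (S.algebraMap_ne_zero (S.ne_zero_of_tZero hd0))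
      (S.algebraMap_ne_zero (S.ne_zero_of_tZero hd0'))]
  · rw [S.tZero_mul hd hd', tZero_add, S.tZero_mul hp hd', S.tZero_mul hd hp', map_mul, map_add,
      map_mul, map_mul, div_add_div _ _ (S.algebraMap_ne_zero hd0) (S.algebraMap_ne_zero hd0')]

theorem hasTLimit_zero : S.HasTLimit 0 0 := by
  refine ⟨0, 1, by intro e he; simp at he, S.isTPol_one, by rw [tZero_one]; exact one_ne_zero, ?_, ?_⟩
  · simp
  · rw [tZero_zero]; simp

theorem hasTLimit_one : S.HasTLimit 1 1 := by
  refine ⟨1, 1, S.isTPol_one, S.isTPol_one, by rw [tZero_one]; exact one_ne_zero, ?_, ?_⟩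
  · simp
  · rw [tZero_one]; simp

theorem hasTLimit_sum {α : Type*} (s : Finset α) {F G : α → S.K}
    (h : ∀ i ∈ s, S.HasTLimit (F i) (G i)) : S.HasTLimit (∑ i ∈ s, F i) (∑ i ∈ s, G i) := by
  induction s using Finset.induction_on with
  | empty => simpa using S.hasTLimit_zero
  | insert a s ha ih =>
    rw [Finset.sum_insert ha, Finset.sum_insert ha]
    exact (h a (Finset.mem_insert_self a s)).add (ih fun i hi => h i (Finset.mem_insert_of_mem hi))

section Domain

variable {S}

theorem domCongr_coeff (e : S.Expo ≃+ S.Expo) (p : S.Pol) (x : S.Expo) :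
    (AddMonoidAlgebra.domCongr ℚ ℚ e p).coeff x = p.coeff (e.symm x) := by
  simp

theorem isTPol_domCongr {e : S.Expo ≃+ S.Expo} (he : ∀ x, (e x).2.2 = x.2.2) {p : S.Pol}
    (hp : S.IsTPol p) : S.IsTPol (AddMonoidAlgebra.domCongr ℚ ℚ e p) := by
  intro x hx ν
  rw [Finsupp.mem_support_iff, domCongr_coeff, ← Finsupp.mem_support_iff] at hx
  have := hp _ hx ν
  rwa [← he, AddEquiv.apply_symm_apply] at this

theorem tZero_domCongr {e : S.Expo ≃+ S.Expo} (he : ∀ x, (e x).2.2 = x.2.2) (p : S.Pol) :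
    S.tZero (AddMonoidAlgebra.domCongr ℚ ℚ e p) =
      AddMonoidAlgebra.domCongr ℚ ℚ e (S.tZero p) := by
  ext x
  rw [domCongr_coeff, tZero_coeff, tZero_coeff, domCongr_coeff]
  have := he (e.symm x)
  rw [AddEquiv.apply_symm_apply] at this
  rw [this]

theorem HasTLimit.smul {c a : S.K} (g : S.What) (h : S.HasTLimit c a) :
    S.HasTLimit (g • c) (g • a) := by
  obtain ⟨p, d, hp, hd, hd0, rfl, rfl⟩ := h
  have hg : ∀ x, (S.actEquiv g x).2.2 = x.2.2 := fun _ => rfl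
  refine ⟨_, _, isTPol_domCongr hg hp, isTPol_domCongr hg hd, ?_, ?_, ?_⟩
  · rw [tZero_domCongr hg]
    exact fun h => hd0 ((AddMonoidAlgebra.domCongr ℚ ℚ (S.actEquiv g)).map_eq_zero_iff.1 h)
  · change fracMap _ _ = _
    rw [map_div₀, fracMap_algebraMap, fracMap_algebraMap]
  · change fracMap _ _ = _
    rw [map_div₀, fracMap_algebraMap, fracMap_algebraMap, tZero_domCongr hg, tZero_domCongr hg]

end Domain

/-! ### Orders -/

theorem polOrd_eq {ν : S.NuR} {p : S.Pol} {n : ℤ} (h1 : ∀ e ∈ p.coeff.support, n ≤ e.2.2 ν)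
    (h2 : ∃ e ∈ p.coeff.support, e.2.2 ν = n) : S.polOrd ν p = n := by
  obtain ⟨e, he, hn⟩ := h2
  unfold polOrd
  rw [dif_pos ⟨e, he⟩]
  refine le_antisymm ?_ (Finset.le_inf' _ _ h1)
  rw [← hn]
  exact Finset.inf'_le (fun e : S.Expo => e.2.2 ν) he

theorem polOrd_spec (ν : S.NuR) {p : S.Pol} (hp : p ≠ 0) :
    (∀ e ∈ p.coeff.support, S.polOrd ν p ≤ e.2.2 ν) ∧
      ∃ e ∈ p.coeff.support, e.2.2 ν = S.polOrd ν p := by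
  have hne : p.coeff.support.Nonempty := by
    rw [Finsupp.support_nonempty_iff]
    exact fun h => hp (AddMonoidAlgebra.coeff_eq_zero.1 h)
  obtain ⟨e, he, hm⟩ := Finset.exists_min_image _ (fun e : S.Expo => e.2.2 ν) hne
  have := S.polOrd_eq hm ⟨e, he, rfl⟩
  rw [this]
  exact ⟨hm, e, he, rfl⟩

/-- The exponent of `t_ν^{1/2}` in a monomial. -/
def tExpAt (ν : S.NuR) : S.Expo →+ ℤ := (Pi.evalAddMonoidHom (fun _ : S.NuR => ℤ) ν).comp S.tExp

/-- The initial parts are nonzero and `Pol` is a domain. -/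
theorem polOrd_mul (ν : S.NuR) {p q : S.Pol} (hp : p ≠ 0) (hq : q ≠ 0) :
    S.polOrd ν (p * q) = S.polOrd ν p + S.polOrd ν q := by
  obtain ⟨h1, e, he, he'⟩ := S.polOrd_spec ν hp
  obtain ⟨h2, f, hf, hf'⟩ := S.polOrd_spec ν hq
  have h3 := S.part_mul (φ := S.tExpAt ν) h1 h2
  have hp0 : S.part (S.tExpAt ν) (S.polOrd ν p) p ≠ 0 := fun h => by
    have := congrArg (fun x => x.coeff e) h
    simp only [part_coeff] at this
    rw [if_pos (by exact he')] at this
    exact Finsupp.mem_support_iff.1 he this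
  have hq0 : S.part (S.tExpAt ν) (S.polOrd ν q) q ≠ 0 := fun h => by
    have := congrArg (fun x => x.coeff f) h
    simp only [part_coeff] at this
    rw [if_pos (by exact hf')] at this
    exact Finsupp.mem_support_iff.1 hf this
  refine S.polOrd_eq (fun x hx => ?_) ?_
  · obtain ⟨a, ha, b, hb, rfl⟩ := S.exists_of_mem_support_mul hx
    exact add_le_add (h1 a ha) (h2 b hb)
  · by_contra hcon
    push Not at hcon
    exact mul_ne_zero hp0 hq0 (h3 ▸ S.part_eq_zero fun x hx => hcon x hx)

/-- `tOrd` is defined by a chosen fraction. Additivity of `polOrd` on the cross-multiplied identity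
shows that any other fraction gives the same value. -/
theorem tOrd_div (ν : S.NuR) {p d : S.Pol} (hp : p ≠ 0) (hd : d ≠ 0) :
    S.tOrd ν (algebraMap S.Pol S.K p / algebraMap S.Pol S.K d) =
      ((((S.polOrd ν p - S.polOrd ν d : ℤ) : ℚ) / 2 : ℚ) : WithTop ℚ) := by
  set c := algebraMap S.Pol S.K p / algebraMap S.Pol S.K d with hc
  have hc0 : c ≠ 0 := div_ne_zero (S.algebraMap_ne_zero hp) (S.algebraMap_ne_zero hd)
  unfold tOrd
  rw [if_neg hc0]
  have hspec := IsLocalization.sec_spec (nonZeroDivisors S.Pol) c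
  set p' := (IsLocalization.sec (nonZeroDivisors S.Pol) c).1
  set d' := ((IsLocalization.sec (nonZeroDivisors S.Pol) c).2 : S.Pol) with hd'
  have hd'0 : d' ≠ 0 := nonZeroDivisors.ne_zero (IsLocalization.sec _ c).2.2
  have hp'0 : p' ≠ 0 := by
    intro h
    rw [h, map_zero] at hspec
    exact mul_ne_zero hc0 (S.algebraMap_ne_zero hd'0) hspec
  have h1 : p * d' = p' * d := by
    refine IsFractionRing.injective S.Pol S.K ?_
    rw [map_mul, map_mul, ← hspec, hc]
    field_simp [S.algebraMap_ne_zero hd]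
  have h2 := congrArg (S.polOrd ν) h1
  rw [S.polOrd_mul ν hp hd'0, S.polOrd_mul ν hp'0 hd] at h2
  have h3 : S.polOrd ν p' - S.polOrd ν d' = S.polOrd ν p - S.polOrd ν d := by omega
  rw [h3]

theorem tOrd_zero (ν : S.NuR) : S.tOrd ν 0 = ⊤ := if_pos rfl

/-! ### Monomials -/

theorem mono_add (e f : S.Expo) : S.mono (e + f) = S.mono e * S.mono f := by
  unfold mono
  rw [← map_mul, AddMonoidAlgebra.single_mul_single, one_mul]

theorem mono_zero : S.mono 0 = 1 := map_one (algebraMap S.Pol S.K)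

theorem mono_ne_zero (e : S.Expo) : S.mono e ≠ 0 :=
  S.algebraMap_ne_zero (by
    rw [Ne, ← AddMonoidAlgebra.coeff_eq_zero]; simp)

theorem mono_neg (e : S.Expo) : S.mono (-e) = (S.mono e)⁻¹ := by
  refine eq_inv_of_mul_eq_one_left ?_
  rw [← mono_add, neg_add_cancel, mono_zero]

/-- The monomial `∏_ν t_ν^{e_ν/2}`. -/
def tMono (e : S.NuR → ℤ) : S.K := S.mono (0, 0, e)

theorem tMono_add (e f : S.NuR → ℤ) : S.tMono (e + f) = S.tMono e * S.tMono f := by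
  unfold tMono
  rw [← mono_add]; simp

theorem tMono_zero : S.tMono 0 = 1 := S.mono_zero

theorem smul_tMono (g : S.What) (e : S.NuR → ℤ) : g • S.tMono e = S.tMono e := by
  unfold tMono
  rw [smul_mono]
  congr 1
  refine Prod.ext ?_ (Prod.ext ?_ rfl)
  · simp [actFun]
  · refine Subtype.ext ?_
    simp [actFun, pair]

theorem qRho_eq (b : S.Wt) : S.qRho b = S.tMono fun ν => S.twoRho ν b := rfl

theorem qRho_add (a b : S.Wt) : S.qRho (a + b) = S.qRho a * S.qRho b := by
  rw [qRho_eq, qRho_eq, qRho_eq, ← tMono_add]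
  congr 1; funext ν; simp

theorem qRho_zero : S.qRho 0 = 1 := by
  rw [qRho_eq, ← tMono_zero]; congr 1; funext ν; simp

theorem rhoShift_mono (e : S.Expo) :
    fracMap S.rhoShift (S.mono e) = S.mono (S.rhoShift e) := by
  unfold mono
  rw [fracMap_algebraMap, AddMonoidAlgebra.domCongr_single]

theorem rhoShift_tMono (e : S.NuR → ℤ) :
    fracMap S.rhoShift (S.tMono e) = S.tMono e := by
  unfold tMono
  rw [rhoShift_mono]
  congr 1
  refine Prod.ext rfl (Prod.ext rfl ?_)
  funext ν
  simp [rhoShift]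

/-! ### Regular elements -/

/-- `c = ∏_ν t_ν^{e_ν/2} p/d`, where `p`, `d` are polynomial in the `t_ν^{1/2}` and
`d|_{t=0} ≠ 0`. -/
def Reg (e : S.NuR → ℤ) (c : S.K) : Prop :=
  ∃ p d : S.Pol, S.IsTPol p ∧ S.IsTPol d ∧ S.tZero d ≠ 0 ∧
    c = S.tMono e * (algebraMap S.Pol S.K p / algebraMap S.Pol S.K d)

variable {S}

theorem Reg.mul {e e' : S.NuR → ℤ} {c c' : S.K} (h : S.Reg e c) (h' : S.Reg e' c') :
    S.Reg (e + e') (c * c') := by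
  obtain ⟨p, d, hp, hd, hd0, rfl⟩ := h
  obtain ⟨p', d', hp', hd', hd0', rfl⟩ := h'
  refine ⟨p * p', d * d', hp.mul hp', hd.mul hd', ?_, ?_⟩
  · rw [S.tZero_mul hd hd']; exact mul_ne_zero hd0 hd0'
  · rw [tMono_add, map_mul, map_mul, ← div_mul_div_comm]; ring

theorem reg_tMono (e : S.NuR → ℤ) : S.Reg e (S.tMono e) :=
  ⟨1, 1, S.isTPol_one, S.isTPol_one, by rw [tZero_one]; exact one_ne_zero, by simp⟩

theorem Reg.neg {e : S.NuR → ℤ} {c : S.K} (h : S.Reg e c) : S.Reg e (-c) := by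
  obtain ⟨p, d, hp, hd, hd0, rfl⟩ := h
  refine ⟨-p, d, hp.neg, hd, hd0, ?_⟩
  rw [map_neg]; ring

theorem reg_of_div {p d : S.Pol} (hp : S.IsTPol p) (hd : S.IsTPol d) (hd0 : S.tZero d ≠ 0) :
    S.Reg 0 (algebraMap S.Pol S.K p / algebraMap S.Pol S.K d) :=
  ⟨p, d, hp, hd, hd0, by rw [tMono_zero, one_mul]⟩

theorem Reg.smul {e : S.NuR → ℤ} {c : S.K} (g : S.What) (h : S.Reg e c) :
    S.Reg e (g • c) := by
  obtain ⟨p, d, hp, hd, hd0, rfl⟩ := h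
  have hg : ∀ x, (S.actEquiv g x).2.2 = x.2.2 := fun _ => rfl
  refine ⟨_, _, isTPol_domCongr hg hp, isTPol_domCongr hg hd, ?_, ?_⟩
  · rw [tZero_domCongr hg]
    exact fun h => hd0 ((AddMonoidAlgebra.domCongr ℚ ℚ (S.actEquiv g)).map_eq_zero_iff.1 h)
  · rw [smul_mul', smul_tMono]
    congr 1
    change fracMap _ _ = _
    rw [map_div₀, fracMap_algebraMap, fracMap_algebraMap]

theorem Reg.mono {e e' : S.NuR → ℤ} {c : S.K} (h : S.Reg e c) (hle : e' ≤ e) : S.Reg e' c := by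
  obtain ⟨p, d, hp, hd, hd0, rfl⟩ := h
  refine ⟨AddMonoidAlgebra.single (0, 0, e - e') 1 * p, d,
    (S.isTPol_single (fun ν => sub_nonneg.2 (hle ν)) 1).mul hp, hd, hd0, ?_⟩
  have : S.tMono e = S.tMono e' * S.tMono (e - e') := by rw [← tMono_add]; simp
  rw [this, map_mul, tMono, tMono, Setup.mono, Setup.mono]; ring

theorem Reg.hasTLimit {c : S.K} (h : S.Reg 0 c) : ∃ c₀, S.HasTLimit c c₀ := by
  obtain ⟨p, d, hp, hd, hd0, rfl⟩ := h
  exact ⟨_, p, d, hp, hd, hd0, by rw [tMono_zero, one_mul], rfl⟩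

theorem Reg.le_tOrd {e : S.NuR → ℤ} {c : S.K} (h : S.Reg e c) (ν : S.NuR) :
    ((((e ν : ℤ) : ℚ) / 2 : ℚ) : WithTop ℚ) ≤ S.tOrd ν c := by
  obtain ⟨p, d, hp, hd, hd0, rfl⟩ := h
  by_cases hp0 : p = 0
  · rw [hp0, map_zero, zero_div, mul_zero, tOrd_zero]; exact le_top
  have hd1 := S.ne_zero_of_tZero hd0
  have hs : AddMonoidAlgebra.single ((0, 0, e) : S.Expo) (1 : ℚ) ≠ 0 := by
    rw [Ne, ← AddMonoidAlgebra.coeff_eq_zero]; simp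
  rw [tMono, Setup.mono, ← mul_div_assoc, ← map_mul, S.tOrd_div ν (mul_ne_zero hs hp0) hd1,
    S.polOrd_mul ν hs hp0]
  have h1 : S.polOrd ν (AddMonoidAlgebra.single ((0, 0, e) : S.Expo) (1 : ℚ)) = e ν := by
    refine S.polOrd_eq ?_ ⟨(0, 0, e), by simp, rfl⟩
    intro f hf
    have := Finsupp.support_single_subset hf
    rw [Finset.mem_singleton] at this
    rw [this]
  have h2 : 0 ≤ S.polOrd ν p := by
    obtain ⟨-, f, hf, hf'⟩ := S.polOrd_spec ν hp0
    rw [← hf']; exact hp f hf ν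
  -- The denominator contains a term free of t, as it does not vanish at t = 0.
  have h3 : S.polOrd ν d ≤ 0 := by
    obtain ⟨f, hf⟩ : ∃ f, (S.tZero d).coeff f ≠ 0 := by
      by_contra hcon
      push Not at hcon
      refine hd0 ?_
      ext f; exact hcon f
    rw [tZero_coeff] at hf
    by_cases hf0 : f.2.2 = 0
    · rw [if_pos hf0] at hf
      have := (S.polOrd_spec ν hd1).1 f (Finsupp.mem_support_iff.2 hf)
      rw [hf0] at this
      exact this
    · exact absurd (if_neg hf0) hf
  rw [h1]
  refine WithTop.coe_le_coe.2 ?_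
  have : ((e ν : ℤ) : ℚ) ≤ ((e ν + S.polOrd ν p - S.polOrd ν d : ℤ) : ℚ) := by
    exact_mod_cast (by omega)
  linarith

theorem tOrd_tMono (ν : S.NuR) (e : S.NuR → ℤ) :
    S.tOrd ν (S.tMono e) = ((((e ν : ℤ) : ℚ) / 2 : ℚ) : WithTop ℚ) := by
  have hs : AddMonoidAlgebra.single ((0, 0, e) : S.Expo) (1 : ℚ) ≠ 0 := by
    rw [Ne, ← AddMonoidAlgebra.coeff_eq_zero]; simp
  have key : ∀ e : S.NuR → ℤ,
      S.polOrd ν (AddMonoidAlgebra.single ((0, 0, e) : S.Expo) (1 : ℚ)) = e ν := by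
    intro e
    refine S.polOrd_eq ?_ ⟨(0, 0, e), by simp, rfl⟩
    intro f hf
    have := Finsupp.support_single_subset hf
    rw [Finset.mem_singleton] at this
    rw [this]
  have h1 := S.tOrd_div ν hs (one_ne_zero (α := S.Pol))
  rw [map_one, div_one, key] at h1
  have h2 : S.polOrd ν 1 = 0 := key 0
  rw [h2, sub_zero] at h1
  exact h1

end

section

/-! ### The spinor homomorphism -/

theorem rhoShift_add (c d : S.K) :
    fracMap S.rhoShift (c + d) = fracMap S.rhoShift c + fracMap S.rhoShift d :=
  RingEquiv.map_add _ _ _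

theorem rhoShift_mul (c d : S.K) :
    fracMap S.rhoShift (c * d) = fracMap S.rhoShift c * fracMap S.rhoShift d :=
  RingEquiv.map_mul _ _ _

theorem rhoShift_zero : fracMap S.rhoShift (0 : S.K) = 0 := RingEquiv.map_zero _

theorem rhoShift_one : fracMap S.rhoShift (1 : S.K) = 1 := RingEquiv.map_one _

theorem coeff_add_apply {G : Type*} {V : Type*} (A B : SkewMonoidAlgebra (V → S.K) G) (x : G)
    (u : V) : (A + B).coeff x u = A.coeff x u + B.coeff x u := by
  rw [SkewMonoidAlgebra.coeff_add]; rfl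

theorem coeff_sum_apply {α : Type*} (s : Finset α) (F : α → S.SpinOp) (x : S.SpinGrp) (u : S.W) :
    (∑ i ∈ s, F i).coeff x u = ∑ i ∈ s, (F i).coeff x u := by
  induction s using Finset.induction_on with
  | empty => rw [Finset.sum_empty, Finset.sum_empty]; rfl
  | insert a s ha ih => rw [Finset.sum_insert ha, Finset.sum_insert ha, coeff_add_apply, ih]

/-- The element of the extended affine Weyl group that contributes to the `u`-component of the
coefficient at `x` under the spinor homomorphism. -/
def ofSpin (u : S.W) (x : S.SpinGrp) : S.What :=
  ⟨Multiplicative.ofAdd (u • -(Multiplicative.toAdd x.1)), x.2⟩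

/-- The inverse of `ofSpin`. -/
def toSpin (u : S.W) (g : S.What) : S.SpinGrp :=
  (Multiplicative.ofAdd (u⁻¹ • -(S.tra g)), g.right)

theorem toSpin_eq_iff (u : S.W) (g : S.What) (x : S.SpinGrp) :
    S.toSpin u g = x ↔ g = S.ofSpin u x := by
  constructor
  · rintro rfl
    refine S.What_ext ?_ rfl
    change S.tra g = u • -(u⁻¹ • -(S.tra g))
    simp
  · rintro rfl
    refine Prod.ext ?_ rfl
    change Multiplicative.ofAdd (u⁻¹ • -(u • -(Multiplicative.toAdd x.1))) = x.1
    simp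

theorem phi_term_zero (x : S.What) : (∑ᶠ u : S.W,
    SkewMonoidAlgebra.single
      (Multiplicative.ofAdd (u⁻¹ • (-(Multiplicative.toAdd x.left))), x.right)
      (Pi.single u (S.fin u⁻¹ • (0 : S.K)) : S.Spin) : S.SpinOp) = 0 := by
  simp

theorem phi_single (g : S.What) (c : S.K) : S.phi (SkewMonoidAlgebra.single g c) =
    ∑ u : S.W, SkewMonoidAlgebra.single (S.toSpin u g) (Pi.single u (S.fin u⁻¹ • c) : S.Spin) := by
  unfold phi
  rw [SkewMonoidAlgebra.sum_single_index (S.phi_term_zero g), finsum_eq_sum_of_fintype]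
  rfl

theorem phi_add (L L' : S.Op) : S.phi (L + L') = S.phi L + S.phi L' := by
  unfold phi
  refine SkewMonoidAlgebra.sum_add_index' S.phi_term_zero fun x c c' => ?_
  simp only [finsum_eq_sum_of_fintype, ← Finset.sum_add_distrib, smul_add, Pi.single_add,
    SkewMonoidAlgebra.single_add]

theorem phi_zero : S.phi 0 = 0 := SkewMonoidAlgebra.sum_zero_index

theorem conjRho_add (L L' : S.SpinOp) : S.conjRho (L + L') = S.conjRho L + S.conjRho L' := by
  unfold conjRho
  refine SkewMonoidAlgebra.sum_add_index' (fun x => ?_) fun x c c' => ?_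
  · rw [SkewMonoidAlgebra.single_eq_zero]
    funext u
    change S.qRho _ * fracMap S.rhoShift 0 = 0
    rw [rhoShift_zero, mul_zero]
  · rw [← SkewMonoidAlgebra.single_add]
    congr 1; funext u
    rw [Pi.add_apply, Pi.add_apply, rhoShift_add, mul_add]

theorem conjRho_zero : S.conjRho 0 = 0 := SkewMonoidAlgebra.sum_zero_index

theorem conjRho_single (x : S.SpinGrp) (F : S.Spin) :
    S.conjRho (SkewMonoidAlgebra.single x F) = SkewMonoidAlgebra.single x
      (fun u => S.qRho (-(Multiplicative.toAdd x.1)) * fracMap S.rhoShift (F u)) := by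
  unfold conjRho
  refine SkewMonoidAlgebra.sum_single_index ?_
  rw [SkewMonoidAlgebra.single_eq_zero]
  funext u
  change S.qRho _ * fracMap S.rhoShift 0 = 0
  rw [rhoShift_zero, mul_zero]

theorem ae_add (L L' : S.Op) : S.ae (L + L') = S.ae L + S.ae L' := by
  unfold ae; rw [phi_add, conjRho_add]

theorem ae_zero : S.ae 0 = 0 := by
  unfold ae; rw [phi_zero, conjRho_zero]

theorem ae_single (g : S.What) (c : S.K) : S.ae (SkewMonoidAlgebra.single g c) =
    ∑ u : S.W, SkewMonoidAlgebra.single (S.toSpin u g)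
      (Pi.single u (S.qRho (u⁻¹ • S.tra g) * fracMap S.rhoShift (S.fin u⁻¹ • c)) : S.Spin) := by
  have hsum : ∀ (s : Finset S.W) (F : S.W → S.SpinOp),
      S.conjRho (∑ u ∈ s, F u) = ∑ u ∈ s, S.conjRho (F u) := by
    intro s F
    induction s using Finset.induction_on with
    | empty => simpa using S.conjRho_zero
    | insert a s ha ih => rw [Finset.sum_insert ha, Finset.sum_insert ha, conjRho_add, ih]
  unfold ae
  rw [phi_single, hsum]
  refine Finset.sum_congr rfl fun u _ => ?_
  rw [conjRho_single]
  congr 1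
  funext v
  change S.qRho (-(u⁻¹ • -(S.tra g))) * _ = _
  rw [smul_neg, neg_neg]
  by_cases h : v = u
  · subst h; rw [Pi.single_eq_same, Pi.single_eq_same]
  · rw [Pi.single_eq_of_ne h, Pi.single_eq_of_ne h, rhoShift_zero, mul_zero]

/-- For fixed u the map `toSpin u` is a bijection, so each component of æ^δ(L) comes from exactly
one coefficient of L and no cancellation can occur. -/
theorem coeff_ae (L : S.Op) (x : S.SpinGrp) (u : S.W) : (S.ae L).coeff x u =
    S.qRho (-(Multiplicative.toAdd x.1)) *
      fracMap S.rhoShift (S.fin u⁻¹ • L.coeff (S.ofSpin u x)) := by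
  induction L using SkewMonoidAlgebra.induction_on with
  | zero =>
    rw [ae_zero, SkewMonoidAlgebra.coeff_zero, SkewMonoidAlgebra.coeff_zero, Finsupp.zero_apply,
      Finsupp.zero_apply, smul_zero, rhoShift_zero, mul_zero]
    rfl
  | single g c =>
    rw [ae_single]
    rw [coeff_sum_apply, Finset.sum_eq_single u]
    · rw [SkewMonoidAlgebra.coeff_single_apply, SkewMonoidAlgebra.coeff_single_apply]
      by_cases h : S.toSpin u g = x
      · rw [if_pos h, if_pos ((S.toSpin_eq_iff u g x).1 h), Pi.single_eq_same]
        rw [← h]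
        congr 2
        change _ = -(u⁻¹ • -(S.tra g))
        rw [smul_neg, neg_neg]
      · rw [if_neg h, if_neg (fun h' => h ((S.toSpin_eq_iff u g x).2 h')), smul_zero,
          rhoShift_zero, mul_zero]
        rfl
    · intro v _ hv
      rw [SkewMonoidAlgebra.coeff_single_apply]
      split_ifs
      · exact Pi.single_eq_of_ne hv.symm _
      · rfl
    · exact fun h => absurd (Finset.mem_univ u) h
  | add L L' h h' =>
    rw [ae_add, coeff_add_apply, h, h', SkewMonoidAlgebra.coeff_add, Finsupp.add_apply, smul_add,
      rhoShift_add, mul_add]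

theorem smul_qRho (g : S.What) (b : S.Wt) : g • S.qRho b = S.qRho b := S.smul_tMono g _

/-- Translations change only powers of q, the ρ-shift only powers of t, each by an amount depending
on the weight of X alone. Elements of W do not commute with the shift in general. -/
theorem rhoShift_tr_smul (b : S.Wt) (c : S.K) :
    fracMap S.rhoShift (S.tr b • c) = S.tr b • fracMap S.rhoShift c := by
  change fracMap S.rhoShift (fracMap (S.actEquiv (S.tr b)) c) =
    fracMap (S.actEquiv (S.tr b)) (fracMap S.rhoShift c)
  rw [← fracMap_trans, ← fracMap_trans]
  congr 2
  refine AddEquiv.ext fun e => ?_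
  refine Prod.ext rfl (Prod.ext rfl ?_)
  funext ν
  change e.2.2 ν - S.twoRho ν ((1 : S.W) • e.1) = e.2.2 ν - S.twoRho ν e.1
  rw [one_smul]

theorem spin_smul_apply (x : S.SpinGrp) (F : S.Spin) (u : S.W) :
    (x • F) u = S.tr (-(Multiplicative.toAdd x.1)) • F (x.2⁻¹ * u) := rfl

theorem fin_mul_eq (u : S.W) (g : S.What) :
    S.fin u⁻¹ * g = S.tr (u⁻¹ • S.tra g) * S.fin (u⁻¹ * g.right) := by
  refine S.What_ext ?_ ?_
  · rw [tra_mul, tra_mul, tra_fin, tra_fin, tra_tr, right_fin, smul_zero, zero_add, add_zero]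
  · rw [SemidirectProduct.mul_right, SemidirectProduct.mul_right, right_fin, right_fin, right_tr,
      one_mul]

/-- Write u⁻¹g as a translation times u⁻¹w, where w is the finite part of g. The translation is the
Γ on the spinor side, and (u⁻¹w)⁻¹ = w⁻¹u is the component that δ(w) brings to place u. -/
theorem ae_single_mul (g : S.What) (c : S.K) (L : S.Op) :
    S.ae (SkewMonoidAlgebra.single g c * L) = S.ae (SkewMonoidAlgebra.single g c) * S.ae L := by
  refine SkewMonoidAlgebra.ext fun x => funext fun u => ?_
  rw [coeff_ae, ae_single, Finset.sum_mul, SkewMonoidAlgebra.coeff_single_mul]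
  rw [coeff_sum_apply, Finset.sum_eq_single u]
  · rw [SkewMonoidAlgebra.coeff_single_mul, Pi.mul_apply, Pi.single_eq_same, spin_smul_apply,
      coeff_ae, smul_mul', rhoShift_mul, smul_mul']
    have e1 : -(Multiplicative.toAdd (S.toSpin u g).1) = u⁻¹ • S.tra g := by
      change -(u⁻¹ • -(S.tra g)) = _
      simp
    have e2 : S.ofSpin ((S.toSpin u g).2⁻¹ * u) ((S.toSpin u g)⁻¹ * x) =
        g⁻¹ * S.ofSpin u x := by
      refine S.What_ext ?_ rfl
      rw [tra_mul, tra_inv]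
      change (g.right⁻¹ * u) • -(-(u⁻¹ • -(S.tra g)) + Multiplicative.toAdd x.1) =
        -(g.right⁻¹ • S.tra g) + g.right⁻¹ • u • -(Multiplicative.toAdd x.1)
      rw [mul_smul]
      simp [smul_add, add_comm]
    have e3 : -(Multiplicative.toAdd ((S.toSpin u g)⁻¹ * x).1) =
        -(Multiplicative.toAdd x.1) - u⁻¹ • S.tra g := by
      change -(-(u⁻¹ • -(S.tra g)) + Multiplicative.toAdd x.1) = _
      simp only [smul_neg, neg_neg]; abel
    have e4 : ((S.toSpin u g).2⁻¹ * u)⁻¹ = u⁻¹ * g.right := by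
      rw [mul_inv_rev, inv_inv]; rfl
    rw [e1, e2, e3, e4, ← rhoShift_tr_smul, smul_smul (S.fin u⁻¹), fin_mul_eq, mul_smul (S.tr _),
      smul_qRho]
    have e5 : S.qRho (-(Multiplicative.toAdd x.1)) =
        S.qRho (u⁻¹ • S.tra g) * S.qRho (-(Multiplicative.toAdd x.1) - u⁻¹ • S.tra g) := by
      rw [← qRho_add]; congr 1; abel
    rw [e5]; ring
  · intro v _ hv
    rw [SkewMonoidAlgebra.coeff_single_mul, Pi.mul_apply, Pi.single_eq_of_ne hv.symm, zero_mul]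
  · exact fun h => absurd (Finset.mem_univ u) h

theorem ae_mul (L L' : S.Op) : S.ae (L * L') = S.ae L * S.ae L' := by
  induction L using SkewMonoidAlgebra.induction_on with
  | zero => rw [zero_mul, ae_zero, zero_mul]
  | single g c => exact S.ae_single_mul g c L'
  | add L₁ L₂ h₁ h₂ => rw [add_mul, ae_add, ae_add, add_mul, h₁, h₂]

theorem ae_one : S.ae 1 = 1 := by
  refine SkewMonoidAlgebra.ext fun x => funext fun u => ?_
  rw [coeff_ae, SkewMonoidAlgebra.one_def, SkewMonoidAlgebra.one_def,
    SkewMonoidAlgebra.coeff_single_apply, SkewMonoidAlgebra.coeff_single_apply]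
  have h : (1 : S.What) = S.ofSpin u x ↔ (1 : S.SpinGrp) = x := by
    rw [← toSpin_eq_iff]
    have : S.toSpin u 1 = 1 := by
      refine Prod.ext ?_ rfl
      change Multiplicative.ofAdd (u⁻¹ • -(0 : S.Wt)) = _
      simp
    rw [this]
  by_cases hx : (1 : S.SpinGrp) = x
  · rw [if_pos hx, if_pos (h.2 hx), ← hx]
    have : -(Multiplicative.toAdd (1 : S.SpinGrp).1) = 0 := neg_zero
    rw [this, qRho_zero, smul_one, rhoShift_one, one_mul]; rfl
  · rw [if_neg hx, if_neg (fun h' => hx (h.1 h')), smul_zero, rhoShift_zero, mul_zero]; rfl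

/-! ### The limit of an operator -/

variable {S}

theorem HasRE.unique {L : S.Op} {A B : S.SpinOp} (hA : S.HasRE L A) (hB : S.HasRE L B) : A = B :=
  SkewMonoidAlgebra.ext fun x => funext fun u => (hA x u).unique (hB x u)

theorem HasRE.add {L L' : S.Op} {A A' : S.SpinOp} (h : S.HasRE L A) (h' : S.HasRE L' A') :
    S.HasRE (L + L') (A + A') := fun x u => by
  rw [ae_add, coeff_add_apply, coeff_add_apply]
  exact (h x u).add (h' x u)

theorem hasRE_one : S.HasRE (1 : S.Op) 1 := fun x u => by
  rw [ae_one, SkewMonoidAlgebra.one_def, SkewMonoidAlgebra.coeff_single_apply]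
  split_ifs
  · exact S.hasTLimit_one
  · exact S.hasTLimit_zero

theorem HasRE.mul {L L' : S.Op} {A A' : S.SpinOp} (h : S.HasRE L A) (h' : S.HasRE L' A') :
    S.HasRE (L * L') (A * A') := fun x u => by
  -- The support may shrink in the limit, so both product coefficients are summed over one finite
  -- set containing both supports and compared term by term.
  have key : ∀ (B B' : S.SpinOp) (s : Finset S.SpinGrp), B.support ⊆ s → (B * B').coeff x u =
      ∑ y ∈ s, B.coeff y u * S.tr (-(Multiplicative.toAdd y.1)) •
        B'.coeff (y⁻¹ * x) (y.2⁻¹ * u) := by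
    intro B B' s hs
    have h1 : (B * B').coeff x = ∑ y ∈ s, B.coeff y * y • B'.coeff (y⁻¹ * x) := by
      rw [SkewMonoidAlgebra.coeff_mul_left]
      exact Finsupp.sum_of_support_subset B.coeff hs
        (fun y F => F * y • B'.coeff (y⁻¹ * x)) (by simp)
    rw [h1, Finset.sum_apply]
    rfl
  rw [ae_mul, key _ _ _ Finset.subset_union_left, key A A' _ Finset.subset_union_right]
  exact S.hasTLimit_sum _ fun y _ => (h y u).mul ((h' _ _).smul _)

theorem exists_hasRE {L : S.Op} (h : ∀ x u, ∃ c, S.HasTLimit ((S.ae L).coeff x u) c) :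
    ∃ A, S.HasRE L A := by
  choose F hF using h
  refine ⟨⟨Finsupp.onFinset (S.ae L).support F fun x hx => ?_⟩, fun x u => ?_⟩
  -- Outside the support of æ^δ(L) the limits are 0 by uniqueness, so the limit is again a finite
  -- sum.
  · by_contra hns
    rw [SkewMonoidAlgebra.notMem_support_iff] at hns
    refine hx (funext fun u => ?_)
    have := hF x u
    rw [hns] at this
    exact this.unique S.hasTLimit_zero
  · simpa using hF x u

end

section

/-! ### The action on the coefficients of the `G`-binomials -/

theorem rhoShift_sub (c d : S.K) :
    fracMap S.rhoShift (c - d) = fracMap S.rhoShift c - fracMap S.rhoShift d :=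
  RingEquiv.map_sub _ _ _

theorem rhoShift_inv (c : S.K) : fracMap S.rhoShift c⁻¹ = (fracMap S.rhoShift c)⁻¹ :=
  map_inv₀ _ _

theorem smul_inv_K (g : S.What) (c : S.K) : g • c⁻¹ = (g • c)⁻¹ :=
  map_inv₀ (fracMap (S.actEquiv g)) c

theorem smul_mul_K (g : S.What) (c d : S.K) : g • (c * d) = g • c * g • d :=
  smul_mul' g c d

theorem smul_sub_K (g : S.What) (c d : S.K) : g • (c - d) = g • c - g • d :=
  RingEquiv.map_sub (fracMap (S.actEquiv g)) c d

theorem smul_one_K (g : S.What) : g • (1 : S.K) = 1 := RingEquiv.map_one (fracMap (S.actEquiv g))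

theorem smul_XAff (g : S.What) (a : S.AffRoot) : g • S.XAff a = S.XAff (S.actAff g a) := by
  unfold XAff
  rw [smul_mono]
  congr 1
  refine Prod.ext (S.rootWt_smul g.right a.1).symm (Prod.ext ?_ rfl)
  refine Subtype.ext ?_
  change (((a.2 • S.nuExp a.1 : S.QExp) : ℝ) -
    S.B.form ((g.right • S.rootWt a.1 : S.Wt) : M) ((S.tra g : S.Wt) : M)) =
    (((a.2 - S.cop (g.right • a.1) (S.tra g)) • S.nuExp (g.right • a.1) : S.QExp) : ℝ)
  rw [← rootWt_smul, form_symm, show ((S.rootWt (g.right • a.1) : S.Wt) : M) =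
    S.P.root (g.right • a.1) from rfl, form_rootWt, AddSubgroup.coe_zsmul, AddSubgroup.coe_zsmul]
  change a.2 • S.nu a.1 - _ = _ • S.nu (g.right • a.1)
  rw [nu_smul]
  simp only [zsmul_eq_mul]
  push_cast
  ring

theorem tAff_actAff (g : S.What) (a : S.AffRoot) : S.tAff (S.actAff g a) = S.tAff a := by
  unfold tAff
  rw [actAff_fst, len_smul]

theorem tAff_negAff (a : S.AffRoot) : S.tAff (S.negAff a) = S.tAff a :=
  congrArg S.tHalf (S.len_ng a.1)

theorem tAff_eq (a : S.AffRoot) : S.tAff a = S.tMono fun ν => S.dl ν a.1 := by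
  unfold tAff tHalf tMono
  congr 3
  funext ν
  unfold dl
  rw [Pi.single_apply]
  exact if_congr eq_comm rfl rfl

theorem smul_tAff (g : S.What) (a : S.AffRoot) : g • S.tAff a = S.tAff a := by
  rw [tAff_eq, smul_tMono]

theorem rhoShift_tAff (a : S.AffRoot) : fracMap S.rhoShift (S.tAff a) = S.tAff a := by
  rw [tAff_eq, rhoShift_tMono]

theorem tAff_ne_zero (a : S.AffRoot) : S.tAff a ≠ 0 := S.mono_ne_zero _

theorem smul_f (g : S.What) (a : S.AffRoot) : g • S.f a = S.f (S.actAff g a) := by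
  unfold f
  simp only [div_eq_mul_inv, pow_two, smul_mul_K, smul_inv_K, smul_sub_K, smul_one_K, smul_XAff,
    smul_tAff, tAff_actAff]

theorem smul_g (g : S.What) (a : S.AffRoot) : g • S.g a = S.g (S.actAff g a) := by
  unfold Setup.g
  simp only [div_eq_mul_inv, pow_two, smul_mul_K, smul_inv_K, smul_sub_K, smul_one_K, smul_XAff,
    smul_tAff, tAff_actAff]

/-! ### Regularity of the coefficients -/

/-- At y = 1 the lower and upper bounds enclose the same number. -/
theorem two_dl_le_twoRho (ν : S.NuR) {i : ι} (hi : S.base.IsPos i) :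
    2 * S.dl ν i ≤ S.twoRho ν (S.rootWt i) := by
  have h1 := S.lenDiff_lower ν (y := 1) hi (by rwa [one_smul])
  have h2 := S.lenDiff_upper ν (y := 1) (a := i) (by rwa [one_smul])
  rw [one_smul] at h2
  linarith

variable {S}

theorem reg_mono (e : S.Expo) : S.Reg e.2.2 (S.mono e) := by
  have h : S.mono e = S.tMono e.2.2 * S.mono (e.1, e.2.1, 0) := by
    unfold tMono
    rw [← mono_add]
    congr 1
    refine Prod.ext (zero_add _).symm (Prod.ext (zero_add _).symm (add_zero _).symm)
  rw [h]
  refine ⟨AddMonoidAlgebra.single (e.1, e.2.1, 0) 1, 1, S.isTPol_single (fun _ => le_rfl) 1,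
    S.isTPol_one, by rw [tZero_one]; exact one_ne_zero, ?_⟩
  rw [map_one, div_one]
  rfl

theorem reg_of_isTPol {p : S.Pol} (hp : S.IsTPol p) : S.Reg 0 (algebraMap S.Pol S.K p) := by
  have := reg_of_div hp S.isTPol_one (by rw [tZero_one]; exact one_ne_zero)
  rwa [map_one, div_one] at this

theorem isTPol_single_sub_one {e : S.Expo} (he : ∀ ν, 0 ≤ e.2.2 ν) :
    S.IsTPol (AddMonoidAlgebra.single e 1 - 1) := by
  rw [sub_eq_add_neg]
  exact (S.isTPol_single he 1).add S.isTPol_one.neg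

theorem mono_sub_one (e : S.Expo) :
    S.mono e - 1 = algebraMap S.Pol S.K (AddMonoidAlgebra.single e 1 - 1) := by
  rw [map_sub, map_one]; rfl

theorem reg_mono_sub_one {e : S.Expo} (he : ∀ ν, 0 ≤ e.2.2 ν) : S.Reg 0 (S.mono e - 1) := by
  rw [mono_sub_one]
  exact reg_of_isTPol (isTPol_single_sub_one he)

/-- The constant term -1 survives at t = 0 and, as e ≠ 0, cannot be cancelled by the monomial. -/
theorem reg_inv_mono_sub_one {e : S.Expo} (he : ∀ ν, 0 ≤ e.2.2 ν) (h0 : e ≠ 0) :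
    S.Reg 0 (S.mono e - 1)⁻¹ := by
  rw [mono_sub_one, inv_eq_one_div, ← map_one (algebraMap S.Pol S.K)]
  refine reg_of_div S.isTPol_one (isTPol_single_sub_one he) fun h => ?_
  have h1 := congrArg (fun p : S.Pol => p.coeff 0) h
  simp only [tZero_coeff] at h1
  rw [if_pos (show (0 : S.Expo).2.2 = 0 from rfl), AddMonoidAlgebra.coeff_sub, Finsupp.sub_apply, AddMonoidAlgebra.coeff_single,
    Finsupp.single_eq_of_ne h0.symm, AddMonoidAlgebra.one_def, AddMonoidAlgebra.coeff_single,
    Finsupp.single_eq_same] at h1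
  norm_num at h1

theorem mono_ne_one {e : S.Expo} (h0 : e ≠ 0) : S.mono e ≠ 1 := by
  intro h
  rw [← S.mono_zero] at h
  have h1 := IsFractionRing.injective S.Pol S.K h
  have h2 := congrArg (fun p : S.Pol => p.coeff e) h1
  simp [AddMonoidAlgebra.coeff_single, h0.symm] at h2

variable (S)

/-- The exponent of the monomial `X_{-ã}` shifted by `Γ_{-ρ_k}`. -/
def shiftedExp (a : S.AffRoot) : S.Expo :=
  (-S.rootWt a.1, -(a.2 • S.nuExp a.1), fun ν => S.twoRho ν (S.rootWt a.1))

theorem rhoShift_XAff_inv (a : S.AffRoot) :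
    fracMap S.rhoShift (S.XAff a)⁻¹ = S.mono (S.shiftedExp a) := by
  unfold XAff
  rw [← mono_neg, rhoShift_mono]
  congr 1
  refine Prod.ext rfl (Prod.ext rfl ?_)
  funext ν
  change -(0 : ℤ) - S.twoRho ν (-S.rootWt a.1) = S.twoRho ν (S.rootWt a.1)
  rw [map_neg]; ring

theorem rootWt_ne_zero (i : ι) : S.rootWt i ≠ 0 := fun h =>
  S.P.ne_zero i (congrArg Subtype.val h)

theorem shiftedExp_ne_zero (a : S.AffRoot) : S.shiftedExp a ≠ 0 := fun h =>
  S.rootWt_ne_zero a.1 (neg_eq_zero.1 (congrArg Prod.fst h))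

theorem XAff_ne_one (a : S.AffRoot) : S.XAff a ≠ 1 :=
  mono_ne_one fun h => S.rootWt_ne_zero a.1 (congrArg Prod.fst h)

theorem twoRho_rootWt_nonneg (ν : S.NuR) {i : ι} (hi : S.base.IsPos i) :
    0 ≤ S.twoRho ν (S.rootWt i) := by
  have h1 := S.two_dl_le_twoRho ν hi
  have h2 := S.dl_nonneg ν i
  linarith

theorem rhoShift_f (a : S.AffRoot) : fracMap S.rhoShift ((S.tAff a)⁻¹ * S.f a) =
    (S.tAff a)⁻¹ * ((S.tAff a ^ 2 * S.mono (S.shiftedExp a) - 1) *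
      (S.mono (S.shiftedExp a) - 1)⁻¹) := by
  unfold f
  simp only [div_eq_mul_inv, pow_two, rhoShift_mul, rhoShift_inv, rhoShift_sub, rhoShift_one,
    rhoShift_tAff, ← rhoShift_XAff_inv]

theorem rhoShift_g (a : S.AffRoot) : fracMap S.rhoShift ((S.tAff a)⁻¹ * S.g a) =
    (S.tAff a)⁻¹ * ((S.tAff a ^ 2 - 1) * (1 - S.mono (S.shiftedExp a))⁻¹) := by
  unfold Setup.g
  simp only [div_eq_mul_inv, pow_two, rhoShift_mul, rhoShift_inv, rhoShift_sub, rhoShift_one,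
    rhoShift_tAff, ← rhoShift_XAff_inv]

theorem tMono_neg (e : S.NuR → ℤ) : S.tMono (-e) = (S.tMono e)⁻¹ := by
  refine eq_inv_of_mul_eq_one_left ?_
  rw [← tMono_add, neg_add_cancel, tMono_zero]

theorem reg_tAff_inv (a : S.AffRoot) : S.Reg (fun ν => -S.dl ν a.1) (S.tAff a)⁻¹ := by
  rw [tAff_eq, ← tMono_neg]
  exact reg_tMono _

theorem tAff_sq (a : S.AffRoot) : S.tAff a ^ 2 = S.mono (0, 0, fun ν => 2 * S.dl ν a.1) := by
  rw [tAff_eq, pow_two, ← tMono_add]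
  unfold tMono
  congr 3
  funext ν
  exact (two_mul _).symm

theorem shiftedExp_negAff (a : S.AffRoot) : S.shiftedExp (S.negAff a) = -S.shiftedExp a := by
  refine Prod.ext ?_ (Prod.ext ?_ ?_)
  · exact congrArg Neg.neg (S.rootWt_ng a.1)
  · have h : S.nuExp (S.ng a.1) = S.nuExp a.1 := Subtype.ext (S.nu_ng a.1)
    change -(-a.2 • S.nuExp (S.ng a.1)) = -(-(a.2 • S.nuExp a.1))
    rw [h, neg_smul]
  · funext ν
    change S.twoRho ν (S.rootWt (S.ng a.1)) = -S.twoRho ν (S.rootWt a.1)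
    rw [rootWt_ng, map_neg]

theorem reg_f_pos {a : S.AffRoot} (ha : S.base.IsPos a.1) :
    S.Reg (fun ν => -S.dl ν a.1) (fracMap S.rhoShift ((S.tAff a)⁻¹ * S.f a)) := by
  have hr : ∀ ν, 0 ≤ (S.shiftedExp a).2.2 ν := fun ν => S.twoRho_rootWt_nonneg ν ha
  rw [rhoShift_f, tAff_sq, ← mono_add]
  have h1 : S.Reg 0 (S.mono ((0, 0, fun ν => 2 * S.dl ν a.1) + S.shiftedExp a) - 1) :=
    reg_mono_sub_one fun ν => add_nonneg (mul_nonneg zero_le_two (S.dl_nonneg ν a.1)) (hr ν)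
  have := (S.reg_tAff_inv a).mul (h1.mul (reg_inv_mono_sub_one hr (S.shiftedExp_ne_zero a)))
  simpa using this

/-- For negative α the shifted X_α̃⁻¹ has nonpositive powers of t. Multiplying numerator and
denominator by its inverse and taking out t_α turns the factor t_α^{-1/2} into t_α^{1/2}. The new
numerator is still polynomial in t by `two_dl_le_twoRho`. -/
theorem reg_f_neg {a : S.AffRoot} (ha : ¬ S.base.IsPos a.1) :
    S.Reg (fun ν => S.dl ν a.1) (fracMap S.rhoShift ((S.tAff a)⁻¹ * S.f a)) := by
  have hp : S.base.IsPos (S.ng a.1) := (S.isPos_ng a.1).2 ha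
  set e := S.shiftedExp (S.negAff a) with he
  have hr : ∀ ν, 0 ≤ e.2.2 ν := fun ν => S.twoRho_rootWt_nonneg ν hp
  have hr' : ∀ ν, 0 ≤ (e - (0, 0, fun ν => 2 * S.dl ν a.1)).2.2 ν := fun ν => by
    have := S.two_dl_le_twoRho ν hp
    rw [dl_ng] at this
    exact sub_nonneg.2 this
  have he0 : e ≠ 0 := S.shiftedExp_ne_zero _
  have hinv : S.mono (S.shiftedExp a) = (S.mono e)⁻¹ := by
    rw [he, shiftedExp_negAff, mono_neg, inv_inv]
  have h0 : S.mono e - 1 ≠ 0 := sub_ne_zero.2 (mono_ne_one he0)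
  have key : fracMap S.rhoShift ((S.tAff a)⁻¹ * S.f a) =
      S.tAff a * ((S.mono (e - (0, 0, fun ν => 2 * S.dl ν a.1)) - 1) * (S.mono e - 1)⁻¹) := by
    rw [rhoShift_f, hinv, sub_eq_add_neg e, mono_add, mono_neg, ← tAff_sq]
    have h1 := S.mono_ne_zero e
    have h2 := S.tAff_ne_zero a
    generalize S.mono e = x at *
    generalize S.tAff a = t at *
    have h3 : x⁻¹ - 1 ≠ 0 := by
      intro h
      rw [sub_eq_zero, inv_eq_one] at h
      exact h0 (sub_eq_zero.2 h)
    have h4 : 1 - x ≠ 0 := by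
      intro h
      exact h0 (by rw [← neg_sub, h, neg_zero])
    rw [← sub_eq_zero]
    field_simp
    ring
  rw [key]
  have := (reg_tMono (S := S) fun ν => S.dl ν a.1).mul
    ((reg_mono_sub_one hr').mul (reg_inv_mono_sub_one hr he0))
  rw [← tAff_eq] at this
  simpa using this

theorem reg_sq_sub_one (a : S.AffRoot) : S.Reg 0 (S.tAff a ^ 2 - 1) := by
  rw [tAff_sq]
  exact reg_mono_sub_one fun ν => mul_nonneg zero_le_two (S.dl_nonneg ν a.1)

theorem reg_g_pos {a : S.AffRoot} (ha : S.base.IsPos a.1) :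
    S.Reg (fun ν => -S.dl ν a.1) (fracMap S.rhoShift ((S.tAff a)⁻¹ * S.g a)) := by
  have hr : ∀ ν, 0 ≤ (S.shiftedExp a).2.2 ν := fun ν => S.twoRho_rootWt_nonneg ν ha
  rw [rhoShift_g, ← neg_sub (S.mono _), inv_neg]
  have := (S.reg_tAff_inv a).mul ((S.reg_sq_sub_one a).mul
    (reg_inv_mono_sub_one hr (S.shiftedExp_ne_zero a)).neg)
  simpa using this

/-- Denominators are cleared as for f, but the numerator t_α - 1 does not involve X, so the clearing
monomial stays in front and adds -2(ρ_ν^∨, α) to the exponent. -/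
theorem reg_g_neg {a : S.AffRoot} (ha : ¬ S.base.IsPos a.1) :
    S.Reg (fun ν => -S.twoRho ν (S.rootWt a.1) - S.dl ν a.1)
      (fracMap S.rhoShift ((S.tAff a)⁻¹ * S.g a)) := by
  have hp : S.base.IsPos (S.ng a.1) := (S.isPos_ng a.1).2 ha
  set e := S.shiftedExp (S.negAff a) with he
  have hr : ∀ ν, 0 ≤ e.2.2 ν := fun ν => S.twoRho_rootWt_nonneg ν hp
  have he0 : e ≠ 0 := S.shiftedExp_ne_zero _
  have hinv : S.mono (S.shiftedExp a) = (S.mono e)⁻¹ := by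
    rw [he, shiftedExp_negAff, mono_neg, inv_inv]
  have h0 : S.mono e - 1 ≠ 0 := sub_ne_zero.2 (mono_ne_one he0)
  have key : fracMap S.rhoShift ((S.tAff a)⁻¹ * S.g a) =
      S.mono e * ((S.tAff a)⁻¹ * ((S.tAff a ^ 2 - 1) * (S.mono e - 1)⁻¹)) := by
    rw [rhoShift_g, hinv]
    have h1 := S.mono_ne_zero e
    generalize S.mono e = x at *
    have : (1 - x⁻¹)⁻¹ = x * (x - 1)⁻¹ := by
      rw [← inv_inv x, ← mul_inv, inv_inv]
      congr 1
      rw [mul_sub, mul_inv_cancel₀ (inv_ne_zero h1), mul_one]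
    rw [this]; ring
  rw [key]
  have := (reg_mono e).mul ((S.reg_tAff_inv a).mul ((S.reg_sq_sub_one a).mul
    (reg_inv_mono_sub_one hr he0)))
  refine this.mono fun ν => le_of_eq ?_
  change -S.twoRho ν (S.rootWt a.1) - S.dl ν a.1 =
    S.twoRho ν (S.rootWt (S.ng a.1)) + (-S.dl ν a.1 + (0 + 0))
  rw [rootWt_ng, map_neg]; ring

theorem smul_term_f (y : S.W) (a : S.AffRoot) : S.fin y • ((S.tAff a)⁻¹ * S.f a) =
    (S.tAff (S.actAff (S.fin y) a))⁻¹ * S.f (S.actAff (S.fin y) a) := by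
  rw [smul_mul_K, smul_inv_K, smul_tAff, smul_f, tAff_actAff]

theorem smul_term_g (y : S.W) (a : S.AffRoot) : S.fin y • ((S.tAff a)⁻¹ * S.g a) =
    (S.tAff (S.actAff (S.fin y) a))⁻¹ * S.g (S.actAff (S.fin y) a) := by
  rw [smul_mul_K, smul_inv_K, smul_tAff, smul_g, tAff_actAff]

theorem reg_term_f (y : S.W) (a : S.AffRoot) :
    S.Reg (fun ν => -(S.dl ν a.1 * S.sgn (y • a.1)))
      (fracMap S.rhoShift (S.fin y • ((S.tAff a)⁻¹ * S.f a))) := by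
  rw [smul_term_f]
  by_cases h : S.base.IsPos (y • a.1)
  · refine (S.reg_f_pos (a := S.actAff (S.fin y) a) h).mono fun ν => le_of_eq ?_
    rw [sgn_pos _ h, mul_one]
    exact congrArg Neg.neg (S.dl_smul ν y a.1).symm
  · refine (S.reg_f_neg (a := S.actAff (S.fin y) a) h).mono fun ν => le_of_eq ?_
    rw [sgn_neg _ h, mul_neg_one, neg_neg]
    exact (S.dl_smul ν y a.1).symm

theorem reg_term_g_pos {y : S.W} {a : S.AffRoot} (h : S.base.IsPos (y • a.1)) :
    S.Reg (fun ν => -S.dl ν a.1)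
      (fracMap S.rhoShift (S.fin y • ((S.tAff a)⁻¹ * S.g a))) := by
  rw [smul_term_g]
  refine (S.reg_g_pos (a := S.actAff (S.fin y) a) h).mono fun ν => le_of_eq ?_
  exact congrArg Neg.neg (S.dl_smul ν y a.1).symm

theorem reg_term_g_neg {y : S.W} {a : S.AffRoot} (h : ¬ S.base.IsPos (y • a.1)) :
    S.Reg (fun ν => -S.twoRho ν (S.rootWt (y • a.1)) - S.dl ν a.1)
      (fracMap S.rhoShift (S.fin y • ((S.tAff a)⁻¹ * S.g a))) := by
  rw [smul_term_g]
  refine (S.reg_g_neg (a := S.actAff (S.fin y) a) h).mono fun ν => le_of_eq ?_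
  rw [← S.dl_smul ν y a.1]
  rfl

end

section

/-! ### The products in the expansions -/

theorem single_mul_single_K (g h : S.What) (c d : S.K) :
    (SkewMonoidAlgebra.single g c * SkewMonoidAlgebra.single h d : S.Op) =
      SkewMonoidAlgebra.single (g * h) (c * g • d) := SkewMonoidAlgebra.single_mul_single

theorem grpOp_mul_grpOp (g h : S.What) : S.grpOp g * S.grpOp h = S.grpOp (g * h) := by
  unfold grpOp
  rw [single_mul_single_K, smul_one_K, one_mul]

theorem grpOp_one : S.grpOp 1 = 1 := rfl

theorem grpOp_mul_inv (g : S.What) : S.grpOp g * S.grpOp g⁻¹ = 1 := by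
  rw [grpOp_mul_grpOp, mul_inv_cancel, grpOp_one]

theorem grpOp_inv_mul (g : S.What) : S.grpOp g⁻¹ * S.grpOp g = 1 := by
  rw [grpOp_mul_grpOp, inv_mul_cancel, grpOp_one]

theorem mulOp_mul_mulOp (c d : S.K) : S.mulOp c * S.mulOp d = S.mulOp (c * d) := by
  unfold mulOp
  rw [single_mul_single_K, one_mul, one_smul]

theorem mulOp_mul_grpOp (c : S.K) (g : S.What) :
    S.mulOp c * S.grpOp g = SkewMonoidAlgebra.single g c := by
  unfold mulOp grpOp
  rw [single_mul_single_K, one_mul, one_smul, mul_one]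

theorem grpOp_mul_mulOp (g : S.What) (c : S.K) :
    S.grpOp g * S.mulOp c = SkewMonoidAlgebra.single g (g • c) := by
  unfold mulOp grpOp
  rw [single_mul_single_K, mul_one, one_mul]

theorem op_mul_neg (A B : S.Op) : A * -B = -(A * B) := mul_neg (α := S.Op) A B

theorem mulOp_neg (c : S.K) : S.mulOp (-c) = -S.mulOp c := SkewMonoidAlgebra.single_neg _ _

theorem mulOp_mul_grpOp_comm (c : S.K) (g : S.What) :
    S.mulOp c * S.grpOp g = S.grpOp g * S.mulOp (g⁻¹ • c) := by
  rw [mulOp_mul_grpOp, grpOp_mul_mulOp, smul_inv_smul]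

theorem fin_mul (y : S.W) (g : S.What) :
    S.fin y * g = S.tr (y • S.tra g) * S.fin (y * g.right) := by
  have := S.fin_mul_eq y⁻¹ g
  rwa [inv_inv] at this

theorem twoRho_smul_tra_sAff_mul (ν : S.NuR) (y : S.W) (a : S.AffRoot) (g : S.What) :
    S.twoRho ν (y • S.tra (S.sAff a * g)) =
      -(a.2 * S.twoRho ν (S.rootWt (y • a.1))) +
        S.twoRho ν ((y * S.refl a.1) • S.tra g) := by
  rw [tra_mul, tra_sAff, right_sAff, smul_add, smul_smul, map_add, smul_neg, map_neg,
    show y • a.2 • S.rootWt a.1 = a.2 • y • S.rootWt a.1 from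
      map_zsmul (DistribSMul.toAddMonoidHom S.Wt y) _ _, map_zsmul, ← rootWt_smul]
  rfl

/-- The product y s_α̃ is a translation times y s_α, and translations commute with the ρ-shift and
preserve `Reg`. So the coefficient is seen at y s_α, and the level of α̃ plays no part here. -/
theorem Reg.fin_smul_sAff_smul {S : Setup ι M N} {y : S.W} {a : S.AffRoot} {c : S.K}
    {e : S.NuR → ℤ} (h : S.Reg e (fracMap S.rhoShift (S.fin (y * S.refl a.1) • c))) :
    S.Reg e (fracMap S.rhoShift (S.fin y • S.sAff a • c)) := by
  rw [smul_smul, fin_mul, mul_smul, rhoShift_tr_smul, right_sAff]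
  exact h.smul _

/-- The coefficients of the products in the expansion of `b⁻¹ Y_b`. -/
def PlusReg (as : List S.AffRoot) (g : S.What) (c : S.K) : Prop :=
  ∀ y : S.W, S.Reg (fun ν => -S.psi ν as y - S.twoRho ν (y • S.tra g))
    (fracMap S.rhoShift (S.fin y • c))

/-- The coefficients of the products in the expansion of `Y_b⁻¹ b`. -/
def MinusReg (as : List S.AffRoot) (g : S.What) (c : S.K) : Prop :=
  ∀ y : S.W, S.Reg (fun ν => S.psi ν as y + S.twoRho ν (y • S.tra g))
    (fracMap S.rhoShift (S.fin y • c))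

variable {S}

theorem PlusReg.cons_f {as : List S.AffRoot} {g : S.What} {c : S.K} (h : S.PlusReg as g c)
    (a : S.AffRoot) : S.PlusReg (a :: as) g ((S.tAff a)⁻¹ * S.f a * c) := fun y => by
  rw [smul_mul_K, rhoShift_mul]
  refine ((S.reg_term_f y a).mul (h y)).mono fun ν => le_of_eq ?_
  rw [psi_cons, Pi.add_apply]
  ring

theorem isPos_smul_of_not {y : S.W} {i : ι} (h : ¬ S.base.IsPos (y • i)) :
    S.base.IsPos ((y * S.refl i) • i) := by
  rw [mul_smul, refl_smul_self, smul_ng]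
  exact (S.isPos_ng _).2 h

theorem rootWt_mul_refl (y : S.W) (i : ι) :
    S.rootWt ((y * S.refl i) • i) = -S.rootWt (y • i) := by
  rw [mul_smul, refl_smul_self, smul_ng, rootWt_ng]

/-- The new coefficient is seen at y and the old one at y s_α. After the ρ-terms of the old
translation cancel, the claim is `psi_sub_lower` if yα > 0 and `psi_sub_upper` at y s_α if yα < 0.
-/
theorem PlusReg.cons_g {j : S.AffIdx} {js : List S.AffIdx} {g : S.What} {c : S.K} {a : S.AffRoot}
    (h : S.PlusReg (S.lamSeq js) g c) (ha : a = S.actAff (S.word js)⁻¹ (S.simple j))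
    (hp : S.base.IsPos a.1) :
    S.PlusReg (a :: S.lamSeq js) (S.sAff a * g) ((S.tAff a)⁻¹ * S.g a * S.sAff a • c) :=
  fun y => by
  rw [smul_mul_K, rhoShift_mul]
  have h1 := (h (y * S.refl a.1)).fin_smul_sAff_smul
  by_cases hy : S.base.IsPos (y • a.1)
  · refine ((S.reg_term_g_pos hy).mul h1).mono fun ν => ?_
    rw [psi_cons, twoRho_smul_tra_sAff_mul, Pi.add_apply, sgn_pos _ hy]
    have := S.psi_sub_lower ν j js y ha hp hy
    linarith
  · refine ((S.reg_term_g_neg hy).mul h1).mono fun ν => ?_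
    rw [psi_cons, twoRho_smul_tra_sAff_mul, Pi.add_apply, sgn_neg _ hy]
    have := S.psi_sub_upper ν j js (y * S.refl a.1) ha (isPos_smul_of_not hy)
    rw [rootWt_mul_refl, map_neg, mul_assoc, refl_mul_self, mul_one] at this
    linarith

theorem MinusReg.cons_f {as : List S.AffRoot} {g : S.What} {c : S.K} (h : S.MinusReg as g c)
    (a : S.AffRoot) :
    S.MinusReg (a :: as) g (c * ((S.tAff (S.negAff a))⁻¹ * S.f (S.negAff a))) := fun y => by
  rw [smul_mul_K, rhoShift_mul]
  refine ((h y).mul (S.reg_term_f y (S.negAff a))).mono fun ν => le_of_eq ?_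
  rw [psi_cons, Pi.add_apply]
  change _ = _ + -(S.dl ν (S.ng a.1) * S.sgn (y • S.ng a.1))
  rw [smul_ng, sgn_ng, dl_ng]
  ring

/-- The coefficient now belongs to -α̃, so the two estimates on ψ exchange their cases. -/
theorem MinusReg.cons_g {j : S.AffIdx} {js : List S.AffIdx} {g : S.What} {c : S.K} {a : S.AffRoot}
    (h : S.MinusReg (S.lamSeq js) g c) (ha : a = S.actAff (S.word js)⁻¹ (S.simple j))
    (hp : S.base.IsPos a.1) :
    S.MinusReg (a :: S.lamSeq js) (S.sAff a * g)
      (-(S.sAff a • c * ((S.tAff (S.negAff a))⁻¹ * S.g (S.negAff a)))) :=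
  fun y => by
  have hneg : ∀ d : S.K, fracMap S.rhoShift (S.fin y • -d) = -fracMap S.rhoShift (S.fin y • d) := by
    intro d
    rw [← zero_sub, smul_sub_K, smul_zero, rhoShift_sub, rhoShift_zero, zero_sub]
  rw [hneg, smul_mul_K, rhoShift_mul]
  have h1 := (h (y * S.refl a.1)).fin_smul_sAff_smul
  have hng : y • (S.negAff a).1 = S.ng (y • a.1) := S.smul_ng y a.1
  have hdl : ∀ ν, S.dl ν (S.negAff a).1 = S.dl ν a.1 := fun ν => S.dl_ng ν a.1
  refine Reg.neg ?_
  by_cases hy : S.base.IsPos (y • a.1)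
  · have hn : ¬ S.base.IsPos (y • (S.negAff a).1) := by
      rw [hng, isPos_ng, not_not]; exact hy
    refine (h1.mul (S.reg_term_g_neg hn)).mono fun ν => ?_
    rw [psi_cons, twoRho_smul_tra_sAff_mul, Pi.add_apply, sgn_pos _ hy, hng, hdl, rootWt_ng,
      map_neg]
    have := S.psi_sub_upper ν j js y ha hy
    linarith
  · have hn : S.base.IsPos (y • (S.negAff a).1) := by
      rw [hng, isPos_ng]; exact hy
    refine (h1.mul (S.reg_term_g_pos hn)).mono fun ν => ?_
    rw [psi_cons, twoRho_smul_tra_sAff_mul, Pi.add_apply, sgn_neg _ hy, hdl]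
    have := S.psi_sub_lower ν j js (y * S.refl a.1) ha hp (isPos_smul_of_not hy)
    rw [rootWt_mul_refl, map_neg, mul_assoc, refl_mul_self, mul_one] at this
    linarith

theorem forall₂_append_singleton {α β : Type*} {R : α → β → Prop} {l : List α} {m : List β} {b : β}
    (h : List.Forall₂ R l (m ++ [b])) :
    ∃ l' x, l = l' ++ [x] ∧ List.Forall₂ R l' m ∧ R x b := by
  have h2 := List.forall₂_drop_append l m [b] h
  obtain ⟨x, xs, hx, hnil, he⟩ := List.forall₂_cons_right_iff.1 h2
  rw [List.forall₂_nil_right_iff] at hnil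
  refine ⟨_, x, ?_, List.forall₂_take_append l m [b] h, hx⟩
  rw [← hnil, ← he, List.take_append_drop]

theorem IsPlusProduct.exists_single {js : List S.AffIdx}
    (hpos : ∀ a ∈ S.lamSeq js, S.base.IsPos a.1) {h : S.Op} (hh : S.IsPlusProduct (S.lamSeq js) h) :
    ∃ g c, h = SkewMonoidAlgebra.single g c ∧ S.PlusReg (S.lamSeq js) g c := by
  induction js generalizing h with
  | nil =>
    obtain ⟨hs, hf, rfl⟩ := hh
    cases hf
    refine ⟨1, 1, rfl, fun y => ?_⟩
    rw [smul_one_K, rhoShift_one, ← tMono_zero]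
    refine (reg_tMono _).mono fun ν => le_of_eq ?_
    rw [tra_one, smul_zero, map_zero]
    rfl
  | cons j js ih =>
    obtain ⟨hs, hf, rfl⟩ := hh
    obtain _ | ⟨hx, hf'⟩ := hf
    rename_i x hs
    obtain ⟨g, c, hgc, hreg⟩ := ih (fun a ha => hpos a (List.mem_cons_of_mem _ ha)) ⟨hs, hf', rfl⟩
    rw [List.prod_cons, hgc]
    rcases hx with rfl | rfl
    · refine ⟨g, _, ?_, hreg.cons_f _⟩
      unfold termF mulOp
      rw [single_mul_single_K, one_mul, one_smul]
    · refine ⟨_, _, ?_, hreg.cons_g (j := j) rfl (hpos _ List.mem_cons_self)⟩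
      unfold termPlus
      rw [mulOp_mul_grpOp, single_mul_single_K]

/-- The list is reversed, so the induction adds the new factor on the right. Group elements are kept
on the left, as in the definition of `dagOrdW`, and c is conjugated past the new reflection. -/
theorem IsMinusProduct.exists_single {js : List S.AffIdx}
    (hpos : ∀ a ∈ S.lamSeq js, S.base.IsPos a.1) {h : S.Op}
    (hh : S.IsMinusProduct ((S.lamSeq js).reverse.map S.negAff) h) :
    ∃ g c, h = S.grpOp g⁻¹ * S.mulOp c ∧ S.MinusReg (S.lamSeq js) g c := by
  induction js generalizing h with
  | nil =>
    obtain ⟨hs, hf, rfl⟩ := hh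
    cases hf
    refine ⟨1, 1, ?_, fun y => ?_⟩
    · rw [inv_one, grpOp_one, one_mul]; rfl
    rw [smul_one_K, rhoShift_one, ← tMono_zero]
    refine (reg_tMono _).mono fun ν => le_of_eq ?_
    rw [tra_one, smul_zero, map_zero]
    rfl
  | cons j js ih =>
    obtain ⟨hs, hf, rfl⟩ := hh
    rw [lamSeq, List.reverse_cons, List.map_append, List.map_cons, List.map_nil] at hf
    obtain ⟨hs', x, rfl, hf', hx⟩ := forall₂_append_singleton hf
    obtain ⟨g, c, hgc, hreg⟩ := ih (fun a ha => hpos a (List.mem_cons_of_mem _ ha)) ⟨hs', hf', rfl⟩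
    rw [List.prod_append, List.prod_singleton, hgc]
    rcases hx with rfl | rfl
    · refine ⟨g, _, ?_, hreg.cons_f _⟩
      unfold termF
      rw [mul_assoc, mulOp_mul_mulOp]
    · refine ⟨_, _, ?_, hreg.cons_g (j := j) rfl (hpos _ List.mem_cons_self)⟩
      unfold termMinus
      rw [sAff_negAff, mul_inv_rev, sAff_inv]
      rw [← grpOp_mul_grpOp, mulOp_neg, op_mul_neg, op_mul_neg, mul_assoc, ← mul_assoc (S.mulOp c),
        mulOp_mul_grpOp_comm, sAff_inv, mul_assoc, mul_assoc, mulOp_mul_mulOp]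

end

section

/-! ### Orders and limits of the products -/

variable {S}

theorem reg_zero (e : S.NuR → ℤ) : S.Reg e 0 :=
  ⟨0, 1, by intro e he; simp at he, S.isTPol_one, by rw [tZero_one]; exact one_ne_zero, by
    rw [map_zero, zero_div, mul_zero]⟩

theorem coeff_ae_single (g : S.What) (c : S.K) {x : S.SpinGrp} {u : S.W} (h : g = S.ofSpin u x) :
    (S.ae (SkewMonoidAlgebra.single g c)).coeff x u =
      S.qRho (u⁻¹ • S.tra g) * fracMap S.rhoShift (S.fin u⁻¹ • c) := by
  rw [coeff_ae, SkewMonoidAlgebra.coeff_single_apply, if_pos h]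
  congr 2
  rw [h]
  change _ = u⁻¹ • u • -(Multiplicative.toAdd x.1)
  rw [inv_smul_smul]

theorem coeff_ae_single_of_ne (g : S.What) (c : S.K) {x : S.SpinGrp} {u : S.W}
    (h : g ≠ S.ofSpin u x) : (S.ae (SkewMonoidAlgebra.single g c)).coeff x u = 0 := by
  rw [coeff_ae, SkewMonoidAlgebra.coeff_single_apply, if_neg h, smul_zero, rhoShift_zero, mul_zero]

theorem reg_coeff_ae_single {g : S.What} {c : S.K} {x : S.SpinGrp} {u : S.W} {e : S.NuR → ℤ}
    (h : g = S.ofSpin u x → S.Reg (fun ν => e ν - S.twoRho ν (u⁻¹ • S.tra g))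
      (fracMap S.rhoShift (S.fin u⁻¹ • c))) :
    S.Reg e ((S.ae (SkewMonoidAlgebra.single g c)).coeff x u) := by
  by_cases hg : g = S.ofSpin u x
  · rw [coeff_ae_single g c hg, qRho_eq]
    refine ((reg_tMono _).mul (h hg)).mono fun ν => le_of_eq ?_
    rw [Pi.add_apply]; ring
  · rw [coeff_ae_single_of_ne g c hg]
    exact reg_zero e

/-- In a nonzero component the finite part of g⁻¹ is the label `x.2`, so c is seen at u⁻¹ times this
label. For u = `x.2 * w`, the component used in `dagOrdW`, that is w⁻¹. -/
theorem reg_coeff_ae_grpOp_mul_mulOp {g : S.What} {c : S.K} {x : S.SpinGrp} {u : S.W}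
    {e : S.NuR → ℤ} (h : S.Reg (fun ν => e ν + S.twoRho ν ((u⁻¹ * x.2) • S.tra g))
      (fracMap S.rhoShift (S.fin (u⁻¹ * x.2) • c))) :
    S.Reg e ((S.ae (S.grpOp g⁻¹ * S.mulOp c)).coeff x u) := by
  rw [grpOp_mul_mulOp]
  refine reg_coeff_ae_single fun hg => ?_
  have hr : g⁻¹.right = x.2 := congrArg SemidirectProduct.right hg
  rw [smul_smul, fin_mul, mul_smul, rhoShift_tr_smul, tra_inv, hr]
  refine (h.smul _).mono fun ν => le_of_eq ?_
  have hr' : g.right⁻¹ = x.2 := hr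
  rw [hr', smul_neg, map_neg, smul_smul]; ring

theorem coeff_ae_Gam (b : S.Wt) (w : S.W) :
    (S.ae (S.Gam b)).coeff (Multiplicative.ofAdd (w⁻¹ • b), 1) w = S.qRho (-(w⁻¹ • b)) := by
  unfold Gam grpOp
  rw [coeff_ae_single, smul_one_K, rhoShift_one, mul_one, tra_tr, smul_neg]
  refine S.What_ext ?_ rfl
  change -b = w • -(w⁻¹ • b)
  rw [smul_neg, smul_inv_smul]

/-- Only an upper bound is needed, so one nonzero component suffices. -/
theorem ordW_Gam_le (b : S.Wt) (ν : S.NuR) (w : S.W) :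
    S.ordW ν w (S.ae (S.Gam b)) ≤
      ((((S.twoRho ν (w⁻¹ • -b) : ℤ) : ℚ) / 2 : ℚ) : WithTop ℚ) := by
  have hc := S.coeff_ae_Gam b w
  have hx : (Multiplicative.ofAdd (w⁻¹ • b), (1 : S.W)) ∈ (S.ae (S.Gam b)).support := by
    by_contra h
    rw [SkewMonoidAlgebra.notMem_support_iff] at h
    rw [h] at hc
    exact S.mono_ne_zero _ hc.symm
  refine (Finset.inf_le hx).trans (le_of_eq ?_)
  rw [hc, qRho_eq, tOrd_tMono, smul_neg]

theorem PlusReg.ordW_le {as : List S.AffRoot} {g : S.What} {c : S.K} {b : S.Wt}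
    (h : S.PlusReg as g c) (hb : ∀ ν y, S.psi ν as y = S.twoRho ν (y • b)) (ν : S.NuR) (w : S.W) :
    S.ordW ν w (S.ae (S.Gam b)) ≤ S.ordW ν w (S.ae (SkewMonoidAlgebra.single g c)) := by
  refine (S.ordW_Gam_le b ν w).trans (Finset.le_inf fun x _ => ?_)
  refine Reg.le_tOrd (e := fun ν => S.twoRho ν (w⁻¹ • -b)) (reg_coeff_ae_single fun _ => ?_) ν
  refine (h w⁻¹).mono fun ν => le_of_eq ?_
  beta_reduce
  rw [hb, smul_neg, map_neg]

theorem MinusReg.dagOrdW_le {as : List S.AffRoot} {g : S.What} {c : S.K} {b : S.Wt}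
    (h : S.MinusReg as g c) (hb : ∀ ν y, S.psi ν as y = S.twoRho ν (y • b)) (ν : S.NuR)
    (w : S.W) :
    S.ordW ν w (S.ae (S.Gam (-b))) ≤ S.dagOrdW ν w (S.ae (S.grpOp g⁻¹ * S.mulOp c)) := by
  refine (S.ordW_Gam_le (-b) ν w).trans (Finset.le_inf fun x _ => ?_)
  refine Reg.le_tOrd (e := fun ν => S.twoRho ν (w⁻¹ • - -b))
    (reg_coeff_ae_grpOp_mul_mulOp ?_) ν
  have : (x.2 * w)⁻¹ * x.2 = w⁻¹ := by group
  rw [this]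
  refine (h w⁻¹).mono fun ν => le_of_eq ?_
  beta_reduce
  rw [hb, neg_neg]

/-- Multiplication by b adds the exponent 2(ρ_ν^∨, y(b)) = ψ(y), which compensates the bound in
`PlusReg` exactly. -/
theorem PlusReg.exists_hasRE {as : List S.AffRoot} {g : S.What} {c : S.K} {b : S.Wt}
    (h : S.PlusReg as g c) (hb : ∀ ν y, S.psi ν as y = S.twoRho ν (y • b)) :
    ∃ L, S.HasRE (S.grpOp (S.tr b) * SkewMonoidAlgebra.single g c) L := by
  refine S.exists_hasRE fun x u => Reg.hasTLimit ?_
  unfold grpOp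
  rw [single_mul_single_K, one_mul]
  refine reg_coeff_ae_single fun _ => ?_
  rw [smul_smul, fin_mul, mul_smul, rhoShift_tr_smul, right_tr, mul_one]
  refine ((h u⁻¹).smul _).mono fun ν => le_of_eq ?_
  beta_reduce
  rw [hb, tra_mul, tra_tr, right_tr, one_smul, smul_add, map_add, Pi.zero_apply]; ring

theorem MinusReg.exists_hasRE {as : List S.AffRoot} {g : S.What} {c : S.K} {b : S.Wt}
    (h : S.MinusReg as g c) (hb : ∀ ν y, S.psi ν as y = S.twoRho ν (y • b)) :
    ∃ L, S.HasRE (S.grpOp g⁻¹ * S.mulOp c * S.grpOp (S.tr b)⁻¹) L := by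
  refine S.exists_hasRE fun x u => Reg.hasTLimit ?_
  rw [mul_assoc, mulOp_mul_grpOp_comm, ← mul_assoc, grpOp_mul_grpOp, ← mul_inv_rev, inv_inv]
  refine reg_coeff_ae_grpOp_mul_mulOp ?_
  generalize u⁻¹ * x.2 = y
  rw [smul_smul, fin_mul, mul_smul, rhoShift_tr_smul, right_tr, mul_one]
  refine ((h y).smul _).mono fun ν => le_of_eq ?_
  beta_reduce
  rw [hb, tra_mul, tra_tr, right_tr, one_smul, smul_add, map_add, Pi.zero_apply]; ring

end

section

/-! ### The operators `T_i` and the `G`-binomials -/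

theorem op_neg_mul (A B : S.Op) : -A * B = -(A * B) := neg_mul (α := S.Op) A B

theorem op_sub_eq (A B : S.Op) : A - B = A + -B := sub_eq_add_neg A B

theorem mulOp_add (c d : S.K) : S.mulOp (c + d) = S.mulOp c + S.mulOp d :=
  SkewMonoidAlgebra.single_add _ _ _

theorem mulOp_one : S.mulOp 1 = 1 := rfl

theorem mulOp_zero : S.mulOp 0 = 0 := SkewMonoidAlgebra.single_zero _

theorem grpOp_mul_mulOp_comm (g : S.What) (c : S.K) :
    S.grpOp g * S.mulOp c = S.mulOp (g • c) * S.grpOp g := by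
  rw [grpOp_mul_mulOp, mulOp_mul_grpOp]

theorem grpOp_mul_GPlus (g : S.What) (a : S.AffRoot) :
    S.grpOp g * S.GPlus a = S.GPlus (S.actAff g a) * S.grpOp g := by
  unfold GPlus termF termPlus
  rw [mul_add, add_mul, ← mul_assoc, grpOp_mul_mulOp_comm, grpOp_mul_mulOp_comm, smul_mul_K,
    smul_mul_K, smul_inv_K, smul_tAff, smul_f, smul_g, tAff_actAff, mul_assoc, mul_assoc,
    grpOp_mul_grpOp, grpOp_mul_grpOp, sAff_actAff, inv_mul_cancel_right]

theorem grpOp_mul_GMinus (g : S.What) (a : S.AffRoot) :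
    S.grpOp g * S.GMinus a = S.GMinus (S.actAff g a) * S.grpOp g := by
  unfold GMinus termF termMinus
  rw [mul_add, add_mul, op_mul_neg, op_neg_mul, ← mul_assoc, grpOp_mul_grpOp,
    grpOp_mul_mulOp_comm, smul_mul_K, smul_inv_K, smul_tAff, smul_f, tAff_actAff,
    mul_assoc (S.grpOp (S.sAff (S.actAff g a))), ← S.tAff_actAff g a, ← smul_g]
  have : S.mulOp ((S.tAff (S.actAff g a))⁻¹ * g • S.g a) * S.grpOp g =
      S.grpOp g * S.mulOp ((S.tAff (S.actAff g a))⁻¹ * S.g a) := by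
    rw [grpOp_mul_mulOp_comm, smul_mul_K, smul_inv_K, smul_tAff]
  rw [this, ← mul_assoc, grpOp_mul_grpOp, sAff_actAff, inv_mul_cancel_right]

theorem XAff_negAff (a : S.AffRoot) : S.XAff (S.negAff a) = (S.XAff a)⁻¹ := by
  unfold XAff
  rw [← mono_neg]
  congr 1
  have h : S.nuExp (S.ng a.1) = S.nuExp a.1 := Subtype.ext (S.nu_ng a.1)
  refine Prod.ext (S.rootWt_ng a.1) (Prod.ext ?_ neg_zero.symm)
  change -a.2 • S.nuExp (S.ng a.1) = -(a.2 • S.nuExp a.1)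
  rw [h, neg_smul]

theorem XAff_ne_zero (a : S.AffRoot) : S.XAff a ≠ 0 := S.mono_ne_zero _

theorem f_negAff (a : S.AffRoot) : (S.tAff (S.negAff a))⁻¹ * S.f (S.negAff a) =
    S.tAff a + S.hecke a * (S.XAff a - 1)⁻¹ := by
  unfold f hecke
  rw [tAff_negAff, XAff_negAff, inv_inv]
  have h1 := S.tAff_ne_zero a
  have h2 := sub_ne_zero.2 (S.XAff_ne_one a)
  generalize S.XAff a = X at *
  generalize S.tAff a = t at *
  field_simp
  ring

theorem g_negAff (a : S.AffRoot) : (S.tAff (S.negAff a))⁻¹ * S.g (S.negAff a) =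
    -(S.hecke a * (S.XAff a - 1)⁻¹) := by
  unfold Setup.g hecke
  rw [tAff_negAff, XAff_negAff, inv_inv, ← neg_sub (S.XAff a) 1]
  have h1 := S.tAff_ne_zero a
  have h2 := sub_ne_zero.2 (S.XAff_ne_one a)
  generalize S.XAff a = X at *
  generalize S.tAff a = t at *
  field_simp

theorem g_eq (a : S.AffRoot) : (S.tAff a)⁻¹ * S.g a =
    S.hecke a * (S.XAff a - 1)⁻¹ + S.hecke a := by
  unfold Setup.g hecke
  have h1 := S.tAff_ne_zero a
  have h2 := sub_ne_zero.2 (S.XAff_ne_one a)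
  have h3 := S.XAff_ne_zero a
  generalize S.XAff a = X at *
  generalize S.tAff a = t at *
  have h4 : (1 - X⁻¹) = (X - 1) * X⁻¹ := by
    rw [sub_mul, mul_inv_cancel₀ h3, one_mul]
  rw [h4]
  field_simp
  ring

theorem T_eq (i : S.AffIdx) : S.T i =
    S.mulOp (S.tAff (S.simple i) + S.hecke (S.simple i) * (S.XAff (S.simple i) - 1)⁻¹) *
      S.grpOp (S.s i) + S.mulOp (-(S.hecke (S.simple i) * (S.XAff (S.simple i) - 1)⁻¹)) := by
  unfold T
  rw [mulOp_add, add_mul, op_sub_eq, mul_add, op_mul_neg, mul_one, mulOp_neg, add_assoc]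

theorem TInv_eq (i : S.AffIdx) : S.TInv i =
    S.mulOp (S.tAff (S.simple i) + S.hecke (S.simple i) * (S.XAff (S.simple i) - 1)⁻¹) *
      S.grpOp (S.s i) + S.mulOp (-((S.tAff (S.simple i))⁻¹ * S.g (S.simple i))) := by
  unfold TInv
  rw [T_eq, g_eq, neg_add, op_sub_eq, add_assoc, ← mulOp_neg, ← mulOp_add]

theorem smul_negAff_f (a : S.AffRoot) : S.sAff a • ((S.tAff a)⁻¹ * S.f a) =
    (S.tAff (S.negAff a))⁻¹ * S.f (S.negAff a) := by
  rw [smul_mul_K, smul_inv_K, smul_tAff, smul_f, actAff_sAff_self, tAff_negAff]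

theorem smul_negAff_g (a : S.AffRoot) : S.sAff a • ((S.tAff a)⁻¹ * S.g a) =
    (S.tAff (S.negAff a))⁻¹ * S.g (S.negAff a) := by
  rw [smul_mul_K, smul_inv_K, smul_tAff, smul_g, actAff_sAff_self, tAff_negAff]

/-- The coefficients of T_i are the f and g of -α_i up to t_i^{-1/2}. Moving s_i to the left turns
-α_i into α_i. -/
theorem T_eq_grpOp_mul_GPlus (i : S.AffIdx) :
    S.T i = S.grpOp (S.s i) * S.GPlus (S.simple i) := by
  unfold GPlus termF termPlus
  rw [T_eq, ← f_negAff, ← g_negAff, ← smul_negAff_f, ← smul_negAff_g, mul_add, ← mul_assoc,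
    grpOp_mul_mulOp_comm, grpOp_mul_mulOp_comm, mul_assoc (S.mulOp _) (S.grpOp (S.s i)),
    grpOp_mul_grpOp]
  change _ = _ + _ * S.grpOp (S.s i * S.s i)
  rw [s_mul_self, grpOp_one, mul_one]
  rfl

theorem TInv_eq_GMinus_mul_grpOp (i : S.AffIdx) :
    S.TInv i = S.GMinus (S.negAff (S.simple i)) * S.grpOp (S.s i) := by
  unfold GMinus termF termMinus
  have h : S.sAff (S.simple i) = S.s i := rfl
  rw [TInv_eq, ← f_negAff, add_mul, op_neg_mul, sAff_negAff, grpOp_mul_mulOp_comm, mul_assoc,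
    grpOp_mul_grpOp, ← smul_negAff_g, smul_smul, h, s_mul_self, one_smul, grpOp_one, mul_one,
    mulOp_neg]

theorem mulOp_grpOp_add_mul (i : S.AffIdx) (A B C : S.K) :
    (S.mulOp A * S.grpOp (S.s i) + S.mulOp B) * (S.mulOp A * S.grpOp (S.s i) + S.mulOp C) =
      S.mulOp (A * S.s i • A + B * C) + S.mulOp (A * (S.s i • C + B)) * S.grpOp (S.s i) := by
  have h1 : S.mulOp A * S.grpOp (S.s i) * (S.mulOp A * S.grpOp (S.s i)) =
      S.mulOp (A * S.s i • A) := by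
    rw [mul_assoc, ← mul_assoc (S.grpOp _), grpOp_mul_mulOp_comm, mul_assoc (S.mulOp _) (S.grpOp _),
      grpOp_mul_grpOp, s_mul_self, grpOp_one, mul_one, mulOp_mul_mulOp]
  have h2 : S.mulOp A * S.grpOp (S.s i) * S.mulOp C =
      S.mulOp (A * S.s i • C) * S.grpOp (S.s i) := by
    rw [mul_assoc, grpOp_mul_mulOp_comm, ← mul_assoc, mulOp_mul_mulOp]
  have h3 : S.mulOp B * (S.mulOp A * S.grpOp (S.s i)) = S.mulOp (A * B) * S.grpOp (S.s i) := by
    rw [← mul_assoc, mulOp_mul_mulOp, mul_comm]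
  rw [add_mul, mul_add, mul_add, h1, h2, h3, mulOp_mul_mulOp, mul_add, mulOp_add, mulOp_add,
    add_mul]
  abel

theorem smul_kappa (i : S.AffIdx) :
    S.s i • (S.hecke (S.simple i) * (S.XAff (S.simple i) - 1)⁻¹) =
      S.hecke (S.simple i) * ((S.XAff (S.simple i))⁻¹ - 1)⁻¹ := by
  unfold hecke s
  rw [smul_mul_K, smul_inv_K, smul_sub_K, smul_sub_K, smul_inv_K, smul_tAff, smul_one_K, smul_XAff,
    actAff_sAff_self, XAff_negAff]

theorem smul_add_K (g : S.What) (c d : S.K) : g • (c + d) = g • c + g • d :=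
  RingEquiv.map_add (fracMap (S.actEquiv g)) c d

theorem smul_neg_K (g : S.What) (c : S.K) : g • (-c) = -(g • c) :=
  RingEquiv.map_neg (fracMap (S.actEquiv g)) c

/-- Both operators are As_i plus a function, with the same A, so the claim is a pair of identities
between rational functions for each order of the factors. -/
theorem T_mul_TInv_and (i : S.AffIdx) : S.T i * S.TInv i = 1 ∧ S.TInv i * S.T i = 1 := by
  rw [TInv_eq, T_eq, g_eq, mulOp_grpOp_add_mul, mulOp_grpOp_add_mul]
  simp only [smul_add_K, smul_neg_K, smul_kappa]
  rw [show S.s i • S.tAff (S.simple i) = S.tAff (S.simple i) from S.smul_tAff _ _,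
    show S.s i • S.hecke (S.simple i) = S.hecke (S.simple i) by
      unfold hecke; rw [smul_sub_K, smul_inv_K, smul_tAff]]
  unfold hecke
  have h1 := S.tAff_ne_zero (S.simple i)
  have h2 := sub_ne_zero.2 (S.XAff_ne_one (S.simple i))
  have h3 := S.XAff_ne_zero (S.simple i)
  generalize S.XAff (S.simple i) = X at *
  generalize S.tAff (S.simple i) = t at *
  -- This expresses the image of (X - 1)⁻¹ under s_i through (X - 1)⁻¹ itself. What remains is
  -- polynomial in t, t⁻¹ and (X - 1)⁻¹, modulo t⁻¹t = 1.
  have h4 : (X⁻¹ - 1)⁻¹ = -(1 + (X - 1)⁻¹) := by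
    have h5 : X⁻¹ - 1 = -((X - 1) * X⁻¹) := by
      rw [sub_mul, mul_inv_cancel₀ h3, one_mul, neg_sub]
    rw [h5]
    field_simp
    ring
  rw [h4]
  have h6 : (X - 1)⁻¹ * (X - 1) = 1 := inv_mul_cancel₀ h2
  have h7 : t⁻¹ * t = 1 := inv_mul_cancel₀ h1
  generalize (X - 1)⁻¹ = k at *
  generalize t⁻¹ = r at *
  constructor
  · rw [← S.mulOp_one, ← add_zero (S.mulOp 1), ← zero_mul (S.grpOp (S.s i)), ← S.mulOp_zero]
    congr 2
    · linear_combination h7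
    · congr 1; ring
  · rw [← S.mulOp_one, ← add_zero (S.mulOp 1), ← zero_mul (S.grpOp (S.s i)), ← S.mulOp_zero]
    congr 2
    · linear_combination h7
    · congr 1; ring

theorem prod_T_mul_prod_TInv (js : List S.AffIdx) :
    (js.map S.T).prod * (js.reverse.map S.TInv).prod = 1 ∧
      (js.reverse.map S.TInv).prod * (js.map S.T).prod = 1 := by
  induction js with
  | nil => exact ⟨mul_one _, mul_one _⟩
  | cons j js ih =>
    rw [List.reverse_cons, List.map_append, List.prod_append, List.map_cons, List.prod_cons,
      List.map_cons, List.map_nil, List.prod_singleton]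
    constructor
    · rw [mul_assoc, ← mul_assoc _ _ (S.TInv j), ih.1, one_mul, (S.T_mul_TInv_and j).1]
    · rw [mul_assoc, ← mul_assoc (S.TInv j), (S.T_mul_TInv_and j).2, one_mul, ih.2]

theorem word_cons (j : S.AffIdx) (js : List S.AffIdx) : S.word (j :: js) = S.s j * S.word js :=
  List.prod_cons

theorem lamSeq_cons (j : S.AffIdx) (js : List S.AffIdx) :
    S.lamSeq (j :: js) = S.actAff (S.word js)⁻¹ (S.simple j) :: S.lamSeq js := rfl

/-- Collecting the group elements on the left, the factor G⁺ of α_j crosses the word to its right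
and becomes the factor of the corresponding α̃^p. -/
theorem prod_T (js : List S.AffIdx) :
    (js.map S.T).prod = S.grpOp (S.word js) * ((S.lamSeq js).map S.GPlus).prod := by
  induction js with
  | nil => exact (mul_one _).symm
  | cons j js ih =>
    rw [List.map_cons, List.prod_cons, ih, T_eq_grpOp_mul_GPlus, lamSeq_cons, List.map_cons,
      List.prod_cons, word_cons, ← grpOp_mul_grpOp, mul_assoc, mul_assoc,
      ← mul_assoc _ (S.GPlus _) (List.prod _), grpOp_mul_GPlus, actAff_actAff_inv]
    simp only [mul_assoc]

theorem prod_TInv (js : List S.AffIdx) : (js.reverse.map S.TInv).prod =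
    (((S.lamSeq js).reverse.map S.negAff).map S.GMinus).prod * S.grpOp (S.word js)⁻¹ := by
  induction js with
  | nil =>
    change (1 : S.Op) = 1 * S.grpOp 1⁻¹
    rw [inv_one, grpOp_one, mul_one]
  | cons j js ih =>
    have hs : (S.s j)⁻¹ = S.s j := S.sAff_inv _
    rw [List.reverse_cons, List.map_append, List.prod_append, ih, lamSeq_cons, List.reverse_cons,
      List.map_append, List.map_append, List.prod_append, word_cons, mul_inv_rev, hs]
    simp only [List.map_cons, List.map_nil, List.prod_singleton]
    rw [TInv_eq_GMinus_mul_grpOp, mul_assoc, ← mul_assoc (S.grpOp _) (S.GMinus _),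
      grpOp_mul_GMinus, actAff_negAff, mul_assoc, mul_assoc, grpOp_mul_grpOp]

theorem Y_mul_YInv (π : S.What) (js : List S.AffIdx) : S.Y π js * S.YInv π js = 1 := by
  unfold Y YInv
  rw [mul_assoc, ← mul_assoc (List.prod _), (S.prod_T_mul_prod_TInv js).1, one_mul, grpOp_mul_inv]

theorem YInv_mul_Y (π : S.What) (js : List S.AffIdx) : S.YInv π js * S.Y π js = 1 := by
  unfold Y YInv
  rw [mul_assoc, ← mul_assoc (S.grpOp _), grpOp_inv_mul, one_mul, (S.prod_T_mul_prod_TInv js).2]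

theorem inv_mul_Y {g π : S.What} {js : List S.AffIdx} (h : g = π * S.word js) :
    S.grpOp g⁻¹ * S.Y π js = ((S.lamSeq js).map S.GPlus).prod := by
  unfold Y
  rw [prod_T, ← mul_assoc, ← mul_assoc, grpOp_mul_grpOp, grpOp_mul_grpOp, mul_assoc, ← h,
    inv_mul_cancel, grpOp_one, one_mul]

theorem YInv_mul {g π : S.What} {js : List S.AffIdx} (h : g = π * S.word js) :
    S.YInv π js * S.grpOp g = (((S.lamSeq js).reverse.map S.negAff).map S.GMinus).prod := by
  unfold YInv
  rw [prod_TInv, mul_assoc, mul_assoc, grpOp_mul_grpOp, grpOp_mul_grpOp, ← mul_assoc,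
    ← mul_inv_rev, ← h, inv_mul_cancel, grpOp_one, mul_one]

/-- A property of operators that is closed under sums holds for a product of binomials as soon as
it holds for all products of terms of these binomials. -/
theorem prod_binomials_induction {Q : S.Op → Prop} (hQ : ∀ A B, Q A → Q B → Q (A + B))
    (F G : S.AffRoot → S.Op) (C : S.Op) (as : List S.AffRoot) (A : S.Op)
    (h : ∀ hs : List S.Op, List.Forall₂ (fun x a => x = F a ∨ x = G a) hs as →
      Q (A * hs.prod * C)) :
    Q (A * (as.map fun a => F a + G a).prod * C) := by
  induction as generalizing A with
  | nil => exact h [] List.Forall₂.nil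
  | cons a as ih =>
    rw [List.map_cons, List.prod_cons, add_mul, mul_add, add_mul, ← mul_assoc, ← mul_assoc]
    refine hQ _ _ (ih _ fun hs hf => ?_) (ih _ fun hs hf => ?_)
    · rw [mul_assoc A, ← List.prod_cons]
      exact h _ (List.Forall₂.cons (Or.inl rfl) hf)
    · rw [mul_assoc A, ← List.prod_cons]
      exact h _ (List.Forall₂.cons (Or.inr rfl) hf)

end

end Setup

end TodaDunkl

end

theorem corollary5p2 {ι M N : Type*} [Fintype ι] [AddCommGroup M] [Module ℝ M]
    [AddCommGroup N] [Module ℝ N] (S : TodaDunkl.Setup ι M N)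
    (b : S.Wt) (hb : S.IsDominant b)
    (π : S.What) (js : List S.AffIdx) (hred : S.IsReducedDec (S.tr b) π js) :
    -- `Y_b Y_b⁻¹ = Y_b⁻¹ Y_b = 1`
    S.Y π js * S.YInv π js = 1 ∧ S.YInv π js * S.Y π js = 1 ∧
    -- the `G`-expansions
    S.grpOp (S.tr b)⁻¹ * S.Y π js = ((S.lamSeq js).map S.GPlus).prod ∧
    S.YInv π js * S.grpOp (S.tr b) =
      (((S.lamSeq js).reverse.map S.negAff).map S.GMinus).prod ∧
    -- the orders of the individual products
    (∀ h : S.Op, S.IsPlusProduct (S.lamSeq js) h → ∀ (ν : S.NuR) (w : S.W),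
      S.ordW ν w (S.ae (S.Gam b)) ≤ S.ordW ν w (S.ae h)) ∧
    (∀ h : S.Op, S.IsMinusProduct ((S.lamSeq js).reverse.map S.negAff) h →
      ∀ (ν : S.NuR) (w : S.W),
        S.ordW ν w (S.ae (S.Gam (-b))) ≤ S.dagOrdW ν w (S.ae h)) ∧
    -- existence and invertibility of the limits
    (∃ Yhat Yhat' : S.SpinOp,
      (∀ L, S.HasRE (S.Y π js) L ↔ L = Yhat) ∧
      (∀ L, S.HasRE (S.YInv π js) L ↔ L = Yhat') ∧
      Yhat * Yhat' = 1 ∧ Yhat' * Yhat = 1) ∧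
    -- existence of the limits of the individual products
    (∀ h : S.Op, S.IsPlusProduct (S.lamSeq js) h →
      ∃! L : S.SpinOp, S.HasRE (S.grpOp (S.tr b) * h) L) ∧
    (∀ h : S.Op, S.IsMinusProduct ((S.lamSeq js).reverse.map S.negAff) h →
      ∃! L : S.SpinOp, S.HasRE (h * S.grpOp (S.tr b)⁻¹) L) := by
  have hpos : ∀ a ∈ S.lamSeq js, S.base.IsPos a.1 := fun a ha => S.isPos_of_mem_lamSeq hb hred ha
  have hpsi : ∀ ν y, S.psi ν (S.lamSeq js) y = S.twoRho ν (y • b) :=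
    fun ν y => S.psi_eq_twoRho hred ν y
  have hG := S.inv_mul_Y hred.2.1
  have hG' := S.YInv_mul hred.2.1
  have hplus : ∀ h : S.Op, S.IsPlusProduct (S.lamSeq js) h →
      ∃ L : S.SpinOp, S.HasRE (S.grpOp (S.tr b) * h) L := fun h hh => by
    obtain ⟨g, c, rfl, hreg⟩ := hh.exists_single hpos
    exact hreg.exists_hasRE hpsi
  have hminus : ∀ h : S.Op, S.IsMinusProduct ((S.lamSeq js).reverse.map S.negAff) h →
      ∃ L : S.SpinOp, S.HasRE (h * S.grpOp (S.tr b)⁻¹) L := fun h hh => by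
    obtain ⟨g, c, rfl, hreg⟩ := hh.exists_single hpos
    exact hreg.exists_hasRE hpsi
  have hadd : ∀ A B : S.Op, (∃ L, S.HasRE A L) → (∃ L, S.HasRE B L) → ∃ L, S.HasRE (A + B) L := by
    rintro A B ⟨L, hL⟩ ⟨L', hL'⟩
    exact ⟨_, hL.add hL'⟩
  refine ⟨S.Y_mul_YInv π js, S.YInv_mul_Y π js, hG, hG', fun h hh ν w => ?_, fun h hh ν w => ?_,
    ?_, fun h hh => ?_, fun h hh => ?_⟩
  · obtain ⟨g, c, rfl, hreg⟩ := hh.exists_single hpos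
    exact hreg.ordW_le hpsi ν w
  · obtain ⟨g, c, rfl, hreg⟩ := hh.exists_single hpos
    exact hreg.dagOrdW_le hpsi ν w
  -- Y_b = b(b⁻¹Y_b) is the sum of the products b h, all of which have limits. Y_b⁻¹ is treated
  -- likewise with b⁻¹ on the right.
  · have hY : ∃ L, S.HasRE (S.Y π js) L := by
      have := S.prod_binomials_induction hadd S.termF S.termPlus 1 (S.lamSeq js)
        (S.grpOp (S.tr b)) fun hs hf => by
          rw [mul_one]; exact hplus _ ⟨hs, hf, rfl⟩
      rw [mul_one] at this
      change ∃ L, S.HasRE (_ * ((S.lamSeq js).map S.GPlus).prod) L at this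
      rwa [← hG, ← mul_assoc, S.grpOp_mul_inv, one_mul] at this
    have hY' : ∃ L, S.HasRE (S.YInv π js) L := by
      have := S.prod_binomials_induction hadd S.termF S.termMinus (S.grpOp (S.tr b)⁻¹)
        ((S.lamSeq js).reverse.map S.negAff) 1 fun hs hf => by
          rw [one_mul]; exact hminus _ ⟨hs, hf, rfl⟩
      rw [one_mul] at this
      change ∃ L, S.HasRE ((((S.lamSeq js).reverse.map S.negAff).map S.GMinus).prod * _) L at this
      rwa [← hG', mul_assoc, S.grpOp_mul_inv, mul_one] at this
    obtain ⟨L, hL⟩ := hY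
    obtain ⟨L', hL'⟩ := hY'
    refine ⟨L, L', fun A => ⟨fun h => h.unique hL, fun h => h ▸ hL⟩,
      fun A => ⟨fun h => h.unique hL', fun h => h ▸ hL'⟩, ?_, ?_⟩
    -- The product of the limits is a limit of Y_bY_b⁻¹ = 1, hence equals 1 by uniqueness.
    · have := hL.mul hL'
      rw [S.Y_mul_YInv] at this
      exact this.unique TodaDunkl.Setup.hasRE_one
    · have := hL'.mul hL
      rw [S.YInv_mul_Y] at this
      exact this.unique TodaDunkl.Setup.hasRE_one
  · obtain ⟨L, hL⟩ := hplus h hh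
    exact ⟨L, hL, fun A hA => hA.unique hL⟩
  · obtain ⟨L, hL⟩ := hminus h hh
    exact ⟨L, hL, fun A hA => hA.unique hL⟩
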